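/- Let $C = (C^1 \xrightarrow{d} C^2 \xrightarrow{d} C^3)$ be a 3-term cochain complex of abelian groups ($d\circ d=0$), with cohomology groups $H^1(C)=\ker(C^1\to C^2)$, $H^2(C)=\ker(C^2\to C^3)/\operatorname{im}(C^1\to C^2)$, $H^3(C)=C^3/\operatorname{im}(C^2\to C^3)$. Let $D(C)$ be the following strict symmetric monoidal bicategory. Its objects are the elements of $C^3$; a 1-morphism $x\to y$ is an element $c\in C^2$ with $y=x+dc$; a 2-morphism $c\Rightarrow c'$ between 1-morphisms $x\to y$ is an element $e\in C^1$ with $c'=c+de$. All compositions are given by addition, the tensor product is addition of objects, of 1-morphisms and of 2-morphisms, and the associativity, unit and symmetry constraints are identities. A cochain map $f\colon C\to C'$ induces a (strict) pseudofunctor $D(f)\colon D(C)\to D(C')$. For an abelian group $M$ write $M$, $M[1]$, $M[2]$ for $D$ of the complex with $M$ in degree $3$, $2$, $1$ respectively and zero elsewhere, and put $\operatorname{Split}(C)=H^3(C)\times H^2(C)[1]\times H^1(C)[2]$, the product symmetric monoidal bicategory; $f$ induces $\operatorname{Split}(f)\colon\operatorname{Split}(C)\to\operatorname{Split}(C')$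 through the maps on cohomology. An equivalence of symmetric monoidal bicategories consists of symmetric monoidal pseudofunctors in both directions together with symmetric monoidal pseudonatural transformations, with equivalences as components, between the two composites and the identities. Then: 1. For every $C$ there is an equivalence of symmetric monoidal bicategories $D(C)\simeq H^3(C)\times H^2(C)[1]\times H^1(C)[2]$. 2. These equivalences cannot be chosen naturally: there is no family of equivalences of symmetric monoidal bicategories $\Phi_C\colon D(C)\to \operatorname{Split}(C)$, one for each $C$, such that for every cochain map $f\colon C\to C'$ the pseudofunctors underlying $\Phi_{C'}\circ D(f)$ and $\operatorname{Split}(f)\circ\Phi_C$ are pseudonaturally equivalent. 3. Nevertheless there is a natural isomorphism $\pi_0(D(C))\cong H^3(C)$: writing $\pi_0(D(C))$ for the equivalence classes of objects of $D(C)$ with the addition induced by the tensor product, there are additive isomorphisms $\varphi_C\colon\pi_0(D(C))\to H^3(C)$, one for each $C$, with $\varphi_{C'}\circ\pi_0(D(f))=H^3(f)\circ\varphi_C$ for every cochain map $f\colon C\to C'$. -/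

import Mathlib

open CategoryTheory CategoryTheory.Bicategory

universe w v u w₁ v₁ u₁ w₂ v₂ u₂ w₃ v₃ u₃

namespace SymBicat

/-! ### Squares of invertible 2-cells -/

section Squares

variable {B : Type u} [Bicategory.{w, v} B]

/-- A 1-morphism is an equivalence if it is part of an adjoint equivalence. -/
def IsEquiv {a b : B} (f : a ⟶ b) : Prop := ∃ e : a ≌ b, e.hom = f

/-- Stack two squares `f ≫ t' ≅ t ≫ g` and `g ≫ s' ≅ s ≫ h` along `g`. -/
def sqV {a a' b b' c c' : B} {f : a ⟶ a'} {t : a ⟶ b} {t' : a' ⟶ b'} {g : b ⟶ b'}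
    {s : b ⟶ c} {s' : b' ⟶ c'} {h : c ⟶ c'}
    (p : f ≫ t' ≅ t ≫ g) (q : g ≫ s' ≅ s ≫ h) : f ≫ t' ≫ s' ≅ (t ≫ s) ≫ h :=
  (α_ _ _ _).symm ≪≫ p ▷ᵢ s' ≪≫ α_ _ _ _ ≪≫ t ◁ᵢ q ≪≫ (α_ _ _ _).symm

/-- Juxtapose two squares `f ≫ t' ≅ t ≫ g` and `f₂ ≫ t'' ≅ t' ≫ g₂` along `t'`. -/
def sqH {a a' a'' b b' b'' : B} {f : a ⟶ a'} {f₂ : a' ⟶ a''} {t : a ⟶ b} {t' : a' ⟶ b'}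
    {t'' : a'' ⟶ b''} {g : b ⟶ b'} {g₂ : b' ⟶ b''}
    (p : f ≫ t' ≅ t ≫ g) (q : f₂ ≫ t'' ≅ t' ≫ g₂) : (f ≫ f₂) ≫ t'' ≅ t ≫ g ≫ g₂ :=
  α_ _ _ _ ≪≫ f ◁ᵢ q ≪≫ (α_ _ _ _).symm ≪≫ p ▷ᵢ g₂ ≪≫ α_ _ _ _

/-- The square on `f` with identity sides. -/
def sqId {a a' : B} (f : a ⟶ a') : f ≫ 𝟙 a' ≅ 𝟙 a ≫ f := ρ_ f ≪≫ (λ_ f).symm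

/-- The square on `t` with identity top and bottom. -/
def sqOne {a b : B} (t : a ⟶ b) : 𝟙 a ≫ t ≅ t ≫ 𝟙 b := λ_ t ≪≫ (ρ_ t).symm

/-- The mate of a square whose sides are adjoint equivalences. -/
def sqMate {a a' b b' : B} {f : a ⟶ a'} {g : b ⟶ b'} (e : a ≌ b) (e' : a' ≌ b')
    (p : f ≫ e'.hom ≅ e.hom ≫ g) : g ≫ e'.inv ≅ e.inv ≫ f :=
  Iso.refl (g ≫ e'.inv) ≪⊗≫ e.counit.symm ▷ᵢ (g ≫ e'.inv) ≪⊗≫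
    e.inv ◁ᵢ (p.symm ▷ᵢ e'.inv) ≪⊗≫ (e.inv ≫ f) ◁ᵢ e'.unit.symm ≪⊗≫ Iso.refl (e.inv ≫ f)

/-- The modification axiom: 2-cells `m : t ≅ s`, `m' : t' ≅ s'` intertwine two squares with the
same top `f` and bottom `g`. -/
def Compat {a a' b b' : B} {f : a ⟶ a'} {g : b ⟶ b'} {t s : a ⟶ b} {t' s' : a' ⟶ b'}
    (p : f ≫ t' ≅ t ≫ g) (q : f ≫ s' ≅ s ≫ g) (m : t ≅ s) (m' : t' ≅ s') : Prop :=
  p ≪≫ m ▷ᵢ g = f ◁ᵢ m' ≪≫ q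

variable {C : Type u₁} [Bicategory.{w₁, v₁} C] (F : B ⥤ᵖ C)

/-- The image of a square under a pseudofunctor. -/
def sqMap {a a' b b' : B} {f : a ⟶ a'} {t : a ⟶ b} {t' : a' ⟶ b'} {g : b ⟶ b'}
    (p : f ≫ t' ≅ t ≫ g) : F.map f ≫ F.map t' ≅ F.map t ≫ F.map g :=
  (F.mapComp _ _).symm ≪≫ F.map₂Iso p ≪≫ F.mapComp _ _

def fun2 {a b c : B} (f : a ⟶ b) (g : b ⟶ c) : F.map f ≫ F.map g ≅ F.map (f ≫ g) :=
  (F.mapComp f g).symm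

def fun3 {a b c d : B} (f : a ⟶ b) (g : b ⟶ c) (h : c ⟶ d) :
    F.map f ≫ F.map g ≫ F.map h ≅ F.map (f ≫ g ≫ h) :=
  F.map f ◁ᵢ fun2 F g h ≪≫ fun2 F f (g ≫ h)

def funUnit {a b : B} (e : a ≌ b) : F.map e.hom ≫ F.map e.inv ≅ 𝟙 (F.obj a) :=
  fun2 F _ _ ≪≫ F.map₂Iso e.unit.symm ≪≫ F.mapId a

end Squares

/-! ### The tensor product -/

/-- A bicategory with a tensor product and a unit object. -/
class TensorBicat (B : Type u) [Bicategory.{w, v} B] where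
  tensor : (B × B) ⥤ᵖ B
  unit : B

section Tensor

variable {B : Type u} [Bicategory.{w, v} B] [TensorBicat B]

variable (B) in
def one : B := TensorBicat.unit

def tensorObj (a b : B) : B := (TensorBicat.tensor (B := B)).obj (a, b)

infixl:70 " ⊠ " => tensorObj

def tensorHom {a a' b b' : B} (f : a ⟶ a') (g : b ⟶ b') : a ⊠ b ⟶ a' ⊠ b' :=
  (TensorBicat.tensor (B := B)).map (Prod.mkHom f g)

infixl:85 " ⊠₁ " => tensorHom

def tensorHom₂ {a a' b b' : B} {f f' : a ⟶ a'} {g g' : b ⟶ b'} (η : f ⟶ f') (θ : g ⟶ g') :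
    f ⊠₁ g ⟶ f' ⊠₁ g' :=
  (TensorBicat.tensor (B := B)).map₂ (Prod.mkHom η θ)

def tensorIso {a a' b b' : B} {f f' : a ⟶ a'} {g g' : b ⟶ b'} (η : f ≅ f') (θ : g ≅ g') :
    f ⊠₁ g ≅ f' ⊠₁ g' :=
  (TensorBicat.tensor (B := B)).map₂Iso (Iso.prod η θ)

infixl:85 " ⊠₂ " => tensorIso

def tensorId (a b : B) : 𝟙 a ⊠₁ 𝟙 b ≅ 𝟙 (a ⊠ b) :=
  (TensorBicat.tensor (B := B)).mapId (a, b)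

def tensorComp {a a' a'' b b' b'' : B} (f : a ⟶ a') (f' : a' ⟶ a'') (g : b ⟶ b')
    (g' : b' ⟶ b'') : (f ≫ f') ⊠₁ (g ≫ g') ≅ f ⊠₁ g ≫ f' ⊠₁ g' :=
  (TensorBicat.tensor (B := B)).mapComp (Prod.mkHom f g) (Prod.mkHom f' g')

/-- Whiskering a 1-morphism by an object on the right: `f ⊗ c`. -/
abbrev whR {a a' : B} (f : a ⟶ a') (c : B) : a ⊠ c ⟶ a' ⊠ c := f ⊠₁ 𝟙 c

/-- Whiskering a 1-morphism by an object on the left: `a ⊗ f`. -/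
abbrev whL (a : B) {b b' : B} (f : b ⟶ b') : a ⊠ b ⟶ a ⊠ b' := 𝟙 a ⊠₁ f

infixl:85 " ▹ " => whR
infixr:85 " ◂ " => whL

def isoR {a a' : B} {f f' : a ⟶ a'} (η : f ≅ f') (c : B) : f ▹ c ≅ f' ▹ c := η ⊠₂ Iso.refl (𝟙 c)

def isoL (a : B) {b b' : B} {f f' : b ⟶ b'} (η : f ≅ f') : a ◂ f ≅ a ◂ f' := Iso.refl (𝟙 a) ⊠₂ η

def compR {a b c : B} (f : a ⟶ b) (g : b ⟶ c) (x : B) : f ▹ x ≫ g ▹ x ≅ (f ≫ g) ▹ x :=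
  (tensorComp f g (𝟙 x) (𝟙 x)).symm ≪≫ Iso.refl (f ≫ g) ⊠₂ λ_ (𝟙 x)

def compL (x : B) {a b c : B} (f : a ⟶ b) (g : b ⟶ c) : x ◂ f ≫ x ◂ g ≅ x ◂ (f ≫ g) :=
  (tensorComp (𝟙 x) (𝟙 x) f g).symm ≪≫ λ_ (𝟙 x) ⊠₂ Iso.refl (f ≫ g)

def compR3 {a b c d : B} (f : a ⟶ b) (g : b ⟶ c) (h : c ⟶ d) (x : B) :
    f ▹ x ≫ g ▹ x ≫ h ▹ x ≅ (f ≫ g ≫ h) ▹ x :=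
  f ▹ x ◁ᵢ compR g h x ≪≫ compR f (g ≫ h) x

def compL3 (x : B) {a b c d : B} (f : a ⟶ b) (g : b ⟶ c) (h : c ⟶ d) :
    x ◂ f ≫ x ◂ g ≫ x ◂ h ≅ x ◂ (f ≫ g ≫ h) :=
  x ◂ f ◁ᵢ compL x g h ≪≫ compL x f (g ≫ h)

def compR5 {a b c d e e' : B} (f : a ⟶ b) (g : b ⟶ c) (h : c ⟶ d) (k : d ⟶ e) (l : e ⟶ e')
    (x : B) : f ▹ x ≫ g ▹ x ≫ h ▹ x ≫ k ▹ x ≫ l ▹ x ≅ (f ≫ g ≫ h ≫ k ≫ l) ▹ x :=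
  f ▹ x ◁ᵢ (g ▹ x ◁ᵢ compR3 h k l x ≪≫ compR g (h ≫ k ≫ l) x) ≪≫ compR f (g ≫ h ≫ k ≫ l) x

def compL5 (x : B) {a b c d e e' : B} (f : a ⟶ b) (g : b ⟶ c) (h : c ⟶ d) (k : d ⟶ e)
    (l : e ⟶ e') : x ◂ f ≫ x ◂ g ≫ x ◂ h ≫ x ◂ k ≫ x ◂ l ≅ x ◂ (f ≫ g ≫ h ≫ k ≫ l) :=
  x ◂ f ◁ᵢ (x ◂ g ◁ᵢ compL3 x h k l ≪≫ compL x g (h ≫ k ≫ l)) ≪≫ compL x f (g ≫ h ≫ k ≫ l)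

/-- The interchange 2-cell. -/
def exch {a a' b b' : B} (f : a ⟶ a') (g : b ⟶ b') : f ▹ b ≫ a' ◂ g ≅ a ◂ g ≫ f ▹ b' :=
  (tensorComp _ _ _ _).symm ≪≫ (ρ_ f ≪≫ (λ_ f).symm) ⊠₂ (λ_ g ≪≫ (ρ_ g).symm) ≪≫
    tensorComp _ _ _ _

def unitR {a b : B} (e : a ≌ b) (x : B) : e.hom ▹ x ≫ e.inv ▹ x ≅ 𝟙 (a ⊠ x) :=
  compR _ _ x ≪≫ isoR e.unit.symm x ≪≫ tensorId a x

def unitL (x : B) {a b : B} (e : a ≌ b) : x ◂ e.hom ≫ x ◂ e.inv ≅ 𝟙 (x ⊠ a) :=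
  compL x _ _ ≪≫ isoL x e.unit.symm ≪≫ tensorId x a

def counitR {a b : B} (e : a ≌ b) (x : B) : e.inv ▹ x ≫ e.hom ▹ x ≅ 𝟙 (b ⊠ x) :=
  compR _ _ x ≪≫ isoR e.counit x ≪≫ tensorId b x

def counitL (x : B) {a b : B} (e : a ≌ b) : x ◂ e.inv ≫ x ◂ e.hom ≅ 𝟙 (x ⊠ b) :=
  compL x _ _ ≪≫ isoL x e.counit ≪≫ tensorId x b

/-- The tensor product of two squares. -/
def sqT {a a' b b' : B} {f : a ⟶ a'} {t : a ⟶ b} {t' : a' ⟶ b'} {g : b ⟶ b'}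
    {c c' d d' : B} {h : c ⟶ c'} {s : c ⟶ d} {s' : c' ⟶ d'} {k : d ⟶ d'}
    (p : f ≫ t' ≅ t ≫ g) (q : h ≫ s' ≅ s ≫ k) :
    f ⊠₁ h ≫ t' ⊠₁ s' ≅ t ⊠₁ s ≫ g ⊠₁ k :=
  (tensorComp _ _ _ _).symm ≪≫ p ⊠₂ q ≪≫ tensorComp _ _ _ _

/-- The square of the whiskered 1-morphisms `t ⊗ x`. -/
def sqR {a a' b b' : B} {f : a ⟶ a'} {t : a ⟶ b} {t' : a' ⟶ b'} {g : b ⟶ b'}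
    (p : f ≫ t' ≅ t ≫ g) {x x' : B} (k : x ⟶ x') : f ⊠₁ k ≫ t' ▹ x' ≅ t ▹ x ≫ g ⊠₁ k :=
  sqT p (sqId k)

/-- The square of the whiskered 1-morphisms `x ⊗ t`. -/
def sqL {x x' : B} (k : x ⟶ x') {a a' b b' : B} {f : a ⟶ a'} {t : a ⟶ b} {t' : a' ⟶ b'}
    {g : b ⟶ b'} (p : f ≫ t' ≅ t ≫ g) : k ⊠₁ f ≫ x' ◂ t' ≅ x ◂ t ≫ k ⊠₁ g :=
  sqT (sqId k) p

end Tensor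

/-! ### Symmetric monoidal bicategories -/

/-- The structure cells of a symmetric monoidal bicategory: tensor product and unit, pseudonatural
adjoint equivalences `asc` (associator), `lu`, `ru` (unitors) and `br` (braiding), and invertible
2-cells `pent` (pentagonator), `mid`, `lun`, `run` (2-unitors), `hexR`, `hexS` (hexagonators) and
`syl` (syllepsis). The 2-cells `ascN`, `luN`, `ruN`, `brN` are the pseudonaturality constraints. -/
class SymMonBicatData (B : Type u) [Bicategory.{w, v} B] extends TensorBicat B where
  asc (a b c : B) : a ⊠ b ⊠ c ≌ a ⊠ (b ⊠ c)
  ascN {a a' b b' c c' : B} (f : a ⟶ a') (g : b ⟶ b') (h : c ⟶ c') :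
    f ⊠₁ g ⊠₁ h ≫ (asc a' b' c').hom ≅ (asc a b c).hom ≫ f ⊠₁ (g ⊠₁ h)
  lu (a : B) : one B ⊠ a ≌ a
  luN {a a' : B} (f : a ⟶ a') : one B ◂ f ≫ (lu a').hom ≅ (lu a).hom ≫ f
  ru (a : B) : a ⊠ one B ≌ a
  ruN {a a' : B} (f : a ⟶ a') : f ▹ one B ≫ (ru a').hom ≅ (ru a).hom ≫ f
  pent (a b c d : B) :
    (asc a b c).hom ▹ d ≫ (asc a (b ⊠ c) d).hom ≫ a ◂ (asc b c d).hom ≅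
      (asc (a ⊠ b) c d).hom ≫ (asc a b (c ⊠ d)).hom
  mid (a b : B) : (asc a (one B) b).hom ≫ a ◂ (lu b).hom ≅ (ru a).hom ▹ b
  lun (a b : B) : (asc (one B) a b).hom ≫ (lu (a ⊠ b)).hom ≅ (lu a).hom ▹ b
  run (a b : B) : (asc a b (one B)).hom ≫ a ◂ (ru b).hom ≅ (ru (a ⊠ b)).hom
  br (a b : B) : a ⊠ b ≌ b ⊠ a
  brN {a a' b b' : B} (f : a ⟶ a') (g : b ⟶ b') :
    f ⊠₁ g ≫ (br a' b').hom ≅ (br a b).hom ≫ g ⊠₁ f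
  hexR (a b c : B) :
    (asc a b c).hom ≫ (br a (b ⊠ c)).hom ≫ (asc b c a).hom ≅
      (br a b).hom ▹ c ≫ (asc b a c).hom ≫ b ◂ (br a c).hom
  hexS (a b c : B) :
    (asc a b c).inv ≫ (br (a ⊠ b) c).hom ≫ (asc c a b).inv ≅
      a ◂ (br b c).hom ≫ (asc a c b).inv ≫ (br a c).hom ▹ b
  syl (a b : B) : (br a b).hom ≫ (br b a).hom ≅ 𝟙 (a ⊠ b)

section Derived

open SymMonBicatData

variable {B : Type u} [Bicategory.{w, v} B] [SymMonBicatData B]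

/-- The associator 1-morphism. -/
abbrev as (a b c : B) : a ⊠ b ⊠ c ⟶ a ⊠ (b ⊠ c) := (asc a b c).hom

/-- The inverse associator 1-morphism. -/
abbrev ai (a b c : B) : a ⊠ (b ⊠ c) ⟶ a ⊠ b ⊠ c := (asc a b c).inv

/-- The braiding 1-morphism. -/
abbrev bt (a b : B) : a ⊠ b ⟶ b ⊠ a := (br a b).hom

/-! Pseudonaturality of the associator, its inverse and the braiding in a single variable. -/

def asA {a a' : B} (f : a ⟶ a') (b c : B) : f ▹ b ▹ c ≫ as a' b c ≅ as a b c ≫ f ▹ (b ⊠ c) :=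
  ascN f (𝟙 b) (𝟙 c) ≪≫ as a b c ◁ᵢ (Iso.refl f ⊠₂ tensorId b c)

def asB (a : B) {b b' : B} (f : b ⟶ b') (c : B) :
    (a ◂ f) ▹ c ≫ as a b' c ≅ as a b c ≫ a ◂ (f ▹ c) :=
  ascN (𝟙 a) f (𝟙 c)

def asC (a b : B) {c c' : B} (f : c ⟶ c') :
    (a ⊠ b) ◂ f ≫ as a b c' ≅ as a b c ≫ a ◂ b ◂ f :=
  ((tensorId a b).symm ⊠₂ Iso.refl f) ▷ᵢ as a b c' ≪≫ ascN (𝟙 a) (𝟙 b) f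

def aiN {a a' b b' c c' : B} (f : a ⟶ a') (g : b ⟶ b') (h : c ⟶ c') :
    f ⊠₁ (g ⊠₁ h) ≫ ai a' b' c' ≅ ai a b c ≫ f ⊠₁ g ⊠₁ h :=
  sqMate (asc a b c) (asc a' b' c') (ascN f g h)

def aiA {a a' : B} (f : a ⟶ a') (b c : B) : f ▹ (b ⊠ c) ≫ ai a' b c ≅ ai a b c ≫ f ▹ b ▹ c :=
  sqMate (asc a b c) (asc a' b c) (asA f b c)

def aiB (a : B) {b b' : B} (f : b ⟶ b') (c : B) :
    a ◂ (f ▹ c) ≫ ai a b' c ≅ ai a b c ≫ (a ◂ f) ▹ c :=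
  sqMate (asc a b c) (asc a b' c) (asB a f c)

def aiC (a b : B) {c c' : B} (f : c ⟶ c') :
    a ◂ b ◂ f ≫ ai a b c' ≅ ai a b c ≫ (a ⊠ b) ◂ f :=
  sqMate (asc a b c) (asc a b c') (asC a b f)

def btA {a a' : B} (f : a ⟶ a') (b : B) : f ▹ b ≫ bt a' b ≅ bt a b ≫ b ◂ f := brN f (𝟙 b)

def btB (a : B) {b b' : B} (f : b ⟶ b') : a ◂ f ≫ bt a b' ≅ bt a b ≫ f ▹ a := brN (𝟙 a) f

/-! Mates of the pentagonator. -/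

def pentI₁ (a b c d : B) :
    ai (a ⊠ b) c d ≫ as a b c ▹ d ≅ as a b (c ⊠ d) ≫ a ◂ ai b c d ≫ ai a (b ⊠ c) d :=
  (ρ_ _).symm ≪≫ (ai (a ⊠ b) c d ≫ as a b c ▹ d) ◁ᵢ (asc a (b ⊠ c) d).unit ≪⊗≫
    (ai (a ⊠ b) c d ≫ as a b c ▹ d ≫ as a (b ⊠ c) d) ◁ᵢ
      ((unitL a (asc b c d)).symm ▷ᵢ ai a (b ⊠ c) d) ≪⊗≫
    ai (a ⊠ b) c d ◁ᵢ (pent a b c d ▷ᵢ (a ◂ ai b c d ≫ ai a (b ⊠ c) d)) ≪⊗≫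
    (asc (a ⊠ b) c d).counit ▷ᵢ (as a b (c ⊠ d) ≫ a ◂ ai b c d ≫ ai a (b ⊠ c) d) ≪⊗≫
    Iso.refl (as a b (c ⊠ d) ≫ a ◂ ai b c d ≫ ai a (b ⊠ c) d)

def pentI₂ (a b c d : B) :
    ai a (b ⊠ c) d ≫ ai a b c ▹ d ≫ as (a ⊠ b) c d ≅ a ◂ as b c d ≫ ai a b (c ⊠ d) :=
  (ρ_ _).symm ≪≫ (ai a (b ⊠ c) d ≫ ai a b c ▹ d ≫ as (a ⊠ b) c d) ◁ᵢ (asc a b (c ⊠ d)).unit ≪⊗≫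
    (ai a (b ⊠ c) d ≫ ai a b c ▹ d) ◁ᵢ ((pent a b c d).symm ▷ᵢ ai a b (c ⊠ d)) ≪⊗≫
    ai a (b ⊠ c) d ◁ᵢ
      (counitR (asc a b c) d ▷ᵢ (as a (b ⊠ c) d ≫ a ◂ as b c d ≫ ai a b (c ⊠ d))) ≪⊗≫
    (asc a (b ⊠ c) d).counit ▷ᵢ (a ◂ as b c d ≫ ai a b (c ⊠ d)) ≪⊗≫
    Iso.refl (a ◂ as b c d ≫ ai a b (c ⊠ d))

def pentI (a b c d : B) :
    a ◂ ai b c d ≫ ai a (b ⊠ c) d ≫ ai a b c ▹ d ≅ ai a b (c ⊠ d) ≫ ai (a ⊠ b) c d :=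
  (ρ_ _).symm ≪≫ (a ◂ ai b c d ≫ ai a (b ⊠ c) d ≫ ai a b c ▹ d) ◁ᵢ (asc (a ⊠ b) c d).unit ≪⊗≫
    a ◂ ai b c d ◁ᵢ (pentI₂ a b c d ▷ᵢ ai (a ⊠ b) c d) ≪⊗≫
    counitL a (asc b c d) ▷ᵢ (ai a b (c ⊠ d) ≫ ai (a ⊠ b) c d) ≪⊗≫
    Iso.refl (ai a b (c ⊠ d) ≫ ai (a ⊠ b) c d)

/-! The hexagonators solved for the braiding with a tensor product. -/

def hexR' (a b c : B) :
    bt a (b ⊠ c) ≅ ai a b c ≫ bt a b ▹ c ≫ as b a c ≫ b ◂ bt a c ≫ ai b c a :=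
  Iso.refl (bt a (b ⊠ c)) ≪⊗≫ (asc a b c).counit.symm ▷ᵢ bt a (b ⊠ c) ≪⊗≫
    (ai a b c ≫ as a b c ≫ bt a (b ⊠ c)) ◁ᵢ (asc b c a).unit ≪⊗≫
    ai a b c ◁ᵢ (hexR a b c ▷ᵢ ai b c a) ≪⊗≫
    Iso.refl (ai a b c ≫ bt a b ▹ c ≫ as b a c ≫ b ◂ bt a c ≫ ai b c a)

def hexS' (a b c : B) :
    bt (a ⊠ b) c ≅ as a b c ≫ a ◂ bt b c ≫ ai a c b ≫ bt a c ▹ b ≫ as c a b :=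
  Iso.refl (bt (a ⊠ b) c) ≪⊗≫ (asc a b c).unit ▷ᵢ bt (a ⊠ b) c ≪⊗≫
    (as a b c ≫ ai a b c ≫ bt (a ⊠ b) c) ◁ᵢ (asc c a b).counit.symm ≪⊗≫
    as a b c ◁ᵢ (hexS a b c ▷ᵢ as c a b) ≪⊗≫
    Iso.refl (as a b c ≫ a ◂ bt b c ≫ ai a c b ≫ bt a c ▹ b ≫ as c a b)

end Derived

open SymMonBicatData in
/-- A symmetric monoidal bicategory. -/
class SymMonBicat (B : Type u) [Bicategory.{w, v} B] extends SymMonBicatData B where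
  -- pseudonaturality of the associator, the unitors and the braiding
  ascN_naturality {a a' b b' c c' : B} {f f₂ : a ⟶ a'} {g g₂ : b ⟶ b'} {h h₂ : c ⟶ c'}
    (η : f ⟶ f₂) (θ : g ⟶ g₂) (ζ : h ⟶ h₂) :
    tensorHom₂ (tensorHom₂ η θ) ζ ▷ as a' b' c' ≫ (ascN f₂ g₂ h₂).hom =
      (ascN f g h).hom ≫ as a b c ◁ tensorHom₂ η (tensorHom₂ θ ζ)
  ascN_id (a b c : B) :
    ascN (𝟙 a) (𝟙 b) (𝟙 c) ≪≫
        as a b c ◁ᵢ (Iso.refl (𝟙 a) ⊠₂ tensorId b c ≪≫ tensorId a (b ⊠ c)) =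
      (tensorId a b ⊠₂ Iso.refl (𝟙 c) ≪≫ tensorId (a ⊠ b) c) ▷ᵢ as a b c ≪≫ sqOne (as a b c)
  ascN_comp {a a' a'' b b' b'' c c' c'' : B} (f : a ⟶ a') (f' : a' ⟶ a'') (g : b ⟶ b')
    (g' : b' ⟶ b'') (h : c ⟶ c') (h' : c' ⟶ c'') :
    ascN (f ≫ f') (g ≫ g') (h ≫ h') ≪≫ as a b c ◁ᵢ
        (Iso.refl (f ≫ f') ⊠₂ tensorComp g g' h h' ≪≫ tensorComp f f' (g ⊠₁ h) (g' ⊠₁ h')) =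
      (tensorComp f f' g g' ⊠₂ Iso.refl (h ≫ h') ≪≫
          tensorComp (f ⊠₁ g) (f' ⊠₁ g') h h') ▷ᵢ as a'' b'' c'' ≪≫
        sqH (ascN f g h) (ascN f' g' h')
  luN_naturality {a a' : B} {f f₂ : a ⟶ a'} (η : f ⟶ f₂) :
    tensorHom₂ (𝟙 (𝟙 (one B))) η ▷ (lu a').hom ≫ (luN f₂).hom = (luN f).hom ≫ (lu a).hom ◁ η
  luN_id (a : B) : luN (𝟙 a) = tensorId (one B) a ▷ᵢ (lu a).hom ≪≫ sqOne (lu a).hom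
  luN_comp {a a' a'' : B} (f : a ⟶ a') (f' : a' ⟶ a'') :
    luN (f ≫ f') = (compL (one B) f f').symm ▷ᵢ (lu a'').hom ≪≫ sqH (luN f) (luN f')
  ruN_naturality {a a' : B} {f f₂ : a ⟶ a'} (η : f ⟶ f₂) :
    tensorHom₂ η (𝟙 (𝟙 (one B))) ▷ (ru a').hom ≫ (ruN f₂).hom = (ruN f).hom ≫ (ru a).hom ◁ η
  ruN_id (a : B) : ruN (𝟙 a) = tensorId a (one B) ▷ᵢ (ru a).hom ≪≫ sqOne (ru a).hom
  ruN_comp {a a' a'' : B} (f : a ⟶ a') (f' : a' ⟶ a'') :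
    ruN (f ≫ f') = (compR f f' (one B)).symm ▷ᵢ (ru a'').hom ≪≫ sqH (ruN f) (ruN f')
  brN_naturality {a a' b b' : B} {f f₂ : a ⟶ a'} {g g₂ : b ⟶ b'} (η : f ⟶ f₂) (θ : g ⟶ g₂) :
    tensorHom₂ η θ ▷ bt a' b' ≫ (brN f₂ g₂).hom = (brN f g).hom ≫ bt a b ◁ tensorHom₂ θ η
  brN_id (a b : B) :
    brN (𝟙 a) (𝟙 b) ≪≫ bt a b ◁ᵢ tensorId b a = tensorId a b ▷ᵢ bt a b ≪≫ sqOne (bt a b)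
  brN_comp {a a' a'' b b' b'' : B} (f : a ⟶ a') (f' : a' ⟶ a'') (g : b ⟶ b') (g' : b' ⟶ b'') :
    brN (f ≫ f') (g ≫ g') ≪≫ bt a b ◁ᵢ tensorComp g g' f f' =
      tensorComp f f' g g' ▷ᵢ bt a'' b'' ≪≫ sqH (brN f g) (brN f' g')
  -- the invertible 2-cells are modifications
  pent_mod {a a' b b' c c' d d' : B} (f : a ⟶ a') (g : b ⟶ b') (h : c ⟶ c') (k : d ⟶ d') :
    Compat (sqV (sqR (ascN f g h) k) (sqV (ascN f (g ⊠₁ h) k) (sqL f (ascN g h k))))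
      (sqV (ascN (f ⊠₁ g) h k) (ascN f g (h ⊠₁ k))) (pent a b c d) (pent a' b' c' d')
  mid_mod {a a' b b' : B} (f : a ⟶ a') (g : b ⟶ b') :
    Compat (sqV (ascN f (𝟙 (one B)) g) (sqL f (luN g))) (sqR (ruN f) g) (mid a b) (mid a' b')
  lun_mod {a a' b b' : B} (f : a ⟶ a') (g : b ⟶ b') :
    Compat (sqV (ascN (𝟙 (one B)) f g) (luN (f ⊠₁ g))) (sqR (luN f) g) (lun a b) (lun a' b')
  run_mod {a a' b b' : B} (f : a ⟶ a') (g : b ⟶ b') :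
    Compat (sqV (ascN f g (𝟙 (one B))) (sqL f (ruN g))) (ruN (f ⊠₁ g)) (run a b) (run a' b')
  hexR_mod {a a' b b' c c' : B} (f : a ⟶ a') (g : b ⟶ b') (h : c ⟶ c') :
    Compat (sqV (ascN f g h) (sqV (brN f (g ⊠₁ h)) (ascN g h f)))
      (sqV (sqR (brN f g) h) (sqV (ascN g f h) (sqL g (brN f h)))) (hexR a b c) (hexR a' b' c')
  hexS_mod {a a' b b' c c' : B} (f : a ⟶ a') (g : b ⟶ b') (h : c ⟶ c') :
    Compat (sqV (aiN f g h) (sqV (brN (f ⊠₁ g) h) (aiN h f g)))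
      (sqV (sqL f (brN g h)) (sqV (aiN f h g) (sqR (brN f h) g))) (hexS a b c) (hexS a' b' c')
  syl_mod {a a' b b' : B} (f : a ⟶ a') (g : b ⟶ b') :
    Compat (sqV (brN f g) (brN g f)) (sqId (f ⊠₁ g)) (syl a b) (syl a' b')
  /-- The non-abelian 4-cocycle (associahedron) axiom. -/
  pent_cocycle (a b c d e : B) :
    ((compR3 _ _ _ e ≪≫ isoR (pent a b c d) e ≪≫ (compR _ _ e).symm) ▷ᵢ
        (as a (b ⊠ (c ⊠ d)) e ≫ a ◂ as b (c ⊠ d) e ≫ a ◂ b ◂ as c d e)) ≪⊗≫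
      as (a ⊠ b) c d ▹ e ◁ᵢ (pent a b (c ⊠ d) e ▷ᵢ a ◂ b ◂ as c d e) ≪⊗≫
      (as (a ⊠ b) c d ▹ e ≫ as (a ⊠ b) (c ⊠ d) e) ◁ᵢ (asC a b (as c d e)).symm ≪⊗≫
      pent (a ⊠ b) c d e ▷ᵢ as a b (c ⊠ (d ⊠ e)) ≪⊗≫
      Iso.refl (as (a ⊠ b ⊠ c) d e ≫ as (a ⊠ b) c (d ⊠ e) ≫ as a b (c ⊠ (d ⊠ e))) =
    Iso.refl ((as a b c ▹ d ▹ e ≫ as a (b ⊠ c) d ▹ e ≫ (a ◂ as b c d) ▹ e) ≫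
        as a (b ⊠ (c ⊠ d)) e ≫ a ◂ as b (c ⊠ d) e ≫ a ◂ b ◂ as c d e) ≪⊗≫
      (as a b c ▹ d ▹ e ≫ as a (b ⊠ c) d ▹ e) ◁ᵢ
        (asB a (as b c d) e ▷ᵢ (a ◂ as b (c ⊠ d) e ≫ a ◂ b ◂ as c d e)) ≪⊗≫
      (as a b c ▹ d ▹ e ≫ as a (b ⊠ c) d ▹ e ≫ as a (b ⊠ c ⊠ d) e) ◁ᵢ
        (compL3 a _ _ _ ≪≫ isoL a (pent b c d e) ≪≫ (compL a _ _).symm) ≪⊗≫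
      as a b c ▹ d ▹ e ◁ᵢ (pent a (b ⊠ c) d e ▷ᵢ a ◂ as b c (d ⊠ e)) ≪⊗≫
      asA (as a b c) d e ▷ᵢ (as a (b ⊠ c) (d ⊠ e) ≫ a ◂ as b c (d ⊠ e)) ≪⊗≫
      as (a ⊠ b ⊠ c) d e ◁ᵢ pent a b c (d ⊠ e)
  /-- Left normalization. -/
  pent_left (a b c : B) :
    pent a (one B) b c ▷ᵢ a ◂ (lu (b ⊠ c)).hom ≪⊗≫
      as (a ⊠ one B) b c ◁ᵢ mid a (b ⊠ c) ≪⊗≫ (asA (ru a).hom b c).symm =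
    Iso.refl ((as a (one B) b ▹ c ≫ as a (one B ⊠ b) c ≫ a ◂ as (one B) b c) ≫
        a ◂ (lu (b ⊠ c)).hom) ≪⊗≫
      (as a (one B) b ▹ c ≫ as a (one B ⊠ b) c) ◁ᵢ (compL a _ _ ≪≫ isoL a (lun b c)) ≪⊗≫
      as a (one B) b ▹ c ◁ᵢ (asB a (lu b).hom c).symm ≪⊗≫
      (compR _ _ c ≪≫ isoR (mid a b) c) ▷ᵢ as a b c
  /-- Right normalization. -/
  pent_right (a b c : B) :
    pent a b (one B) c ▷ᵢ a ◂ b ◂ (lu c).hom ≪⊗≫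
      as (a ⊠ b) (one B) c ◁ᵢ (asC a b (lu c).hom).symm ≪⊗≫ mid (a ⊠ b) c ▷ᵢ as a b c =
    Iso.refl ((as a b (one B) ▹ c ≫ as a (b ⊠ one B) c ≫ a ◂ as b (one B) c) ≫
        a ◂ b ◂ (lu c).hom) ≪⊗≫
      (as a b (one B) ▹ c ≫ as a (b ⊠ one B) c) ◁ᵢ (compL a _ _ ≪≫ isoL a (mid b c)) ≪⊗≫
      as a b (one B) ▹ c ◁ᵢ (asB a (ru b).hom c).symm ≪⊗≫
      (compR _ _ c ≪≫ isoR (run a b) c) ▷ᵢ as a b c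
  /-- Braiding one object past three. -/
  braid_one_three (a b c d : B) :
    (compR3 _ _ _ d ≪≫ isoR (hexR a b c).symm d ≪≫ (compR3 _ _ _ d).symm) ▷ᵢ
        (as b (c ⊠ a) d ≫ b ◂ as c a d ≫ b ◂ c ◂ bt a d) ≪⊗≫
      (as a b c ▹ d ≫ bt a (b ⊠ c) ▹ d) ◁ᵢ (pent b c a d ▷ᵢ b ◂ c ◂ bt a d) ≪⊗≫
      (as a b c ▹ d ≫ bt a (b ⊠ c) ▹ d ≫ as (b ⊠ c) a d) ◁ᵢ (asC b c (bt a d)).symm ≪⊗≫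
      as a b c ▹ d ◁ᵢ ((hexR a (b ⊠ c) d).symm ▷ᵢ as b c (d ⊠ a)) ≪⊗≫
      (as a b c ▹ d ≫ as a (b ⊠ c) d ≫ bt a (b ⊠ c ⊠ d)) ◁ᵢ (pent b c d a).symm ≪⊗≫
      (as a b c ▹ d ≫ as a (b ⊠ c) d) ◁ᵢ
        ((btB a (as b c d)).symm ▷ᵢ (as b (c ⊠ d) a ≫ b ◂ as c d a)) ≪⊗≫
      pent a b c d ▷ᵢ (bt a (b ⊠ (c ⊠ d)) ≫ as b (c ⊠ d) a ≫ b ◂ as c d a) =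
    Iso.refl ((bt a b ▹ c ▹ d ≫ as b a c ▹ d ≫ (b ◂ bt a c) ▹ d) ≫
        as b (c ⊠ a) d ≫ b ◂ as c a d ≫ b ◂ c ◂ bt a d) ≪⊗≫
      (bt a b ▹ c ▹ d ≫ as b a c ▹ d) ◁ᵢ
        (asB b (bt a c) d ▷ᵢ (b ◂ as c a d ≫ b ◂ c ◂ bt a d)) ≪⊗≫
      (bt a b ▹ c ▹ d ≫ as b a c ▹ d ≫ as b (a ⊠ c) d) ◁ᵢ
        (compL3 b _ _ _ ≪≫ isoL b (hexR a c d).symm ≪≫ (compL3 b _ _ _).symm) ≪⊗≫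
      bt a b ▹ c ▹ d ◁ᵢ (pent b a c d ▷ᵢ (b ◂ bt a (c ⊠ d) ≫ b ◂ as c d a)) ≪⊗≫
      asA (bt a b) c d ▷ᵢ (as b a (c ⊠ d) ≫ b ◂ bt a (c ⊠ d) ≫ b ◂ as c d a) ≪⊗≫
      as (a ⊠ b) c d ◁ᵢ ((hexR a b (c ⊠ d)).symm ▷ᵢ b ◂ as c d a) ≪⊗≫
      Iso.refl ((as (a ⊠ b) c d ≫ as a b (c ⊠ d)) ≫
        bt a (b ⊠ (c ⊠ d)) ≫ as b (c ⊠ d) a ≫ b ◂ as c d a)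
  /-- Braiding three objects past one. -/
  braid_three_one (a b c d : B) :
    (compL3 a _ _ _ ≪≫ isoL a (hexS b c d).symm ≪≫ (compL3 a _ _ _).symm) ▷ᵢ
        (ai a (d ⊠ b) c ≫ ai a d b ▹ c ≫ bt a d ▹ b ▹ c) ≪⊗≫
      (a ◂ ai b c d ≫ a ◂ bt (b ⊠ c) d) ◁ᵢ (pentI a d b c ▷ᵢ bt a d ▹ b ▹ c) ≪⊗≫
      (a ◂ ai b c d ≫ a ◂ bt (b ⊠ c) d ≫ ai a d (b ⊠ c)) ◁ᵢ (aiA (bt a d) b c).symm ≪⊗≫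
      a ◂ ai b c d ◁ᵢ ((hexS a (b ⊠ c) d).symm ▷ᵢ ai (d ⊠ a) b c) ≪⊗≫
      (a ◂ ai b c d ≫ ai a (b ⊠ c) d ≫ bt (a ⊠ (b ⊠ c)) d) ◁ᵢ (pentI d a b c).symm ≪⊗≫
      (a ◂ ai b c d ≫ ai a (b ⊠ c) d) ◁ᵢ
        ((btA (ai a b c) d).symm ▷ᵢ (ai d (a ⊠ b) c ≫ ai d a b ▹ c)) ≪⊗≫
      pentI a b c d ▷ᵢ (bt (a ⊠ b ⊠ c) d ≫ ai d (a ⊠ b) c ≫ ai d a b ▹ c) =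
    Iso.refl ((a ◂ b ◂ bt c d ≫ a ◂ ai b d c ≫ a ◂ (bt b d ▹ c)) ≫
        ai a (d ⊠ b) c ≫ ai a d b ▹ c ≫ bt a d ▹ b ▹ c) ≪⊗≫
      (a ◂ b ◂ bt c d ≫ a ◂ ai b d c) ◁ᵢ
        (aiB a (bt b d) c ▷ᵢ (ai a d b ▹ c ≫ bt a d ▹ b ▹ c)) ≪⊗≫
      (a ◂ b ◂ bt c d ≫ a ◂ ai b d c ≫ ai a (b ⊠ d) c) ◁ᵢ
        (compR3 _ _ _ c ≪≫ isoR (hexS a b d).symm c ≪≫ (compR3 _ _ _ c).symm) ≪⊗≫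
      a ◂ b ◂ bt c d ◁ᵢ (pentI a b d c ▷ᵢ (bt (a ⊠ b) d ▹ c ≫ ai d a b ▹ c)) ≪⊗≫
      aiC a b (bt c d) ▷ᵢ (ai (a ⊠ b) d c ≫ bt (a ⊠ b) d ▹ c ≫ ai d a b ▹ c) ≪⊗≫
      ai a b (c ⊠ d) ◁ᵢ ((hexS (a ⊠ b) c d).symm ▷ᵢ ai d a b ▹ c) ≪⊗≫
      Iso.refl ((ai a b (c ⊠ d) ≫ ai (a ⊠ b) c d) ≫
        bt (a ⊠ b ⊠ c) d ≫ ai d (a ⊠ b) c ≫ ai d a b ▹ c)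
  /-- Braiding two objects past two. -/
  braid_two_two (a b c d : B) :
    hexR' (a ⊠ b) c d ≪⊗≫
      ai (a ⊠ b) c d ◁ᵢ ((isoR (hexS' a b c) d ≪≫ (compR5 _ _ _ _ _ d).symm) ▷ᵢ
        (as c (a ⊠ b) d ≫ c ◂ bt (a ⊠ b) d ≫ ai c d (a ⊠ b))) ≪⊗≫
      (ai (a ⊠ b) c d ≫ as a b c ▹ d ≫ (a ◂ bt b c) ▹ d ≫ ai a c b ▹ d ≫ bt a c ▹ b ▹ d ≫
          as c a b ▹ d ≫ as c (a ⊠ b) d) ◁ᵢ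
        ((isoL c (hexS' a b d) ≪≫ (compL5 c _ _ _ _ _).symm) ▷ᵢ ai c d (a ⊠ b)) ≪⊗≫
      pentI₁ a b c d ▷ᵢ ((a ◂ bt b c) ▹ d ≫ ai a c b ▹ d ≫ bt a c ▹ b ▹ d ≫
          as c a b ▹ d ≫ as c (a ⊠ b) d ≫ c ◂ as a b d ≫ c ◂ a ◂ bt b d ≫ c ◂ ai a d b ≫
          c ◂ (bt a d ▹ b) ≫ c ◂ as d a b ≫ ai c d (a ⊠ b)) ≪⊗≫
      (as a b (c ⊠ d) ≫ a ◂ ai b c d) ◁ᵢ ((aiB a (bt b c) d).symm ▷ᵢ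
        (ai a c b ▹ d ≫ bt a c ▹ b ▹ d ≫
          as c a b ▹ d ≫ as c (a ⊠ b) d ≫ c ◂ as a b d ≫ c ◂ a ◂ bt b d ≫ c ◂ ai a d b ≫
          c ◂ (bt a d ▹ b) ≫ c ◂ as d a b ≫ ai c d (a ⊠ b))) ≪⊗≫
      (as a b (c ⊠ d) ≫ a ◂ ai b c d ≫ a ◂ (bt b c ▹ d) ≫ ai a (c ⊠ b) d ≫ ai a c b ▹ d ≫
          bt a c ▹ b ▹ d) ◁ᵢ (pent c a b d ▷ᵢ
        (c ◂ a ◂ bt b d ≫ c ◂ ai a d b ≫ c ◂ (bt a d ▹ b) ≫ c ◂ as d a b ≫ ai c d (a ⊠ b))) ≪⊗≫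
      (as a b (c ⊠ d) ≫ a ◂ ai b c d ≫ a ◂ (bt b c ▹ d) ≫ ai a (c ⊠ b) d ≫ ai a c b ▹ d) ◁ᵢ
        (asA (bt a c) b d ▷ᵢ (as c a (b ⊠ d) ≫
          c ◂ a ◂ bt b d ≫ c ◂ ai a d b ≫ c ◂ (bt a d ▹ b) ≫ c ◂ as d a b ≫
          ai c d (a ⊠ b))) ≪⊗≫
      (as a b (c ⊠ d) ≫ a ◂ ai b c d ≫ a ◂ (bt b c ▹ d)) ◁ᵢ (pentI₂ a c b d ▷ᵢ
        (bt a c ▹ (b ⊠ d) ≫ as c a (b ⊠ d) ≫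
          c ◂ a ◂ bt b d ≫ c ◂ ai a d b ≫ c ◂ (bt a d ▹ b) ≫ c ◂ as d a b ≫
          ai c d (a ⊠ b))) ≪⊗≫
      (as a b (c ⊠ d) ≫ a ◂ ai b c d ≫ a ◂ (bt b c ▹ d) ≫ a ◂ as c b d ≫ ai a c (b ⊠ d) ≫
          bt a c ▹ (b ⊠ d)) ◁ᵢ ((asC c a (bt b d)).symm ▷ᵢ
        (c ◂ ai a d b ≫ c ◂ (bt a d ▹ b) ≫ c ◂ as d a b ≫ ai c d (a ⊠ b))) ≪⊗≫
      (as a b (c ⊠ d) ≫ a ◂ ai b c d ≫ a ◂ (bt b c ▹ d) ≫ a ◂ as c b d ≫ ai a c (b ⊠ d)) ◁ᵢ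
        (exch (bt a c) (bt b d) ▷ᵢ (as c a (d ⊠ b) ≫
          c ◂ ai a d b ≫ c ◂ (bt a d ▹ b) ≫ c ◂ as d a b ≫ ai c d (a ⊠ b))) ≪⊗≫
      (as a b (c ⊠ d) ≫ a ◂ ai b c d ≫ a ◂ (bt b c ▹ d) ≫ a ◂ as c b d) ◁ᵢ
        ((aiC a c (bt b d)).symm ▷ᵢ (bt a c ▹ (d ⊠ b) ≫ as c a (d ⊠ b) ≫
          c ◂ ai a d b ≫ c ◂ (bt a d ▹ b) ≫ c ◂ as d a b ≫ ai c d (a ⊠ b))) ≪⊗≫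
      Iso.refl (as a b (c ⊠ d) ≫ a ◂ ai b c d ≫ a ◂ (bt b c ▹ d) ≫ a ◂ as c b d ≫
        a ◂ c ◂ bt b d ≫ ai a c (d ⊠ b) ≫ bt a c ▹ (d ⊠ b) ≫ as c a (d ⊠ b) ≫
        c ◂ ai a d b ≫ c ◂ (bt a d ▹ b) ≫ c ◂ as d a b ≫ ai c d (a ⊠ b)) =
    hexS' a b (c ⊠ d) ≪⊗≫
      as a b (c ⊠ d) ◁ᵢ ((isoL a (hexR' b c d) ≪≫ (compL5 a _ _ _ _ _).symm) ▷ᵢ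
        (ai a (c ⊠ d) b ≫ bt a (c ⊠ d) ▹ b ≫ as (c ⊠ d) a b)) ≪⊗≫
      (as a b (c ⊠ d) ≫ a ◂ ai b c d ≫ a ◂ (bt b c ▹ d) ≫ a ◂ as c b d ≫ a ◂ c ◂ bt b d ≫
          a ◂ ai c d b ≫ ai a (c ⊠ d) b) ◁ᵢ
        ((isoR (hexR' a c d) b ≪≫ (compR5 _ _ _ _ _ b).symm) ▷ᵢ as (c ⊠ d) a b) ≪⊗≫
      (as a b (c ⊠ d) ≫ a ◂ ai b c d ≫ a ◂ (bt b c ▹ d) ≫ a ◂ as c b d ≫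
          a ◂ c ◂ bt b d) ◁ᵢ (pentI a c d b ▷ᵢ
        (bt a c ▹ d ▹ b ≫ as c a d ▹ b ≫ (c ◂ bt a d) ▹ b ≫ ai c d a ▹ b ≫
          as (c ⊠ d) a b)) ≪⊗≫
      (as a b (c ⊠ d) ≫ a ◂ ai b c d ≫ a ◂ (bt b c ▹ d) ≫ a ◂ as c b d ≫
          a ◂ c ◂ bt b d ≫ ai a c (d ⊠ b)) ◁ᵢ ((aiA (bt a c) d b).symm ▷ᵢ
        (as c a d ▹ b ≫ (c ◂ bt a d) ▹ b ≫ ai c d a ▹ b ≫ as (c ⊠ d) a b)) ≪⊗≫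
      (as a b (c ⊠ d) ≫ a ◂ ai b c d ≫ a ◂ (bt b c ▹ d) ≫ a ◂ as c b d ≫
          a ◂ c ◂ bt b d ≫ ai a c (d ⊠ b) ≫ bt a c ▹ (d ⊠ b)) ◁ᵢ (pentI₁ c a d b ▷ᵢ
        ((c ◂ bt a d) ▹ b ≫ ai c d a ▹ b ≫ as (c ⊠ d) a b)) ≪⊗≫
      (as a b (c ⊠ d) ≫ a ◂ ai b c d ≫ a ◂ (bt b c ▹ d) ≫ a ◂ as c b d ≫
          a ◂ c ◂ bt b d ≫ ai a c (d ⊠ b) ≫ bt a c ▹ (d ⊠ b) ≫ as c a (d ⊠ b) ≫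
          c ◂ ai a d b) ◁ᵢ ((aiB c (bt a d) b).symm ▷ᵢ (ai c d a ▹ b ≫ as (c ⊠ d) a b)) ≪⊗≫
      (as a b (c ⊠ d) ≫ a ◂ ai b c d ≫ a ◂ (bt b c ▹ d) ≫ a ◂ as c b d ≫
          a ◂ c ◂ bt b d ≫ ai a c (d ⊠ b) ≫ bt a c ▹ (d ⊠ b) ≫ as c a (d ⊠ b) ≫
          c ◂ ai a d b ≫ c ◂ (bt a d ▹ b)) ◁ᵢ pentI₂ c d a b ≪⊗≫
      Iso.refl (as a b (c ⊠ d) ≫ a ◂ ai b c d ≫ a ◂ (bt b c ▹ d) ≫ a ◂ as c b d ≫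
        a ◂ c ◂ bt b d ≫ ai a c (d ⊠ b) ≫ bt a c ▹ (d ⊠ b) ≫ as c a (d ⊠ b) ≫
        c ◂ ai a d b ≫ c ◂ (bt a d ▹ b) ≫ c ◂ as d a b ≫ ai c d (a ⊠ b))
  /-- The two derivations of the Yang–Baxter 2-cell agree. -/
  yang_baxter (a b c : B) :
    (hexR a b c).symm ▷ᵢ (ai b c a ≫ bt b c ▹ a ≫ as c b a) ≪⊗≫
      (as a b c ≫ bt a (b ⊠ c)) ◁ᵢ ((asc b c a).unit.symm ▷ᵢ (bt b c ▹ a ≫ as c b a)) ≪⊗≫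
      as a b c ◁ᵢ ((btB a (bt b c)).symm ▷ᵢ as c b a) ≪⊗≫
      (as a b c ≫ a ◂ bt b c) ◁ᵢ (hexR' a c b ▷ᵢ as c b a) ≪⊗≫
      (as a b c ≫ a ◂ bt b c ≫ ai a c b ≫ bt a c ▹ b ≫ as c a b ≫ c ◂ bt a b) ◁ᵢ
        (asc c b a).counit ≪⊗≫
      Iso.refl ((as a b c ≫ a ◂ bt b c ≫ ai a c b ≫ bt a c ▹ b ≫ as c a b) ≫ c ◂ bt a b) =
    Iso.refl ((bt a b ▹ c ≫ as b a c ≫ b ◂ bt a c) ≫ ai b c a ≫ bt b c ▹ a ≫ as c b a) ≪⊗≫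
      bt a b ▹ c ◁ᵢ (hexS' b a c).symm ≪⊗≫ btA (bt a b) c ≪⊗≫ hexS' a b c ▷ᵢ c ◂ bt a b
  -- the syllepsis axioms
  syl_left (a b c : B) :
    syl a (b ⊠ c) =
    hexR' a b c ▷ᵢ bt (b ⊠ c) a ≪⊗≫
      (ai a b c ≫ bt a b ▹ c ≫ as b a c ≫ b ◂ bt a c ≫ ai b c a) ◁ᵢ hexS' b c a ≪⊗≫
      (ai a b c ≫ bt a b ▹ c ≫ as b a c ≫ b ◂ bt a c) ◁ᵢ
        ((asc b c a).counit ▷ᵢ (b ◂ bt c a ≫ ai b a c ≫ bt b a ▹ c ≫ as a b c)) ≪⊗≫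
      (ai a b c ≫ bt a b ▹ c ≫ as b a c) ◁ᵢ
        ((compL b _ _ ≪≫ isoL b (syl a c) ≪≫ tensorId b (a ⊠ c)) ▷ᵢ
          (ai b a c ≫ bt b a ▹ c ≫ as a b c)) ≪⊗≫
      (ai a b c ≫ bt a b ▹ c) ◁ᵢ ((asc b a c).unit.symm ▷ᵢ (bt b a ▹ c ≫ as a b c)) ≪⊗≫
      ai a b c ◁ᵢ
        ((compR _ _ c ≪≫ isoR (syl a b) c ≪≫ tensorId (a ⊠ b) c) ▷ᵢ as a b c) ≪⊗≫
      (asc a b c).counit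
  syl_right (a b c : B) :
    syl (a ⊠ b) c =
    hexS' a b c ▷ᵢ bt c (a ⊠ b) ≪⊗≫
      (as a b c ≫ a ◂ bt b c ≫ ai a c b ≫ bt a c ▹ b ≫ as c a b) ◁ᵢ hexR' c a b ≪⊗≫
      (as a b c ≫ a ◂ bt b c ≫ ai a c b ≫ bt a c ▹ b) ◁ᵢ
        ((asc c a b).unit.symm ▷ᵢ (bt c a ▹ b ≫ as a c b ≫ a ◂ bt c b ≫ ai a b c)) ≪⊗≫
      (as a b c ≫ a ◂ bt b c ≫ ai a c b) ◁ᵢ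
        ((compR _ _ b ≪≫ isoR (syl a c) b ≪≫ tensorId (a ⊠ c) b) ▷ᵢ
          (as a c b ≫ a ◂ bt c b ≫ ai a b c)) ≪⊗≫
      (as a b c ≫ a ◂ bt b c) ◁ᵢ ((asc a c b).counit ▷ᵢ (a ◂ bt c b ≫ ai a b c)) ≪⊗≫
      as a b c ◁ᵢ
        ((compL a _ _ ≪≫ isoL a (syl b c) ≪≫ tensorId a (b ⊠ c)) ▷ᵢ ai a b c) ≪⊗≫
      (asc a b c).unit.symm
  /-- The symmetry axiom. -/
  syl_symm (a b : B) :
    syl a b ▷ᵢ bt a b ≪≫ λ_ (bt a b) =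
      α_ (bt a b) (bt b a) (bt a b) ≪≫ bt a b ◁ᵢ syl b a ≪≫ ρ_ (bt a b)

/-! ### Symmetric monoidal pseudofunctors -/

open SymMonBicatData

section Functors

variable {M : Type u₁} [Bicategory.{w₁, v₁} M] {N : Type u₂} [Bicategory.{w₂, v₂} N]
  {P : Type u₃} [Bicategory.{w₃, v₃} P]

/-- The structure cells of a symmetric monoidal pseudofunctor: a pseudofunctor with 1-morphisms
`χ : F x ⊗ F y ⟶ F (x ⊗ y)`, with pseudonaturality constraints `χN`, and `ι : 1 ⟶ F 1`, and
invertible 2-cells `ω`, `γ`, `δ`, `υ` comparing associators, unitors and braidings. -/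
structure SymMonFunctorData (M : Type u₁) [Bicategory.{w₁, v₁} M] [SymMonBicatData M]
    (N : Type u₂) [Bicategory.{w₂, v₂} N] [SymMonBicatData N] extends M ⥤ᵖ N where
  χ (x y : M) : obj x ⊠ obj y ⟶ obj (x ⊠ y)
  χN {x x' y y' : M} (f : x ⟶ x') (g : y ⟶ y') :
    map f ⊠₁ map g ≫ χ x' y' ≅ χ x y ≫ map (f ⊠₁ g)
  ι : one N ⟶ obj (one M)
  ω (x y z : M) :
    χ x y ▹ obj z ≫ χ (x ⊠ y) z ≫ map (as x y z) ≅
      as (obj x) (obj y) (obj z) ≫ obj x ◂ χ y z ≫ χ x (y ⊠ z)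
  γ (x : M) : ι ▹ obj x ≫ χ (one M) x ≫ map (lu x).hom ≅ (lu (obj x)).hom
  δ (x : M) : obj x ◂ ι ≫ χ x (one M) ≫ map (ru x).hom ≅ (ru (obj x)).hom
  υ (x y : M) : χ x y ≫ map (bt x y) ≅ bt (obj x) (obj y) ≫ χ y x

namespace SymMonFunctorData

section

variable [SymMonBicatData M] [SymMonBicatData N] (F : SymMonFunctorData M N)

def χA {x x' : M} (f : x ⟶ x') (y : M) :
    F.map f ▹ F.obj y ≫ F.χ x' y ≅ F.χ x y ≫ F.map (f ▹ y) :=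
  (Iso.refl (F.map f) ⊠₂ (F.mapId y).symm) ▷ᵢ F.χ x' y ≪≫ F.χN f (𝟙 y)

def χB (x : M) {y y' : M} (f : y ⟶ y') :
    F.obj x ◂ F.map f ≫ F.χ x y' ≅ F.χ x y ≫ F.map (x ◂ f) :=
  ((F.mapId x).symm ⊠₂ Iso.refl (F.map f)) ▷ᵢ F.χ x y' ≪≫ F.χN (𝟙 x) f

/-- The square on `ι`. -/
def ιN : 𝟙 (one N) ≫ F.ι ≅ F.ι ≫ F.map (𝟙 (one M)) :=
  sqOne F.ι ≪≫ F.ι ◁ᵢ (F.mapId (one M)).symm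

/-- The mate of `ω` for the inverse associators. -/
def ωI (x y z : M) :
    F.obj x ◂ F.χ y z ≫ F.χ x (y ⊠ z) ≫ F.map (ai x y z) ≅
      ai (F.obj x) (F.obj y) (F.obj z) ≫ F.χ x y ▹ F.obj z ≫ F.χ (x ⊠ y) z :=
  Iso.refl (F.obj x ◂ F.χ y z ≫ F.χ x (y ⊠ z) ≫ F.map (ai x y z)) ≪⊗≫
    (asc (F.obj x) (F.obj y) (F.obj z)).counit.symm ▷ᵢ
      (F.obj x ◂ F.χ y z ≫ F.χ x (y ⊠ z) ≫ F.map (ai x y z)) ≪⊗≫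
    ai (F.obj x) (F.obj y) (F.obj z) ◁ᵢ ((F.ω x y z).symm ▷ᵢ F.map (ai x y z)) ≪⊗≫
    (ai (F.obj x) (F.obj y) (F.obj z) ≫ F.χ x y ▹ F.obj z ≫ F.χ (x ⊠ y) z) ◁ᵢ
      funUnit F.toPseudofunctor (asc x y z) ≪⊗≫
    Iso.refl (ai (F.obj x) (F.obj y) (F.obj z) ≫ F.χ x y ▹ F.obj z ≫ F.χ (x ⊠ y) z)

end

section

variable [SymMonBicatData M]

def idω (x y z : M) :
    𝟙 (x ⊠ y) ▹ z ≫ 𝟙 (x ⊠ y ⊠ z) ≫ as x y z ≅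
      as x y z ≫ x ◂ 𝟙 (y ⊠ z) ≫ 𝟙 (x ⊠ (y ⊠ z)) :=
  tensorId (x ⊠ y) z ▷ᵢ (𝟙 _ ≫ as x y z) ≪⊗≫
    as x y z ◁ᵢ ((tensorId x (y ⊠ z)).symm ▷ᵢ 𝟙 (x ⊠ (y ⊠ z)))

def idγ (x : M) : 𝟙 (one M) ▹ x ≫ 𝟙 (one M ⊠ x) ≫ (lu x).hom ≅ (lu x).hom :=
  tensorId (one M) x ▷ᵢ (𝟙 _ ≫ (lu x).hom) ≪⊗≫ Iso.refl (lu x).hom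

def idδ (x : M) : x ◂ 𝟙 (one M) ≫ 𝟙 (x ⊠ one M) ≫ (ru x).hom ≅ (ru x).hom :=
  tensorId x (one M) ▷ᵢ (𝟙 _ ≫ (ru x).hom) ≪⊗≫ Iso.refl (ru x).hom

end

/-- The identity. -/
def id (M : Type u₁) [Bicategory.{w₁, v₁} M] [SymMonBicatData M] : SymMonFunctorData M M where
  toPseudofunctor := Pseudofunctor.id M
  χ x y := 𝟙 (x ⊠ y)
  χN f g := sqId (f ⊠₁ g)
  ι := 𝟙 (one M)
  ω x y z := idω x y z
  γ x := idγ x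
  δ x := idδ x
  υ x y := sqOne (bt x y)

section

variable [SymMonBicatData M] [SymMonBicatData N] [SymMonBicatData P]
  (F : SymMonFunctorData M N) (G : SymMonFunctorData N P)

def compω (x y z : M) :
    (G.χ (F.obj x) (F.obj y) ≫ G.map (F.χ x y)) ▹ G.obj (F.obj z) ≫
        (G.χ (F.obj (x ⊠ y)) (F.obj z) ≫ G.map (F.χ (x ⊠ y) z)) ≫ G.map (F.map (as x y z)) ≅
      as (G.obj (F.obj x)) (G.obj (F.obj y)) (G.obj (F.obj z)) ≫
        G.obj (F.obj x) ◂ (G.χ (F.obj y) (F.obj z) ≫ G.map (F.χ y z)) ≫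
          G.χ (F.obj x) (F.obj (y ⊠ z)) ≫ G.map (F.χ x (y ⊠ z)) :=
  (compR (G.χ (F.obj x) (F.obj y)) (G.map (F.χ x y)) (G.obj (F.obj z))).symm ▷ᵢ
      ((G.χ (F.obj (x ⊠ y)) (F.obj z) ≫ G.map (F.χ (x ⊠ y) z)) ≫
        G.map (F.map (as x y z))) ≪⊗≫
    G.χ (F.obj x) (F.obj y) ▹ G.obj (F.obj z) ◁ᵢ (G.χA (F.χ x y) (F.obj z) ▷ᵢ
      (G.map (F.χ (x ⊠ y) z) ≫ G.map (F.map (as x y z)))) ≪⊗≫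
    (G.χ (F.obj x) (F.obj y) ▹ G.obj (F.obj z) ≫ G.χ (F.obj x ⊠ F.obj y) (F.obj z)) ◁ᵢ
      (fun3 G.toPseudofunctor _ _ _ ≪≫ G.map₂Iso (F.ω x y z) ≪≫
        (fun3 G.toPseudofunctor _ _ _).symm) ≪⊗≫
    G.ω (F.obj x) (F.obj y) (F.obj z) ▷ᵢ
      (G.map (F.obj x ◂ F.χ y z) ≫ G.map (F.χ x (y ⊠ z))) ≪⊗≫
    (as (G.obj (F.obj x)) (G.obj (F.obj y)) (G.obj (F.obj z)) ≫
        G.obj (F.obj x) ◂ G.χ (F.obj y) (F.obj z)) ◁ᵢ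
      ((G.χB (F.obj x) (F.χ y z)).symm ▷ᵢ G.map (F.χ x (y ⊠ z))) ≪⊗≫
    as (G.obj (F.obj x)) (G.obj (F.obj y)) (G.obj (F.obj z)) ◁ᵢ
      (compL (G.obj (F.obj x)) (G.χ (F.obj y) (F.obj z)) (G.map (F.χ y z)) ▷ᵢ
        (G.χ (F.obj x) (F.obj (y ⊠ z)) ≫ G.map (F.χ x (y ⊠ z))))

def compγ (x : M) :
    (G.ι ≫ G.map F.ι) ▹ G.obj (F.obj x) ≫
        (G.χ (F.obj (one M)) (F.obj x) ≫ G.map (F.χ (one M) x)) ≫ G.map (F.map (lu x).hom) ≅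
      (lu (G.obj (F.obj x))).hom :=
  (compR G.ι (G.map F.ι) (G.obj (F.obj x))).symm ▷ᵢ
      ((G.χ (F.obj (one M)) (F.obj x) ≫ G.map (F.χ (one M) x)) ≫
        G.map (F.map (lu x).hom)) ≪⊗≫
    G.ι ▹ G.obj (F.obj x) ◁ᵢ (G.χA F.ι (F.obj x) ▷ᵢ
      (G.map (F.χ (one M) x) ≫ G.map (F.map (lu x).hom))) ≪⊗≫
    (G.ι ▹ G.obj (F.obj x) ≫ G.χ (one N) (F.obj x)) ◁ᵢ
      (fun3 G.toPseudofunctor _ _ _ ≪≫ G.map₂Iso (F.γ x)) ≪⊗≫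
    G.γ (F.obj x)

def compδ (x : M) :
    G.obj (F.obj x) ◂ (G.ι ≫ G.map F.ι) ≫
        (G.χ (F.obj x) (F.obj (one M)) ≫ G.map (F.χ x (one M))) ≫ G.map (F.map (ru x).hom) ≅
      (ru (G.obj (F.obj x))).hom :=
  (compL (G.obj (F.obj x)) G.ι (G.map F.ι)).symm ▷ᵢ
      ((G.χ (F.obj x) (F.obj (one M)) ≫ G.map (F.χ x (one M))) ≫
        G.map (F.map (ru x).hom)) ≪⊗≫
    G.obj (F.obj x) ◂ G.ι ◁ᵢ (G.χB (F.obj x) F.ι ▷ᵢ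
      (G.map (F.χ x (one M)) ≫ G.map (F.map (ru x).hom))) ≪⊗≫
    (G.obj (F.obj x) ◂ G.ι ≫ G.χ (F.obj x) (one N)) ◁ᵢ
      (fun3 G.toPseudofunctor _ _ _ ≪≫ G.map₂Iso (F.δ x)) ≪⊗≫
    G.δ (F.obj x)

def compυ (x y : M) :
    (G.χ (F.obj x) (F.obj y) ≫ G.map (F.χ x y)) ≫ G.map (F.map (bt x y)) ≅
      bt (G.obj (F.obj x)) (G.obj (F.obj y)) ≫ G.χ (F.obj y) (F.obj x) ≫ G.map (F.χ y x) :=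
  α_ _ _ _ ≪≫
    G.χ (F.obj x) (F.obj y) ◁ᵢ
      (fun2 G.toPseudofunctor _ _ ≪≫ G.map₂Iso (F.υ x y) ≪≫
        (fun2 G.toPseudofunctor _ _).symm) ≪⊗≫
    G.υ (F.obj x) (F.obj y) ▷ᵢ G.map (F.χ y x) ≪≫ α_ _ _ _

end

/-- The composite, `F` first. -/
def comp [SymMonBicatData M] [SymMonBicatData N] [SymMonBicatData P]
    (F : SymMonFunctorData M N) (G : SymMonFunctorData N P) : SymMonFunctorData M P where
  toPseudofunctor := F.toPseudofunctor.comp G.toPseudofunctor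
  χ x y := G.χ (F.obj x) (F.obj y) ≫ G.map (F.χ x y)
  χN f g := sqV (G.χN (F.map f) (F.map g)) (sqMap G.toPseudofunctor (F.χN f g))
  ι := G.ι ≫ G.map F.ι
  ω x y z := compω F G x y z
  γ x := compγ F G x
  δ x := compδ F G x
  υ x y := compυ F G x y

end SymMonFunctorData

/-- A symmetric monoidal pseudofunctor (symmetric monoidal homomorphism). -/
structure SymMonFunctor (M : Type u₁) [Bicategory.{w₁, v₁} M] [SymMonBicat M]
    (N : Type u₂) [Bicategory.{w₂, v₂} N] [SymMonBicat N] extends SymMonFunctorData M N where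
  χ_equiv (x y : M) : IsEquiv (χ x y)
  ι_equiv : IsEquiv ι
  -- pseudonaturality of `χ`
  χN_naturality {x x' y y' : M} {f f₂ : x ⟶ x'} {g g₂ : y ⟶ y'} (η : f ⟶ f₂) (θ : g ⟶ g₂) :
    tensorHom₂ (map₂ η) (map₂ θ) ▷ χ x' y' ≫ (χN f₂ g₂).hom =
      (χN f g).hom ≫ χ x y ◁ map₂ (tensorHom₂ η θ)
  χN_id (x y : M) :
    χN (𝟙 x) (𝟙 y) ≪≫
        χ x y ◁ᵢ (toPseudofunctor.map₂Iso (tensorId x y) ≪≫ mapId (x ⊠ y)) =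
      (mapId x ⊠₂ mapId y ≪≫ tensorId (obj x) (obj y)) ▷ᵢ χ x y ≪≫ sqOne (χ x y)
  χN_comp {x x' x'' y y' y'' : M} (f : x ⟶ x') (f' : x' ⟶ x'') (g : y ⟶ y') (g' : y' ⟶ y'') :
    χN (f ≫ f') (g ≫ g') ≪≫ χ x y ◁ᵢ
        (toPseudofunctor.map₂Iso (tensorComp f f' g g') ≪≫ mapComp (f ⊠₁ g) (f' ⊠₁ g')) =
      (mapComp f f' ⊠₂ mapComp g g' ≪≫ tensorComp (map f) (map f') (map g) (map g')) ▷ᵢ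
          χ x'' y'' ≪≫
        sqH (χN f g) (χN f' g')
  -- `ω`, `γ`, `δ` and `υ` are modifications
  ω_mod {x x' y y' z z' : M} (f : x ⟶ x') (g : y ⟶ y') (h : z ⟶ z') :
    Compat
      (sqV (sqR (χN f g) (map h)) (sqV (χN (f ⊠₁ g) h) (sqMap toPseudofunctor (ascN f g h))))
      (sqV (ascN (map f) (map g) (map h)) (sqV (sqL (map f) (χN g h)) (χN f (g ⊠₁ h))))
      (ω x y z) (ω x' y' z')
  γ_mod {x x' : M} (f : x ⟶ x') :
    Compat
      (sqV (sqR toSymMonFunctorData.ιN (map f))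
        (sqV (χN (𝟙 (one M)) f) (sqMap toPseudofunctor (luN f))))
      (luN (map f)) (γ x) (γ x')
  δ_mod {x x' : M} (f : x ⟶ x') :
    Compat
      (sqV (sqL (map f) toSymMonFunctorData.ιN)
        (sqV (χN f (𝟙 (one M))) (sqMap toPseudofunctor (ruN f))))
      (ruN (map f)) (δ x) (δ x')
  υ_mod {x x' y y' : M} (f : x ⟶ x') (g : y ⟶ y') :
    Compat (sqV (χN f g) (sqMap toPseudofunctor (brN f g)))
      (sqV (brN (map f) (map g)) (χN g f)) (υ x y) (υ x' y')
  /-- Compatibility with the pentagonators. -/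
  pent_coh (x y z t : M) :
    (χ x y ▹ obj z ▹ obj t ≫ χ (x ⊠ y) z ▹ obj t ≫ χ (x ⊠ y ⊠ z) t) ◁ᵢ
        (fun3 toPseudofunctor _ _ _ ≪≫ toPseudofunctor.map₂Iso (pent x y z t) ≪≫
          (fun2 toPseudofunctor _ _).symm) ≪⊗≫
      χ x y ▹ obj z ▹ obj t ◁ᵢ (ω (x ⊠ y) z t ▷ᵢ map (as x y (z ⊠ t))) ≪⊗≫
      asA (χ x y) (obj z) (obj t) ▷ᵢ
        (obj (x ⊠ y) ◂ χ z t ≫ χ (x ⊠ y) (z ⊠ t) ≫ map (as x y (z ⊠ t))) ≪⊗≫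
      as (obj x ⊠ obj y) (obj z) (obj t) ◁ᵢ (exch (χ x y) (χ z t) ▷ᵢ
        (χ (x ⊠ y) (z ⊠ t) ≫ map (as x y (z ⊠ t)))) ≪⊗≫
      (as (obj x ⊠ obj y) (obj z) (obj t) ≫ (obj x ⊠ obj y) ◂ χ z t) ◁ᵢ ω x y (z ⊠ t) ≪⊗≫
      as (obj x ⊠ obj y) (obj z) (obj t) ◁ᵢ (asC (obj x) (obj y) (χ z t) ▷ᵢ
        (obj x ◂ χ y (z ⊠ t) ≫ χ x (y ⊠ (z ⊠ t)))) ≪⊗≫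
      Iso.refl ((as (obj x ⊠ obj y) (obj z) (obj t) ≫ as (obj x) (obj y) (obj z ⊠ obj t)) ≫
        obj x ◂ obj y ◂ χ z t ≫ obj x ◂ χ y (z ⊠ t) ≫ χ x (y ⊠ (z ⊠ t))) =
    Iso.refl ((χ x y ▹ obj z ▹ obj t ≫ χ (x ⊠ y) z ▹ obj t ≫ χ (x ⊠ y ⊠ z) t) ≫
        map (as x y z ▹ t) ≫ map (as x (y ⊠ z) t) ≫ map (x ◂ as y z t)) ≪⊗≫
      (χ x y ▹ obj z ▹ obj t ≫ χ (x ⊠ y) z ▹ obj t) ◁ᵢ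
        ((toSymMonFunctorData.χA (as x y z) t).symm ▷ᵢ
          (map (as x (y ⊠ z) t) ≫ map (x ◂ as y z t))) ≪⊗≫
      (compR3 _ _ _ (obj t) ≪≫ isoR (ω x y z) (obj t) ≪≫ (compR3 _ _ _ (obj t)).symm) ▷ᵢ
        (χ (x ⊠ (y ⊠ z)) t ≫ map (as x (y ⊠ z) t) ≫ map (x ◂ as y z t)) ≪⊗≫
      (as (obj x) (obj y) (obj z) ▹ obj t ≫ (obj x ◂ χ y z) ▹ obj t) ◁ᵢ
        (ω x (y ⊠ z) t ▷ᵢ map (x ◂ as y z t)) ≪⊗≫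
      (as (obj x) (obj y) (obj z) ▹ obj t ≫ (obj x ◂ χ y z) ▹ obj t ≫
          as (obj x) (obj (y ⊠ z)) (obj t) ≫ obj x ◂ χ (y ⊠ z) t) ◁ᵢ
        (toSymMonFunctorData.χB x (as y z t)).symm ≪⊗≫
      as (obj x) (obj y) (obj z) ▹ obj t ◁ᵢ (asB (obj x) (χ y z) (obj t) ▷ᵢ
        (obj x ◂ χ (y ⊠ z) t ≫ obj x ◂ map (as y z t) ≫ χ x (y ⊠ (z ⊠ t)))) ≪⊗≫
      (as (obj x) (obj y) (obj z) ▹ obj t ≫ as (obj x) (obj y ⊠ obj z) (obj t)) ◁ᵢ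
        ((compL3 (obj x) _ _ _ ≪≫ isoL (obj x) (ω y z t) ≪≫ (compL3 (obj x) _ _ _).symm) ▷ᵢ
          χ x (y ⊠ (z ⊠ t))) ≪⊗≫
      pent (obj x) (obj y) (obj z) (obj t) ▷ᵢ
        (obj x ◂ obj y ◂ χ z t ≫ obj x ◂ χ y (z ⊠ t) ≫ χ x (y ⊠ (z ⊠ t)))
  /-- Compatibility with the 2-unitors. -/
  mid_coh (x y : M) :
    ((obj x ◂ ι) ▹ obj y ≫ χ x (one M) ▹ obj y ≫ χ (x ⊠ one M) y) ◁ᵢ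
        (fun2 toPseudofunctor _ _ ≪≫ toPseudofunctor.map₂Iso (mid x y)) ≪⊗≫
      ((obj x ◂ ι) ▹ obj y ≫ χ x (one M) ▹ obj y) ◁ᵢ
        (toSymMonFunctorData.χA (ru x).hom y).symm ≪⊗≫
      (compR3 _ _ _ (obj y) ≪≫ isoR (δ x) (obj y)) ▷ᵢ χ x y =
    Iso.refl (((obj x ◂ ι) ▹ obj y ≫ χ x (one M) ▹ obj y ≫ χ (x ⊠ one M) y) ≫
        map (as x (one M) y) ≫ map (x ◂ (lu y).hom)) ≪⊗≫
      (obj x ◂ ι) ▹ obj y ◁ᵢ (ω x (one M) y ▷ᵢ map (x ◂ (lu y).hom)) ≪⊗≫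
      ((obj x ◂ ι) ▹ obj y ≫ as (obj x) (obj (one M)) (obj y) ≫ obj x ◂ χ (one M) y) ◁ᵢ
        (toSymMonFunctorData.χB x (lu y).hom).symm ≪⊗≫
      asB (obj x) ι (obj y) ▷ᵢ (obj x ◂ χ (one M) y ≫ obj x ◂ map (lu y).hom ≫ χ x y) ≪⊗≫
      as (obj x) (one N) (obj y) ◁ᵢ
        ((compL3 (obj x) _ _ _ ≪≫ isoL (obj x) (γ y)) ▷ᵢ χ x y) ≪⊗≫
      mid (obj x) (obj y) ▷ᵢ χ x y
  /-- Compatibility with the first hexagonators. -/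
  hexR_coh (x y z : M) :
    (χ x y ▹ obj z ≫ χ (x ⊠ y) z) ◁ᵢ
        (fun3 toPseudofunctor _ _ _ ≪≫ toPseudofunctor.map₂Iso (hexR x y z) ≪≫
          (fun3 toPseudofunctor _ _ _).symm) ≪⊗≫
      χ x y ▹ obj z ◁ᵢ ((toSymMonFunctorData.χA (bt x y) z).symm ▷ᵢ
        (map (as y x z) ≫ map (y ◂ bt x z))) ≪⊗≫
      (compR _ _ (obj z) ≪≫ isoR (υ x y) (obj z) ≪≫ (compR _ _ (obj z)).symm) ▷ᵢ
        (χ (y ⊠ x) z ≫ map (as y x z) ≫ map (y ◂ bt x z)) ≪⊗≫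
      bt (obj x) (obj y) ▹ obj z ◁ᵢ (ω y x z ▷ᵢ map (y ◂ bt x z)) ≪⊗≫
      (bt (obj x) (obj y) ▹ obj z ≫ as (obj y) (obj x) (obj z) ≫ obj y ◂ χ x z) ◁ᵢ
        (toSymMonFunctorData.χB y (bt x z)).symm ≪⊗≫
      (bt (obj x) (obj y) ▹ obj z ≫ as (obj y) (obj x) (obj z)) ◁ᵢ
        ((compL (obj y) _ _ ≪≫ isoL (obj y) (υ x z) ≪≫ (compL (obj y) _ _).symm) ▷ᵢ
          χ y (z ⊠ x)) ≪⊗≫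
      Iso.refl ((bt (obj x) (obj y) ▹ obj z ≫ as (obj y) (obj x) (obj z) ≫
        obj y ◂ bt (obj x) (obj z)) ≫ obj y ◂ χ z x ≫ χ y (z ⊠ x)) =
    Iso.refl ((χ x y ▹ obj z ≫ χ (x ⊠ y) z) ≫
        map (as x y z) ≫ map (bt x (y ⊠ z)) ≫ map (as y z x)) ≪⊗≫
      ω x y z ▷ᵢ (map (bt x (y ⊠ z)) ≫ map (as y z x)) ≪⊗≫
      (as (obj x) (obj y) (obj z) ≫ obj x ◂ χ y z) ◁ᵢ (υ x (y ⊠ z) ▷ᵢ map (as y z x)) ≪⊗≫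
      as (obj x) (obj y) (obj z) ◁ᵢ (btB (obj x) (χ y z) ▷ᵢ
        (χ (y ⊠ z) x ≫ map (as y z x))) ≪⊗≫
      (as (obj x) (obj y) (obj z) ≫ bt (obj x) (obj y ⊠ obj z)) ◁ᵢ ω y z x ≪⊗≫
      hexR (obj x) (obj y) (obj z) ▷ᵢ (obj y ◂ χ z x ≫ χ y (z ⊠ x))
  /-- Compatibility with the second hexagonators. -/
  hexS_coh (x y z : M) :
    (obj x ◂ χ y z ≫ χ x (y ⊠ z)) ◁ᵢ
        (fun3 toPseudofunctor _ _ _ ≪≫ toPseudofunctor.map₂Iso (hexS x y z) ≪≫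
          (fun3 toPseudofunctor _ _ _).symm) ≪⊗≫
      obj x ◂ χ y z ◁ᵢ ((toSymMonFunctorData.χB x (bt y z)).symm ▷ᵢ
        (map (ai x z y) ≫ map (bt x z ▹ y))) ≪⊗≫
      (compL (obj x) _ _ ≪≫ isoL (obj x) (υ y z) ≪≫ (compL (obj x) _ _).symm) ▷ᵢ
        (χ x (z ⊠ y) ≫ map (ai x z y) ≫ map (bt x z ▹ y)) ≪⊗≫
      obj x ◂ bt (obj y) (obj z) ◁ᵢ
        (toSymMonFunctorData.ωI x z y ▷ᵢ map (bt x z ▹ y)) ≪⊗≫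
      (obj x ◂ bt (obj y) (obj z) ≫ ai (obj x) (obj z) (obj y) ≫ χ x z ▹ obj y) ◁ᵢ
        (toSymMonFunctorData.χA (bt x z) y).symm ≪⊗≫
      (obj x ◂ bt (obj y) (obj z) ≫ ai (obj x) (obj z) (obj y)) ◁ᵢ
        ((compR _ _ (obj y) ≪≫ isoR (υ x z) (obj y) ≪≫ (compR _ _ (obj y)).symm) ▷ᵢ
          χ (z ⊠ x) y) ≪⊗≫
      Iso.refl ((obj x ◂ bt (obj y) (obj z) ≫ ai (obj x) (obj z) (obj y) ≫
        bt (obj x) (obj z) ▹ obj y) ≫ χ z x ▹ obj y ≫ χ (z ⊠ x) y) =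
    Iso.refl ((obj x ◂ χ y z ≫ χ x (y ⊠ z)) ≫
        map (ai x y z) ≫ map (bt (x ⊠ y) z) ≫ map (ai z x y)) ≪⊗≫
      toSymMonFunctorData.ωI x y z ▷ᵢ (map (bt (x ⊠ y) z) ≫ map (ai z x y)) ≪⊗≫
      (ai (obj x) (obj y) (obj z) ≫ χ x y ▹ obj z) ◁ᵢ (υ (x ⊠ y) z ▷ᵢ map (ai z x y)) ≪⊗≫
      ai (obj x) (obj y) (obj z) ◁ᵢ (btA (χ x y) (obj z) ▷ᵢ
        (χ z (x ⊠ y) ≫ map (ai z x y))) ≪⊗≫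
      (ai (obj x) (obj y) (obj z) ≫ bt (obj x ⊠ obj y) (obj z)) ◁ᵢ
        toSymMonFunctorData.ωI z x y ≪⊗≫
      hexS (obj x) (obj y) (obj z) ▷ᵢ (χ z x ▹ obj y ≫ χ (z ⊠ x) y)
  /-- Compatibility with the syllepses. -/
  syl_coh (x y : M) :
    χ x y ◁ᵢ (fun2 toPseudofunctor _ _ ≪≫ toPseudofunctor.map₂Iso (syl x y) ≪≫
        mapId (x ⊠ y)) ≪⊗≫ Iso.refl (χ x y) =
    Iso.refl (χ x y ≫ map (bt x y) ≫ map (bt y x)) ≪⊗≫ υ x y ▷ᵢ map (bt y x) ≪⊗≫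
      bt (obj x) (obj y) ◁ᵢ υ y x ≪⊗≫ syl (obj x) (obj y) ▷ᵢ χ x y ≪⊗≫ Iso.refl (χ x y)

/-! ### Symmetric monoidal transformations and equivalences -/

/-- A symmetric monoidal transformation. Only the structure cells of its source and target enter,
so that they may be composites. -/
structure SymMonTrans [SymMonBicatData M] [SymMonBicatData N] (F G : SymMonFunctorData M N) extends
    Pseudofunctor.StrongTrans F.toPseudofunctor G.toPseudofunctor where
  m₂ (x y : M) : F.χ x y ≫ app (x ⊠ y) ≅ app x ⊠₁ app y ≫ G.χ x y
  m₀ : F.ι ≫ app (one M) ≅ G.ι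
  m₂_mod {x x' y y' : M} (f : x ⟶ x') (g : y ⟶ y') :
    Compat (sqV (F.χN f g) (naturality (f ⊠₁ g)))
      (sqV (sqT (naturality f) (naturality g)) (G.χN f g)) (m₂ x y) (m₂ x' y')
  /-- Compatibility with the associativity constraints. -/
  ω_coh (x y z : M) :
    F.ω x y z ▷ᵢ app (x ⊠ (y ⊠ z)) ≪⊗≫
      (as (F.obj x) (F.obj y) (F.obj z) ≫ F.obj x ◂ F.χ y z) ◁ᵢ m₂ x (y ⊠ z) ≪⊗≫
      as (F.obj x) (F.obj y) (F.obj z) ◁ᵢ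
        (sqT (sqOne (app x)) (m₂ y z) ▷ᵢ G.χ x (y ⊠ z)) ≪⊗≫
      (ascN (app x) (app y) (app z)).symm ▷ᵢ (G.obj x ◂ G.χ y z ≫ G.χ x (y ⊠ z)) ≪⊗≫
      Iso.refl (app x ⊠₁ app y ⊠₁ app z ≫ as (G.obj x) (G.obj y) (G.obj z) ≫
        G.obj x ◂ G.χ y z ≫ G.χ x (y ⊠ z)) =
    Iso.refl ((F.χ x y ▹ F.obj z ≫ F.χ (x ⊠ y) z ≫ F.map (as x y z)) ≫
        app (x ⊠ (y ⊠ z))) ≪⊗≫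
      (F.χ x y ▹ F.obj z ≫ F.χ (x ⊠ y) z) ◁ᵢ naturality (as x y z) ≪⊗≫
      F.χ x y ▹ F.obj z ◁ᵢ (m₂ (x ⊠ y) z ▷ᵢ G.map (as x y z)) ≪⊗≫
      sqT (m₂ x y) (sqOne (app z)) ▷ᵢ (G.χ (x ⊠ y) z ≫ G.map (as x y z)) ≪⊗≫
      app x ⊠₁ app y ⊠₁ app z ◁ᵢ G.ω x y z
  /-- Compatibility with the left unit constraints. -/
  γ_coh (x : M) :
    F.γ x ▷ᵢ app x ≪≫ (luN (app x)).symm =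
    Iso.refl ((F.ι ▹ F.obj x ≫ F.χ (one M) x ≫ F.map (lu x).hom) ≫ app x) ≪⊗≫
      (F.ι ▹ F.obj x ≫ F.χ (one M) x) ◁ᵢ naturality (lu x).hom ≪⊗≫
      F.ι ▹ F.obj x ◁ᵢ (m₂ (one M) x ▷ᵢ G.map (lu x).hom) ≪⊗≫
      sqT (m₀ ≪≫ (λ_ G.ι).symm) (sqOne (app x)) ▷ᵢ
        (G.χ (one M) x ≫ G.map (lu x).hom) ≪⊗≫
      one N ◂ app x ◁ᵢ G.γ x
  /-- Compatibility with the right unit constraints. -/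
  δ_coh (x : M) :
    F.δ x ▷ᵢ app x ≪≫ (ruN (app x)).symm =
    Iso.refl ((F.obj x ◂ F.ι ≫ F.χ x (one M) ≫ F.map (ru x).hom) ≫ app x) ≪⊗≫
      (F.obj x ◂ F.ι ≫ F.χ x (one M)) ◁ᵢ naturality (ru x).hom ≪⊗≫
      F.obj x ◂ F.ι ◁ᵢ (m₂ x (one M) ▷ᵢ G.map (ru x).hom) ≪⊗≫
      sqT (sqOne (app x)) (m₀ ≪≫ (λ_ G.ι).symm) ▷ᵢ
        (G.χ x (one M) ≫ G.map (ru x).hom) ≪⊗≫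
      app x ▹ one N ◁ᵢ G.δ x
  /-- Compatibility with the braiding constraints. -/
  υ_coh (x y : M) :
    F.υ x y ▷ᵢ app (y ⊠ x) ≪⊗≫ bt (F.obj x) (F.obj y) ◁ᵢ m₂ y x ≪⊗≫
      (brN (app x) (app y)).symm ▷ᵢ G.χ y x ≪⊗≫
      Iso.refl (app x ⊠₁ app y ≫ bt (G.obj x) (G.obj y) ≫ G.χ y x) =
    Iso.refl ((F.χ x y ≫ F.map (bt x y)) ≫ app (y ⊠ x)) ≪⊗≫
      F.χ x y ◁ᵢ naturality (bt x y) ≪⊗≫ m₂ x y ▷ᵢ G.map (bt x y) ≪⊗≫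
      app x ⊠₁ app y ◁ᵢ G.υ x y

/-- An equivalence of symmetric monoidal bicategories: symmetric monoidal pseudofunctors in both
directions whose composites are equivalent to the identities by symmetric monoidal
transformations. -/
structure SymMonEquivalence (M : Type u₁) [Bicategory.{w₁, v₁} M] [SymMonBicat M]
    (N : Type u₂) [Bicategory.{w₂, v₂} N] [SymMonBicat N] where
  F : SymMonFunctor M N
  G : SymMonFunctor N M
  unit : SymMonTrans (SymMonFunctorData.id M) (F.toSymMonFunctorData.comp G.toSymMonFunctorData)
  unit_equiv (x : M) : IsEquiv (unit.app x)
  counit : SymMonTrans (G.toSymMonFunctorData.comp F.toSymMonFunctorData) (SymMonFunctorData.id N)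
  counit_equiv (y : N) : IsEquiv (counit.app y)

end Functors

/-! ### The symmetric monoidal bicategory of a 3-term cochain complex -/

/-- The bicategory `D` of a complex `C¹ ⟶ C² ⟶ C³` of abelian groups (`C¹ = S.X₁`, `C² = S.X₂`,
`C³ = S.X₃`): its objects are the elements of `C³`. -/
@[ext]
structure CochainBicat (S : ShortComplex Ab.{u}) where
  val : S.X₃

namespace CochainBicat

variable {S : ShortComplex Ab.{u}}

/-- A 1-morphism `x ⟶ y` is an element `c` of `C²` with `y = x + d c`. -/
@[ext]
structure Hom₁ (x y : CochainBicat S) where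
  val : S.X₂
  prop : y.val = x.val + S.g.hom val

/-- A 2-morphism `f ⟶ g` is an element `e` of `C¹` with `g = f + d e`. -/
@[ext]
structure Hom₂ {x y : CochainBicat S} (f g : Hom₁ x y) where
  val : S.X₁
  prop : g.val = f.val + S.f.hom val

section Construction

/-- Composition of 1-morphisms is addition in `C²`. -/
@[reducible] def catStruct : CategoryStruct (CochainBicat S) where
  Hom := Hom₁
  id x := ⟨0, by simp⟩
  comp f g := ⟨f.val + g.val, by rw [g.prop, f.prop, map_add, add_assoc]⟩

attribute [local instance] catStruct

/-- Vertical composition of 2-morphisms is addition in `C¹`. -/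
@[reducible] def homCat (x y : CochainBicat S) : Category (x ⟶ y) where
  Hom f g := Hom₂ f g
  id f := ⟨0, by simp⟩
  comp η θ := ⟨η.val + θ.val, by rw [θ.prop, η.prop, map_add, add_assoc]⟩
  id_comp η := Hom₂.ext (zero_add _)
  comp_id η := Hom₂.ext (add_zero _)
  assoc η θ ζ := Hom₂.ext (add_assoc _ _ _)

attribute [local instance] homCat

lemma sandwich (e : S.X₁) : 0 + (e + 0) = e := by rw [zero_add, add_zero]

/-- The identity 2-isomorphism between equal 1-morphisms. -/
def preIso {x y : CochainBicat S} {f g : x ⟶ y} (h : Hom₁.val g = Hom₁.val f) : f ≅ g where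
  hom := Hom₂.mk 0 (by rw [h, map_zero, add_zero])
  inv := Hom₂.mk 0 (by rw [h, map_zero, add_zero])
  hom_inv_id := Hom₂.ext (add_zero 0)
  inv_hom_id := Hom₂.ext (add_zero 0)

/-- The bicategory structure: horizontal composition of 2-morphisms is addition in `C¹`;
associators and unitors are identities. -/
instance : Bicategory (CochainBicat S) where
  toCategoryStruct := catStruct
  homCategory := homCat
  whiskerLeft f _ _ η := Hom₂.mk (Hom₂.val η)
    ((congrArg (Hom₁.val f + ·) (Hom₂.prop η)).trans (add_assoc _ _ _).symm)
  whiskerRight η h := Hom₂.mk (Hom₂.val η)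
    ((congrArg (· + Hom₁.val h) (Hom₂.prop η)).trans (add_right_comm _ _ _))
  associator _ _ _ := preIso (add_assoc _ _ _).symm
  leftUnitor _ := preIso (zero_add _).symm
  rightUnitor _ := preIso (add_zero _).symm
  whiskerLeft_id _ _ := rfl
  whiskerLeft_comp _ _ _ _ _ _ := rfl
  id_whiskerLeft _ := Hom₂.ext (sandwich _).symm
  comp_whiskerLeft _ _ _ _ _ := Hom₂.ext (sandwich _).symm
  id_whiskerRight _ _ := rfl
  comp_whiskerRight _ _ _ := rfl
  whiskerRight_id _ := Hom₂.ext (sandwich _).symm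
  whiskerRight_comp _ _ _ := Hom₂.ext (sandwich _).symm
  whisker_assoc _ _ _ _ _ := Hom₂.ext (sandwich _).symm
  whisker_exchange _ _ := Hom₂.ext (add_comm _ _)
  pentagon _ _ _ _ := Hom₂.ext (zero_add _)
  triangle _ _ := Hom₂.ext (zero_add _)

end Construction

/-- The element of `C²` underlying a 1-morphism. -/
def v₁ {x y : CochainBicat S} (f : x ⟶ y) : S.X₂ := Hom₁.val f

/-- The element of `C¹` underlying a 2-morphism. -/
def v₂ {x y : CochainBicat S} {f g : x ⟶ y} (η : f ⟶ g) : S.X₁ := Hom₂.val η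

/-- The 1-morphism given by an element of `C²`. -/
def mk₁ {x y : CochainBicat S} (c : S.X₂) (h : y.val = x.val + S.g.hom c) : x ⟶ y := Hom₁.mk c h

/-- The 2-morphism given by an element of `C¹`. -/
def mk₂ {x y : CochainBicat S} {f g : x ⟶ y} (e : S.X₁) (h : v₁ g = v₁ f + S.f.hom e) : f ⟶ g :=
  Hom₂.mk e h

lemma v₁_prop {x y : CochainBicat S} (f : x ⟶ y) : y.val = x.val + S.g.hom (v₁ f) := Hom₁.prop f

lemma v₂_prop {x y : CochainBicat S} {f g : x ⟶ y} (η : f ⟶ g) :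
    v₁ g = v₁ f + S.f.hom (v₂ η) := Hom₂.prop η

lemma hom₂_ext {x y : CochainBicat S} {f g : x ⟶ y} {η θ : f ⟶ g} (h : v₂ η = v₂ θ) : η = θ :=
  Hom₂.ext h

lemma iso_ext {x y : CochainBicat S} {f g : x ⟶ y} {η θ : f ≅ g}
    (h : v₂ η.hom = v₂ θ.hom) : η = θ := Iso.ext (Hom₂.ext h)

@[simp] lemma mk₁_val {x y : CochainBicat S} (c : S.X₂) (h : y.val = x.val + S.g.hom c) :
    v₁ (mk₁ c h : x ⟶ y) = c := rfl
@[simp] lemma mk₂_val {x y : CochainBicat S} {f g : x ⟶ y} (e : S.X₁)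
    (h : v₁ g = v₁ f + S.f.hom e) : v₂ (mk₂ e h : f ⟶ g) = e := rfl
@[simp] lemma id_val (x : CochainBicat S) : v₁ (𝟙 x) = 0 := rfl
@[simp] lemma comp_val {x y z : CochainBicat S} (f : x ⟶ y) (g : y ⟶ z) :
    v₁ (f ≫ g) = v₁ f + v₁ g := rfl
@[simp] lemma id₂_val {x y : CochainBicat S} (f : x ⟶ y) : v₂ (𝟙 f) = 0 := rfl
@[simp] lemma comp₂_val {x y : CochainBicat S} {f g h : x ⟶ y} (η : f ⟶ g) (θ : g ⟶ h) :
    v₂ (η ≫ θ) = v₂ η + v₂ θ := rfl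
@[simp] lemma whiskerLeft_val {x y z : CochainBicat S} (f : x ⟶ y) {g h : y ⟶ z} (η : g ⟶ h) :
    v₂ (f ◁ η) = v₂ η := rfl
@[simp] lemma whiskerRight_val {x y z : CochainBicat S} {f g : x ⟶ y} (η : f ⟶ g) (h : y ⟶ z) :
    v₂ (η ▷ h) = v₂ η := rfl
@[simp] lemma associator_hom_val {x y z t : CochainBicat S} (f : x ⟶ y) (g : y ⟶ z)
    (h : z ⟶ t) : v₂ (α_ f g h).hom = 0 := rfl
@[simp] lemma associator_inv_val {x y z t : CochainBicat S} (f : x ⟶ y) (g : y ⟶ z)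
    (h : z ⟶ t) : v₂ (α_ f g h).inv = 0 := rfl
@[simp] lemma leftUnitor_hom_val {x y : CochainBicat S} (f : x ⟶ y) : v₂ (λ_ f).hom = 0 := rfl
@[simp] lemma leftUnitor_inv_val {x y : CochainBicat S} (f : x ⟶ y) : v₂ (λ_ f).inv = 0 := rfl
@[simp] lemma rightUnitor_hom_val {x y : CochainBicat S} (f : x ⟶ y) : v₂ (ρ_ f).hom = 0 := rfl
@[simp] lemma rightUnitor_inv_val {x y : CochainBicat S} (f : x ⟶ y) : v₂ (ρ_ f).inv = 0 := rfl

/-- The identity 2-isomorphism between 1-morphisms with the same underlying element of `C²`. -/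
def eqIso {x y : CochainBicat S} {f g : x ⟶ y} (h : v₁ g = v₁ f) : f ≅ g where
  hom := mk₂ 0 (by simp [h])
  inv := mk₂ 0 (by simp [h])
  hom_inv_id := hom₂_ext (add_zero 0)
  inv_hom_id := hom₂_ext (add_zero 0)

@[simp] lemma eqIso_hom_val {x y : CochainBicat S} {f g : x ⟶ y} (h : v₁ g = v₁ f) :
    v₂ (eqIso h).hom = 0 := rfl
@[simp] lemma eqIso_inv_val {x y : CochainBicat S} {f g : x ⟶ y} (h : v₁ g = v₁ f) :
    v₂ (eqIso h).inv = 0 := rfl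

/-- The tensor product is addition on objects, 1-morphisms and 2-morphisms. -/
instance : TensorBicat (CochainBicat S) where
  tensor :=
    { obj := fun p => ⟨p.1.val + p.2.val⟩
      map := fun f => mk₁ (v₁ f.1 + v₁ f.2) (by
        rw [v₁_prop f.1, v₁_prop f.2, map_add]; exact add_add_add_comm _ _ _ _)
      map₂ := fun η => mk₂ (v₂ η.1 + v₂ η.2) (by
        rw [mk₁_val, mk₁_val, v₂_prop η.1, v₂_prop η.2, map_add]
        exact add_add_add_comm _ _ _ _)
      map₂_id := fun _ => hom₂_ext (add_zero _)
      map₂_comp := fun _ _ => hom₂_ext (add_add_add_comm _ _ _ _)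
      mapId := fun _ => eqIso (by simp)
      mapComp := fun _ _ => eqIso (by simp [add_add_add_comm])
      map₂_whisker_left := fun _ _ _ _ => hom₂_ext (sandwich _).symm
      map₂_whisker_right := fun _ _ => hom₂_ext (sandwich _).symm
      map₂_associator := fun _ _ _ => hom₂_ext (by
        change (0 : S.X₁) + 0 = 0 + (0 + (0 + (0 + 0))); simp)
      map₂_left_unitor := fun _ => hom₂_ext (by change (0 : S.X₁) + 0 = 0 + (0 + 0); simp)
      map₂_right_unitor := fun _ => hom₂_ext (by change (0 : S.X₁) + 0 = 0 + (0 + 0); simp) }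
  unit := ⟨0⟩

@[simp] lemma tensorObj_val (x y : CochainBicat S) : (x ⊠ y).val = x.val + y.val := rfl
@[simp] lemma one_val : (one (CochainBicat S)).val = 0 := rfl
@[simp] lemma tensorHom_val {x x' y y' : CochainBicat S} (f : x ⟶ x') (g : y ⟶ y') :
    v₁ (f ⊠₁ g) = v₁ f + v₁ g := rfl
@[simp] lemma tensorHom₂_val {x x' y y' : CochainBicat S} {f f' : x ⟶ x'} {g g' : y ⟶ y'}
    (η : f ⟶ f') (θ : g ⟶ g') : v₂ (tensorHom₂ η θ) = v₂ η + v₂ θ := rfl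
@[simp] lemma tensorIso_hom_val {x x' y y' : CochainBicat S} {f f' : x ⟶ x'} {g g' : y ⟶ y'}
    (η : f ≅ f') (θ : g ≅ g') :
    v₂ (η ⊠₂ θ).hom = v₂ η.hom + v₂ θ.hom := rfl
@[simp] lemma tensorIso_inv_val {x x' y y' : CochainBicat S} {f f' : x ⟶ x'} {g g' : y ⟶ y'}
    (η : f ≅ f') (θ : g ≅ g') :
    v₂ (η ⊠₂ θ).inv = v₂ η.inv + v₂ θ.inv := rfl
@[simp] lemma tensorId_hom_val (x y : CochainBicat S) :
    v₂ (tensorId x y).hom = 0 := rfl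
@[simp] lemma tensorId_inv_val (x y : CochainBicat S) :
    v₂ (tensorId x y).inv = 0 := rfl
@[simp] lemma tensorComp_hom_val {x x' x'' y y' y'' : CochainBicat S} (f : x ⟶ x')
    (f' : x' ⟶ x'') (g : y ⟶ y') (g' : y' ⟶ y'') :
    v₂ (tensorComp f f' g g').hom = 0 := rfl
@[simp] lemma tensorComp_inv_val {x x' x'' y y' y'' : CochainBicat S} (f : x ⟶ x')
    (f' : x' ⟶ x'') (g : y ⟶ y') (g' : y' ⟶ y'') :
    v₂ (tensorComp f f' g g').inv = 0 := rfl

/-- The identity equivalence between objects with the same underlying element of `C³`. -/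
def eqEquiv {x y : CochainBicat S} (h : y.val = x.val) : x ≌ y where
  hom := mk₁ 0 (by simp [h])
  inv := mk₁ 0 (by simp [h])
  unit := eqIso (by simp)
  counit := eqIso (by simp)
  left_triangle := iso_ext (by
    simp only [leftZigzagIso, bicategoricalIsoComp, Iso.trans_hom, comp₂_val]
    simp [BicategoricalCoherence.iso]
    try exact add_zero (0 : S.X₁))

@[simp] lemma eqEquiv_hom_val {x y : CochainBicat S} (h : y.val = x.val) :
    v₁ (eqEquiv h).hom = 0 := rfl
@[simp] lemma eqEquiv_inv_val {x y : CochainBicat S} (h : y.val = x.val) :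
    v₁ (eqEquiv h).inv = 0 := rfl
@[simp] lemma eqEquiv_unit_hom_val {x y : CochainBicat S} (h : y.val = x.val) :
    v₂ (eqEquiv h).unit.hom = 0 := rfl
@[simp] lemma eqEquiv_unit_inv_val {x y : CochainBicat S} (h : y.val = x.val) :
    v₂ (eqEquiv h).unit.inv = 0 := rfl
@[simp] lemma eqEquiv_counit_hom_val {x y : CochainBicat S} (h : y.val = x.val) :
    v₂ (eqEquiv h).counit.hom = 0 := rfl
@[simp] lemma eqEquiv_counit_inv_val {x y : CochainBicat S} (h : y.val = x.val) :
    v₂ (eqEquiv h).counit.inv = 0 := rfl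

/-- The associator. -/
def asc' (a b c : CochainBicat S) : a ⊠ b ⊠ c ≌ a ⊠ (b ⊠ c) :=
  eqEquiv (add_assoc _ _ _).symm

/-- The left unitor. -/
def lu' (a : CochainBicat S) : one (CochainBicat S) ⊠ a ≌ a := eqEquiv (zero_add _).symm

/-- The right unitor. -/
def ru' (a : CochainBicat S) : a ⊠ one (CochainBicat S) ≌ a := eqEquiv (add_zero _).symm

/-- The braiding. -/
def br' (a b : CochainBicat S) : a ⊠ b ≌ b ⊠ a := eqEquiv (add_comm _ _)

@[simp] lemma asc'_hom_val (a b c : CochainBicat S) : v₁ (asc' a b c).hom = 0 := rfl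
@[simp] lemma asc'_inv_val (a b c : CochainBicat S) : v₁ (asc' a b c).inv = 0 := rfl
@[simp] lemma lu'_hom_val (a : CochainBicat S) : v₁ (lu' a).hom = 0 := rfl
@[simp] lemma ru'_hom_val (a : CochainBicat S) : v₁ (ru' a).hom = 0 := rfl
@[simp] lemma br'_hom_val (a b : CochainBicat S) : v₁ (br' a b).hom = 0 := rfl

/-- All structure cells are identities. -/
instance : SymMonBicatData (CochainBicat S) where
  asc := asc'
  ascN f g h := eqIso (by simp [add_assoc])
  lu := lu'
  luN f := eqIso (by simp)
  ru := ru'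
  ruN f := eqIso (by simp)
  pent a b c d := eqIso (by simp)
  mid a b := eqIso (by simp)
  lun a b := eqIso (by simp)
  run a b := eqIso (by simp)
  br := br'
  brN f g := eqIso (by simp [add_comm])
  hexR a b c := eqIso (by simp)
  hexS a b c := eqIso (by simp)
  syl a b := eqIso (by simp)

end CochainBicat

namespace CochainBicat

variable {S : ShortComplex Ab.{u}}

/-! Underlying elements of the structure cells, for the verification of the axioms. -/

@[simp] lemma inv_v {x y : CochainBicat S} {f g : x ⟶ y} (η : f ≅ g) :
    v₂ η.inv = -v₂ η.hom :=
  eq_neg_of_add_eq_zero_right (congrArg v₂ η.hom_inv_id)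

@[simp] lemma bicategoricalIsoComp_v {x y : CochainBicat S} {f g h i : x ⟶ y}
    [BicategoricalCoherence g h] (η : f ≅ g) (θ : h ≅ i) :
    v₂ (η ≪⊗≫ θ).hom = v₂ η.hom + (v₂ (⊗𝟙 : g ≅ h).hom + v₂ θ.hom) := rfl

@[simp] lemma asc_hom_val (a b c : CochainBicat S) : v₁ (asc a b c).hom = 0 := rfl
@[simp] lemma asc_inv_val (a b c : CochainBicat S) : v₁ (asc a b c).inv = 0 := rfl
@[simp] lemma lu_hom_val (a : CochainBicat S) : v₁ (lu a).hom = 0 := rfl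
@[simp] lemma ru_hom_val (a : CochainBicat S) : v₁ (ru a).hom = 0 := rfl
@[simp] lemma br_hom_val (a b : CochainBicat S) : v₁ (br a b).hom = 0 := rfl
@[simp] lemma asc_unit_v (a b c : CochainBicat S) : v₂ (asc a b c).unit.hom = 0 := rfl
@[simp] lemma asc_counit_v (a b c : CochainBicat S) : v₂ (asc a b c).counit.hom = 0 := rfl
@[simp] lemma pent_v (a b c d : CochainBicat S) : v₂ (pent a b c d).hom = 0 := rfl
@[simp] lemma mid_v (a b : CochainBicat S) : v₂ (mid a b).hom = 0 := rfl
@[simp] lemma lun_v (a b : CochainBicat S) : v₂ (lun a b).hom = 0 := rfl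
@[simp] lemma run_v (a b : CochainBicat S) : v₂ (run a b).hom = 0 := rfl
@[simp] lemma hexR_v (a b c : CochainBicat S) : v₂ (hexR a b c).hom = 0 := rfl
@[simp] lemma hexS_v (a b c : CochainBicat S) : v₂ (hexS a b c).hom = 0 := rfl
@[simp] lemma syl_v (a b : CochainBicat S) : v₂ (syl a b).hom = 0 := rfl
@[simp] lemma ascN_v {a a' b b' c c' : CochainBicat S} (f : a ⟶ a') (g : b ⟶ b')
    (h : c ⟶ c') : v₂ (ascN f g h).hom = 0 := rfl
@[simp] lemma luN_v {a a' : CochainBicat S} (f : a ⟶ a') : v₂ (luN f).hom = 0 := rfl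
@[simp] lemma ruN_v {a a' : CochainBicat S} (f : a ⟶ a') : v₂ (ruN f).hom = 0 := rfl
@[simp] lemma brN_v {a a' b b' : CochainBicat S} (f : a ⟶ a') (g : b ⟶ b') :
    v₂ (brN f g).hom = 0 := rfl

@[simp] lemma sqV_v {a a' b b' c c' : CochainBicat S} {f : a ⟶ a'} {t : a ⟶ b} {t' : a' ⟶ b'} {g : b ⟶ b'}
    {s : b ⟶ c} {s' : b' ⟶ c'} {h : c ⟶ c'} (p : f ≫ t' ≅ t ≫ g) (q : g ≫ s' ≅ s ≫ h) :
    v₂ (sqV p q).hom = v₂ p.hom + v₂ q.hom := by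
  simp [sqV]
@[simp] lemma sqH_v {a a' a'' b b' b'' : CochainBicat S} {f : a ⟶ a'} {f₂ : a' ⟶ a''} {t : a ⟶ b}
    {t' : a' ⟶ b'} {t'' : a'' ⟶ b''} {g : b ⟶ b'} {g₂ : b' ⟶ b''} (p : f ≫ t' ≅ t ≫ g)
    (q : f₂ ≫ t'' ≅ t' ≫ g₂) :
    v₂ (sqH p q).hom = v₂ q.hom + v₂ p.hom := by
  simp [sqH]
@[simp] lemma sqId_v {a a' : CochainBicat S} (f : a ⟶ a') :
    v₂ (sqId f).hom = 0 := by
  simp [sqId]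
@[simp] lemma sqOne_v {a a' : CochainBicat S} (f : a ⟶ a') :
    v₂ (sqOne f).hom = 0 := by
  simp [sqOne]
@[simp] lemma sqMate_v {a a' b b' : CochainBicat S} {f : a ⟶ a'} {g : b ⟶ b'} (e : a ≌ b) (e' : a' ≌ b')
    (p : f ≫ e'.hom ≅ e.hom ≫ g) :
    v₂ (sqMate e e' p).hom = -v₂ e.counit.hom + (-v₂ p.hom + -v₂ e'.unit.hom) := by
  simp [sqMate]
@[simp] lemma sqT_v {a a' b b' : CochainBicat S} {f : a ⟶ a'} {t : a ⟶ b} {t' : a' ⟶ b'} {g : b ⟶ b'}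
    {c c' d d' : CochainBicat S} {h : c ⟶ c'} {s : c ⟶ d} {s' : c' ⟶ d'} {k : d ⟶ d'}
    (p : f ≫ t' ≅ t ≫ g) (q : h ≫ s' ≅ s ≫ k) :
    v₂ (sqT p q).hom = v₂ p.hom + v₂ q.hom := by
  simp [sqT]
@[simp] lemma sqR_v {a a' b b' : CochainBicat S} {f : a ⟶ a'} {t : a ⟶ b} {t' : a' ⟶ b'} {g : b ⟶ b'}
    (p : f ≫ t' ≅ t ≫ g) {x x' : CochainBicat S} (k : x ⟶ x') :
    v₂ (sqR p k).hom = v₂ p.hom := by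
  simp [sqR]
@[simp] lemma sqL_v {x x' : CochainBicat S} (k : x ⟶ x') {a a' b b' : CochainBicat S} {f : a ⟶ a'} {t : a ⟶ b} {t' : a' ⟶ b'} {g : b ⟶ b'}
    (p : f ≫ t' ≅ t ≫ g) :
    v₂ (sqL k p).hom = v₂ p.hom := by
  simp [sqL]
@[simp] lemma isoR_v {a a' : CochainBicat S} {f f' : a ⟶ a'} (η : f ≅ f') (c : CochainBicat S) :
    v₂ (isoR η c).hom = v₂ η.hom := by
  simp [isoR]
@[simp] lemma isoL_v (c : CochainBicat S) {a a' : CochainBicat S} {f f' : a ⟶ a'} (η : f ≅ f') :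
    v₂ (isoL c η).hom = v₂ η.hom := by
  simp [isoL]
@[simp] lemma compR_v {a b c : CochainBicat S} (f : a ⟶ b) (g : b ⟶ c) (x : CochainBicat S) :
    v₂ (compR f g x).hom = 0 := by
  simp [compR]
@[simp] lemma compL_v (x : CochainBicat S) {a b c : CochainBicat S} (f : a ⟶ b) (g : b ⟶ c) :
    v₂ (compL x f g).hom = 0 := by
  simp [compL]
@[simp] lemma compR3_v {a b c d : CochainBicat S} (f : a ⟶ b) (g : b ⟶ c) (h : c ⟶ d)
    (x : CochainBicat S) :
    v₂ (compR3 f g h x).hom = 0 := by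
  simp [compR3]
@[simp] lemma compL3_v (x : CochainBicat S) {a b c d : CochainBicat S} (f : a ⟶ b) (g : b ⟶ c) (h : c ⟶ d) :
    v₂ (compL3 x f g h).hom = 0 := by
  simp [compL3]
@[simp] lemma compR5_v {a b c d e e' : CochainBicat S} (f : a ⟶ b) (g : b ⟶ c)
    (h : c ⟶ d) (k : d ⟶ e) (l : e ⟶ e') (x : CochainBicat S) :
    v₂ (compR5 f g h k l x).hom = 0 := by
  simp [compR5]
@[simp] lemma compL5_v (x : CochainBicat S) {a b c d e e' : CochainBicat S} (f : a ⟶ b) (g : b ⟶ c)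
    (h : c ⟶ d) (k : d ⟶ e) (l : e ⟶ e') :
    v₂ (compL5 x f g h k l).hom = 0 := by
  simp [compL5]
@[simp] lemma exch_v {a a' b b' : CochainBicat S} (f : a ⟶ a') (g : b ⟶ b') :
    v₂ (exch f g).hom = 0 := by
  simp [exch]
@[simp] lemma unitL_v (x : CochainBicat S) {a b : CochainBicat S} (e : a ≌ b) :
    v₂ (unitL x e).hom = -v₂ e.unit.hom := by
  simp [unitL]
@[simp] lemma counitR_v {a b : CochainBicat S} (e : a ≌ b) (x : CochainBicat S) :
    v₂ (counitR e x).hom = v₂ e.counit.hom := by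
  simp [counitR]
@[simp] lemma counitL_v (x : CochainBicat S) {a b : CochainBicat S} (e : a ≌ b) :
    v₂ (counitL x e).hom = v₂ e.counit.hom := by
  simp [counitL]
@[simp] lemma asA_v {a a' : CochainBicat S} (f : a ⟶ a') (b c : CochainBicat S) :
    v₂ (asA f b c).hom = 0 := by
  simp [asA]
@[simp] lemma asB_v (a : CochainBicat S) {b b' : CochainBicat S} (f : b ⟶ b') (c : CochainBicat S) :
    v₂ (asB a f c).hom = 0 := by
  simp [asB]
@[simp] lemma asC_v (a b : CochainBicat S) {c c' : CochainBicat S} (f : c ⟶ c') :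
    v₂ (asC a b f).hom = 0 := by
  simp [asC]
@[simp] lemma aiA_v {a a' : CochainBicat S} (f : a ⟶ a') (b c : CochainBicat S) :
    v₂ (aiA f b c).hom = 0 := by
  simp [aiA]
@[simp] lemma aiB_v (a : CochainBicat S) {b b' : CochainBicat S} (f : b ⟶ b') (c : CochainBicat S) :
    v₂ (aiB a f c).hom = 0 := by
  simp [aiB]
@[simp] lemma aiC_v (a b : CochainBicat S) {c c' : CochainBicat S} (f : c ⟶ c') :
    v₂ (aiC a b f).hom = 0 := by
  simp [aiC]
@[simp] lemma aiN_v {a a' b b' c c' : CochainBicat S} (f : a ⟶ a') (g : b ⟶ b') (h : c ⟶ c') :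
    v₂ (aiN f g h).hom = 0 := by
  simp [aiN]
@[simp] lemma btA_v {a a' : CochainBicat S} (f : a ⟶ a') (b : CochainBicat S) :
    v₂ (btA f b).hom = 0 := by
  simp [btA]
@[simp] lemma btB_v (a : CochainBicat S) {b b' : CochainBicat S} (f : b ⟶ b') :
    v₂ (btB a f).hom = 0 := by
  simp [btB]
@[simp] lemma pentI₁_v (a b c d : CochainBicat S) :
    v₂ (pentI₁ a b c d).hom = 0 := by
  simp [pentI₁]
@[simp] lemma pentI₂_v (a b c d : CochainBicat S) :
    v₂ (pentI₂ a b c d).hom = 0 := by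
  simp [pentI₂]
@[simp] lemma pentI_v (a b c d : CochainBicat S) :
    v₂ (pentI a b c d).hom = 0 := by
  simp [pentI]
@[simp] lemma hexR'_v (a b c : CochainBicat S) :
    v₂ (hexR' a b c).hom = 0 := by
  simp [hexR']
@[simp] lemma hexS'_v (a b c : CochainBicat S) :
    v₂ (hexS' a b c).hom = 0 := by
  simp [hexS']

set_option maxHeartbeats 2000000 in
instance : SymMonBicat (CochainBicat S) where
  ascN_naturality η θ ζ := hom₂_ext (by simp [add_assoc])
  ascN_id a b c := iso_ext (by simp)
  ascN_comp f f' g g' h h' := iso_ext (by simp)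
  luN_naturality η := hom₂_ext (by simp)
  luN_id a := iso_ext (by simp)
  luN_comp f f' := iso_ext (by simp)
  ruN_naturality η := hom₂_ext (by simp)
  ruN_id a := iso_ext (by simp)
  ruN_comp f f' := iso_ext (by simp)
  brN_naturality η θ := hom₂_ext (by simp [add_comm])
  brN_id a b := iso_ext (by simp)
  brN_comp f f' g g' := iso_ext (by simp)
  pent_mod f g h k := iso_ext (by simp)
  mid_mod f g := iso_ext (by simp)
  lun_mod f g := iso_ext (by simp)
  run_mod f g := iso_ext (by simp)
  hexR_mod f g h := iso_ext (by simp)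
  hexS_mod f g h := iso_ext (by simp)
  syl_mod f g := iso_ext (by simp)
  pent_cocycle a b c d e := iso_ext (by simp)
  pent_left a b c := iso_ext (by simp)
  pent_right a b c := iso_ext (by simp)
  braid_one_three a b c d := iso_ext (by simp)
  braid_three_one a b c d := iso_ext (by simp)
  braid_two_two a b c d := iso_ext (by
    simp only [bicategoricalIsoComp_v, BicategoricalCoherence.whiskerRight_iso,
      BicategoricalCoherence.whiskerLeft_iso, BicategoricalCoherence.refl_iso,
      BicategoricalCoherence.assoc_iso, BicategoricalCoherence.assoc'_iso, Iso.trans_hom,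
      Iso.symm_hom, Iso.refl_hom, whiskerRightIso_hom, whiskerLeftIso_hom, comp₂_val, id₂_val,
      whiskerLeft_val, whiskerRight_val, associator_hom_val, inv_v, neg_zero, add_zero, hexR'_v,
      hexS'_v, isoR_v, isoL_v, compR5_v, compL5_v, pentI₁_v, pentI₂_v, pentI_v, pent_v, asA_v,
      asC_v, aiA_v, aiB_v, aiC_v, exch_v])
  yang_baxter a b c := iso_ext (by simp)
  syl_left a b c := iso_ext (by simp)
  syl_right a b c := iso_ext (by simp)
  syl_symm a b := iso_ext (by simp)

end CochainBicat

/-! ### Products of symmetric monoidal bicategories -/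

section Product

variable {M N : Type u} [Bicategory.{w, v} M] [Bicategory.{w, v} N]

/-- A pair of adjoint equivalences is an adjoint equivalence in the product. -/
def prodEquiv {a a' : M} {b b' : N} (e : a ≌ a') (e' : b ≌ b') : (a, b) ≌ (a', b') where
  hom := Prod.mkHom e.hom e'.hom
  inv := Prod.mkHom e.inv e'.inv
  unit := Iso.prod e.unit e'.unit
  counit := Iso.prod e.counit e'.counit
  left_triangle := Iso.ext (Prod.ext (congrArg Iso.hom e.left_triangle)
    (congrArg Iso.hom e'.left_triangle))

lemma tensorHom₂_comp [TensorBicat M] {a a' b b' : M} {f f' f'' : a ⟶ a'} {g g' g'' : b ⟶ b'}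
    (η : f ⟶ f') (η' : f' ⟶ f'') (θ : g ⟶ g') (θ' : g' ⟶ g'') :
    tensorHom₂ (η ≫ η') (θ ≫ θ') = tensorHom₂ η θ ≫ tensorHom₂ η' θ' :=
  (TensorBicat.tensor (B := M)).map₂_comp (f := Prod.mkHom f g) (g := Prod.mkHom f' g')
    (h := Prod.mkHom f'' g'') (Prod.mkHom η θ) (Prod.mkHom η' θ')

/-- The componentwise tensor product. -/
instance [TensorBicat M] [TensorBicat N] : TensorBicat (M × N) where
  tensor :=
    { obj := fun p => (p.1.1 ⊠ p.2.1, p.1.2 ⊠ p.2.2)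
      map := fun f => Prod.mkHom (f.1.1 ⊠₁ f.2.1) (f.1.2 ⊠₁ f.2.2)
      map₂ := fun η => Prod.mkHom (tensorHom₂ η.1.1 η.2.1) (tensorHom₂ η.1.2 η.2.2)
      map₂_id := fun _ => Prod.ext (TensorBicat.tensor.map₂_id _) (TensorBicat.tensor.map₂_id _)
      map₂_comp := fun η θ => Prod.ext
        (tensorHom₂_comp η.1.1 θ.1.1 η.2.1 θ.2.1) (tensorHom₂_comp η.1.2 θ.1.2 η.2.2 θ.2.2)
      mapId := fun p => Iso.prod (tensorId p.1.1 p.2.1) (tensorId p.1.2 p.2.2)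
      mapComp := fun f g => Iso.prod (tensorComp f.1.1 g.1.1 f.2.1 g.2.1)
        (tensorComp f.1.2 g.1.2 f.2.2 g.2.2)
      map₂_whisker_left := fun f g h η => Prod.ext
        (TensorBicat.tensor.map₂_whisker_left (Prod.mkHom f.1.1 f.2.1)
          (g := Prod.mkHom g.1.1 g.2.1) (h := Prod.mkHom h.1.1 h.2.1) (Prod.mkHom η.1.1 η.2.1))
        (TensorBicat.tensor.map₂_whisker_left (Prod.mkHom f.1.2 f.2.2)
          (g := Prod.mkHom g.1.2 g.2.2) (h := Prod.mkHom h.1.2 h.2.2) (Prod.mkHom η.1.2 η.2.2))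
      map₂_whisker_right := fun {_ _ _ f g} η h => Prod.ext
        (TensorBicat.tensor.map₂_whisker_right (f := Prod.mkHom f.1.1 f.2.1)
          (g := Prod.mkHom g.1.1 g.2.1) (Prod.mkHom η.1.1 η.2.1) (Prod.mkHom h.1.1 h.2.1))
        (TensorBicat.tensor.map₂_whisker_right (f := Prod.mkHom f.1.2 f.2.2)
          (g := Prod.mkHom g.1.2 g.2.2) (Prod.mkHom η.1.2 η.2.2) (Prod.mkHom h.1.2 h.2.2))
      map₂_associator := fun f g h => Prod.ext
        (TensorBicat.tensor.map₂_associator (Prod.mkHom f.1.1 f.2.1) (Prod.mkHom g.1.1 g.2.1)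
          (Prod.mkHom h.1.1 h.2.1))
        (TensorBicat.tensor.map₂_associator (Prod.mkHom f.1.2 f.2.2) (Prod.mkHom g.1.2 g.2.2)
          (Prod.mkHom h.1.2 h.2.2))
      map₂_left_unitor := fun f => Prod.ext
        (TensorBicat.tensor.map₂_left_unitor (Prod.mkHom f.1.1 f.2.1))
        (TensorBicat.tensor.map₂_left_unitor (Prod.mkHom f.1.2 f.2.2))
      map₂_right_unitor := fun f => Prod.ext
        (TensorBicat.tensor.map₂_right_unitor (Prod.mkHom f.1.1 f.2.1))
        (TensorBicat.tensor.map₂_right_unitor (Prod.mkHom f.1.2 f.2.2)) }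
  unit := (one M, one N)

section

variable [SymMonBicatData M] [SymMonBicatData N]

def prodAsc (a b c : M × N) : a ⊠ b ⊠ c ≌ a ⊠ (b ⊠ c) :=
  prodEquiv (asc a.1 b.1 c.1) (asc a.2 b.2 c.2)

def prodLu (a : M × N) : one (M × N) ⊠ a ≌ a := prodEquiv (lu a.1) (lu a.2)

def prodRu (a : M × N) : a ⊠ one (M × N) ≌ a := prodEquiv (ru a.1) (ru a.2)

def prodBr (a b : M × N) : a ⊠ b ≌ b ⊠ a := prodEquiv (br a.1 b.1) (br a.2 b.2)

end

/-- Componentwise structure cells. -/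
instance [SymMonBicatData M] [SymMonBicatData N] : SymMonBicatData (M × N) where
  asc := prodAsc
  ascN f g h := Iso.prod (ascN f.1 g.1 h.1) (ascN f.2 g.2 h.2)
  lu := prodLu
  luN f := Iso.prod (luN f.1) (luN f.2)
  ru := prodRu
  ruN f := Iso.prod (ruN f.1) (ruN f.2)
  pent a b c d := Iso.prod (pent a.1 b.1 c.1 d.1) (pent a.2 b.2 c.2 d.2)
  mid a b := Iso.prod (mid a.1 b.1) (mid a.2 b.2)
  lun a b := Iso.prod (lun a.1 b.1) (lun a.2 b.2)
  run a b := Iso.prod (run a.1 b.1) (run a.2 b.2)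
  br := prodBr
  brN f g := Iso.prod (brN f.1 g.1) (brN f.2 g.2)
  hexR a b c := Iso.prod (hexR a.1 b.1 c.1) (hexR a.2 b.2 c.2)
  hexS a b c := Iso.prod (hexS a.1 b.1 c.1) (hexS a.2 b.2 c.2)
  syl a b := Iso.prod (syl a.1 b.1) (syl a.2 b.2)

lemma isoProd_ext {a b : M × N} {f g : a ⟶ b} {η θ : f ≅ g}
    (h : (⟨η.hom.1, η.inv.1, congrArg Prod.fst η.hom_inv_id, congrArg Prod.fst η.inv_hom_id⟩ :
      f.1 ≅ g.1) = ⟨θ.hom.1, θ.inv.1, congrArg Prod.fst θ.hom_inv_id,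
        congrArg Prod.fst θ.inv_hom_id⟩)
    (h' : (⟨η.hom.2, η.inv.2, congrArg Prod.snd η.hom_inv_id, congrArg Prod.snd η.inv_hom_id⟩ :
      f.2 ≅ g.2) = ⟨θ.hom.2, θ.inv.2, congrArg Prod.snd θ.hom_inv_id,
        congrArg Prod.snd θ.inv_hom_id⟩) : η = θ :=
  Iso.ext (Prod.ext (congrArg Iso.hom h) (congrArg Iso.hom h'))

set_option maxHeartbeats 2000000 in
instance [SymMonBicat M] [SymMonBicat N] : SymMonBicat (M × N) where
  ascN_naturality η θ ζ := Prod.ext (SymMonBicat.ascN_naturality η.1 θ.1 ζ.1)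
    (SymMonBicat.ascN_naturality η.2 θ.2 ζ.2)
  ascN_id a b c := isoProd_ext (SymMonBicat.ascN_id a.1 b.1 c.1)
    (SymMonBicat.ascN_id a.2 b.2 c.2)
  ascN_comp f f' g g' h h' := isoProd_ext (SymMonBicat.ascN_comp f.1 f'.1 g.1 g'.1 h.1 h'.1)
    (SymMonBicat.ascN_comp f.2 f'.2 g.2 g'.2 h.2 h'.2)
  luN_naturality η := Prod.ext (SymMonBicat.luN_naturality η.1)
    (SymMonBicat.luN_naturality η.2)
  luN_id a := isoProd_ext (SymMonBicat.luN_id a.1)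
    (SymMonBicat.luN_id a.2)
  luN_comp f f' := isoProd_ext (SymMonBicat.luN_comp f.1 f'.1)
    (SymMonBicat.luN_comp f.2 f'.2)
  ruN_naturality η := Prod.ext (SymMonBicat.ruN_naturality η.1)
    (SymMonBicat.ruN_naturality η.2)
  ruN_id a := isoProd_ext (SymMonBicat.ruN_id a.1)
    (SymMonBicat.ruN_id a.2)
  ruN_comp f f' := isoProd_ext (SymMonBicat.ruN_comp f.1 f'.1)
    (SymMonBicat.ruN_comp f.2 f'.2)
  brN_naturality η θ := Prod.ext (SymMonBicat.brN_naturality η.1 θ.1)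
    (SymMonBicat.brN_naturality η.2 θ.2)
  brN_id a b := isoProd_ext (SymMonBicat.brN_id a.1 b.1)
    (SymMonBicat.brN_id a.2 b.2)
  brN_comp f f' g g' := isoProd_ext (SymMonBicat.brN_comp f.1 f'.1 g.1 g'.1)
    (SymMonBicat.brN_comp f.2 f'.2 g.2 g'.2)
  pent_mod f g h k := isoProd_ext (SymMonBicat.pent_mod f.1 g.1 h.1 k.1)
    (SymMonBicat.pent_mod f.2 g.2 h.2 k.2)
  mid_mod f g := isoProd_ext (SymMonBicat.mid_mod f.1 g.1)
    (SymMonBicat.mid_mod f.2 g.2)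
  lun_mod f g := isoProd_ext (SymMonBicat.lun_mod f.1 g.1)
    (SymMonBicat.lun_mod f.2 g.2)
  run_mod f g := isoProd_ext (SymMonBicat.run_mod f.1 g.1)
    (SymMonBicat.run_mod f.2 g.2)
  hexR_mod f g h := isoProd_ext (SymMonBicat.hexR_mod f.1 g.1 h.1)
    (SymMonBicat.hexR_mod f.2 g.2 h.2)
  hexS_mod f g h := isoProd_ext (SymMonBicat.hexS_mod f.1 g.1 h.1)
    (SymMonBicat.hexS_mod f.2 g.2 h.2)
  syl_mod f g := isoProd_ext (SymMonBicat.syl_mod f.1 g.1)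
    (SymMonBicat.syl_mod f.2 g.2)
  pent_cocycle a b c d e := isoProd_ext (SymMonBicat.pent_cocycle a.1 b.1 c.1 d.1 e.1)
    (SymMonBicat.pent_cocycle a.2 b.2 c.2 d.2 e.2)
  pent_left a b c := isoProd_ext (SymMonBicat.pent_left a.1 b.1 c.1)
    (SymMonBicat.pent_left a.2 b.2 c.2)
  pent_right a b c := isoProd_ext (SymMonBicat.pent_right a.1 b.1 c.1)
    (SymMonBicat.pent_right a.2 b.2 c.2)
  braid_one_three a b c d := isoProd_ext (SymMonBicat.braid_one_three a.1 b.1 c.1 d.1)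
    (SymMonBicat.braid_one_three a.2 b.2 c.2 d.2)
  braid_three_one a b c d := isoProd_ext (SymMonBicat.braid_three_one a.1 b.1 c.1 d.1)
    (SymMonBicat.braid_three_one a.2 b.2 c.2 d.2)
  braid_two_two a b c d := isoProd_ext (SymMonBicat.braid_two_two a.1 b.1 c.1 d.1)
    (SymMonBicat.braid_two_two a.2 b.2 c.2 d.2)
  yang_baxter a b c := isoProd_ext (SymMonBicat.yang_baxter a.1 b.1 c.1)
    (SymMonBicat.yang_baxter a.2 b.2 c.2)
  syl_left a b c := isoProd_ext (SymMonBicat.syl_left a.1 b.1 c.1)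
    (SymMonBicat.syl_left a.2 b.2 c.2)
  syl_right a b c := isoProd_ext (SymMonBicat.syl_right a.1 b.1 c.1)
    (SymMonBicat.syl_right a.2 b.2 c.2)
  syl_symm a b := isoProd_ext (SymMonBicat.syl_symm a.1 b.1)
    (SymMonBicat.syl_symm a.2 b.2)

end Product

section ProductMap

variable {M : Type u} [Bicategory.{w, v} M] {N : Type u} [Bicategory.{w, v} N]
  {M' : Type u₁} [Bicategory.{w₁, v₁} M'] {N' : Type u₁} [Bicategory.{w₁, v₁} N']

/-- The product of two pseudofunctors. -/
def prodMap (F : M ⥤ᵖ M') (G : N ⥤ᵖ N') : (M × N) ⥤ᵖ (M' × N') where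
  obj p := (F.obj p.1, G.obj p.2)
  map f := Prod.mkHom (F.map f.1) (G.map f.2)
  map₂ η := Prod.mkHom (F.map₂ η.1) (G.map₂ η.2)
  map₂_id f := Prod.ext (F.map₂_id f.1) (G.map₂_id f.2)
  map₂_comp η θ := Prod.ext (F.map₂_comp η.1 θ.1) (G.map₂_comp η.2 θ.2)
  mapId p := Iso.prod (F.mapId p.1) (G.mapId p.2)
  mapComp f g := Iso.prod (F.mapComp f.1 g.1) (G.mapComp f.2 g.2)
  map₂_whisker_left f _ _ η :=
    Prod.ext (F.map₂_whisker_left f.1 η.1) (G.map₂_whisker_left f.2 η.2)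
  map₂_whisker_right η h :=
    Prod.ext (F.map₂_whisker_right η.1 h.1) (G.map₂_whisker_right η.2 h.2)
  map₂_associator f g h :=
    Prod.ext (F.map₂_associator f.1 g.1 h.1) (G.map₂_associator f.2 g.2 h.2)
  map₂_left_unitor f := Prod.ext (F.map₂_left_unitor f.1) (G.map₂_left_unitor f.2)
  map₂_right_unitor f := Prod.ext (F.map₂_right_unitor f.1) (G.map₂_right_unitor f.2)

end ProductMap

/-! ### Functoriality in the complex -/

section Complexes

variable {S S' : ShortComplex Ab.{u}}

lemma map_g (f : S ⟶ S') (c : S.X₂) : f.τ₃.hom (S.g.hom c) = S'.g.hom (f.τ₂.hom c) :=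
  (ConcreteCategory.congr_hom f.comm₂₃ c).symm

lemma map_f (f : S ⟶ S') (e : S.X₁) : f.τ₂.hom (S.f.hom e) = S'.f.hom (f.τ₁.hom e) :=
  (ConcreteCategory.congr_hom f.comm₁₂ e).symm

/-- The strict pseudofunctor induced by a cochain map. -/
def CochainBicat.map (f : S ⟶ S') : CochainBicat S ⥤ᵖ CochainBicat S' where
  obj x := ⟨f.τ₃.hom x.val⟩
  map h := mk₁ (f.τ₂.hom (v₁ h)) (by rw [v₁_prop h, map_add, map_g])
  map₂ η := mk₂ (f.τ₁.hom (v₂ η)) (by rw [mk₁_val, mk₁_val, v₂_prop η, map_add, map_f])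
  map₂_id _ := hom₂_ext (by simp)
  map₂_comp _ _ := hom₂_ext (by simp)
  mapId _ := eqIso (by simp)
  mapComp _ _ := eqIso (by simp)
  map₂_whisker_left _ _ _ _ := hom₂_ext (sandwich _).symm
  map₂_whisker_right _ _ := hom₂_ext (sandwich _).symm
  map₂_associator _ _ _ := hom₂_ext (by
    change f.τ₁.hom 0 = 0 + (0 + (0 + (0 + 0))); simp)
  map₂_left_unitor _ := hom₂_ext (by change f.τ₁.hom 0 = 0 + (0 + 0); simp)
  map₂_right_unitor _ := hom₂_ext (by change f.τ₁.hom 0 = 0 + (0 + 0); simp)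

/-! ### Cohomology and the split bicategory -/

/-- `H¹ = ker (C¹ ⟶ C²)`. -/
abbrev H1 (S : ShortComplex Ab.{u}) : Type u := S.f.hom.ker

/-- `H² = ker (C² ⟶ C³) / im (C¹ ⟶ C²)`. -/
abbrev H2 (S : ShortComplex Ab.{u}) : Type u := S.g.hom.ker ⧸ S.abToCycles.range

/-- `H³ = C³ / im (C² ⟶ C³)`. -/
abbrev H3 (S : ShortComplex Ab.{u}) : Type u := S.X₃ ⧸ S.g.hom.range

def H1map (f : S ⟶ S') : H1 S →+ H1 S' :=
  (f.τ₁.hom.comp S.f.hom.ker.subtype).codRestrict _ fun e => by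
    change S'.f.hom (f.τ₁.hom e.1) = 0
    rw [← map_f, show S.f.hom e.1 = 0 from e.2, map_zero]

/-- The map induced on the kernels of `C² ⟶ C³`. -/
def cyclesMap (f : S ⟶ S') : S.g.hom.ker →+ S'.g.hom.ker :=
  (f.τ₂.hom.comp S.g.hom.ker.subtype).codRestrict _ fun c => by
    change S'.g.hom (f.τ₂.hom c.1) = 0
    rw [← map_g, show S.g.hom c.1 = 0 from c.2, map_zero]

def H2map (f : S ⟶ S') : H2 S →+ H2 S' :=
  QuotientAddGroup.map _ _ (cyclesMap f) (by
    rintro _ ⟨e, rfl⟩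
    exact ⟨f.τ₁.hom e, Subtype.ext (map_f f e).symm⟩)

def H3map (f : S ⟶ S') : H3 S →+ H3 S' :=
  QuotientAddGroup.map _ _ f.τ₃.hom (by
    rintro _ ⟨c, rfl⟩
    exact ⟨f.τ₂.hom c, (map_g f c).symm⟩)

/-- The complex with the group `A` in degree 3 and zero elsewhere. -/
abbrev conc3 (A : Type u) [AddCommGroup A] : ShortComplex Ab.{u} :=
  ShortComplex.mk (X₁ := .of PUnit) (X₂ := .of PUnit) (X₃ := .of A) 0 0 rfl

/-- The complex with the group `A` in degree 2 and zero elsewhere. -/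
abbrev conc2 (A : Type u) [AddCommGroup A] : ShortComplex Ab.{u} :=
  ShortComplex.mk (X₁ := .of PUnit) (X₂ := .of A) (X₃ := .of PUnit) 0 0 rfl

/-- The complex with the group `A` in degree 1 and zero elsewhere. -/
abbrev conc1 (A : Type u) [AddCommGroup A] : ShortComplex Ab.{u} :=
  ShortComplex.mk (X₁ := .of A) (X₂ := .of PUnit) (X₃ := .of PUnit) 0 0 rfl

variable {A A' : Type u} [AddCommGroup A] [AddCommGroup A']

def conc3Map (φ : A →+ A') : conc3 A ⟶ conc3 A' where
  τ₁ := 0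
  τ₂ := 0
  τ₃ := AddCommGrpCat.ofHom φ

def conc2Map (φ : A →+ A') : conc2 A ⟶ conc2 A' where
  τ₁ := 0
  τ₂ := AddCommGrpCat.ofHom φ
  τ₃ := 0

def conc1Map (φ : A →+ A') : conc1 A ⟶ conc1 A' where
  τ₁ := AddCommGrpCat.ofHom φ
  τ₂ := 0
  τ₃ := 0

/-- The discrete symmetric monoidal bicategory on an abelian group `A`. -/
abbrev Disc (A : Type u) [AddCommGroup A] : Type u := CochainBicat (conc3 A)

/-- `A[1]`: one object, with `A` as the group of its 1-endomorphisms and only identity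
2-morphisms. -/
abbrev Shift1 (A : Type u) [AddCommGroup A] : Type u := CochainBicat (conc2 A)

/-- `A[2]`: one object and one 1-morphism, with `A` as the group of its 2-endomorphisms. -/
abbrev Shift2 (A : Type u) [AddCommGroup A] : Type u := CochainBicat (conc1 A)

/-- The product `H³ × H²[1] × H¹[2]`. -/
abbrev Split (S : ShortComplex Ab.{u}) : Type u := Disc (H3 S) × Shift1 (H2 S) × Shift2 (H1 S)

/-- The pseudofunctor `H³ × H²[1] × H¹[2] ⟶ H'³ × H'²[1] × H'¹[2]` induced by a cochain map. -/
def Split.map (f : S ⟶ S') : Split S ⥤ᵖ Split S' :=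
  prodMap (CochainBicat.map (conc3Map (H3map f)))
    (prodMap (CochainBicat.map (conc2Map (H2map f))) (CochainBicat.map (conc1Map (H1map f))))

end Complexes

/-! ### The monoid of equivalence classes of objects -/

section Pi0

variable {B : Type u} [Bicategory.{w, v} B]

noncomputable def equivSymm {a b : B} (e : a ≌ b) : b ≌ a :=
  Bicategory.Equivalence.mkOfAdjointifyCounit e.counit.symm e.unit.symm

noncomputable def equivTrans {a b c : B} (e : a ≌ b) (e' : b ≌ c) : a ≌ c :=
  Bicategory.Equivalence.mkOfAdjointifyCounit (f := e.hom ≫ e'.hom) (g := e'.inv ≫ e.inv)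
    (e.unit ≪⊗≫ e.hom ◁ᵢ (e'.unit ▷ᵢ e.inv) ≪⊗≫ Iso.refl ((e.hom ≫ e'.hom) ≫ e'.inv ≫ e.inv))
    (Iso.refl ((e'.inv ≫ e.inv) ≫ e.hom ≫ e'.hom) ≪⊗≫ e'.inv ◁ᵢ (e.counit ▷ᵢ e'.hom) ≪⊗≫
      e'.counit)

noncomputable def equivMap {C : Type u₁} [Bicategory.{w₁, v₁} C] (F : B ⥤ᵖ C) {a b : B}
    (e : a ≌ b) : F.obj a ≌ F.obj b :=
  Bicategory.Equivalence.mkOfAdjointifyCounit (f := F.map e.hom) (g := F.map e.inv)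
    ((F.mapId a).symm ≪≫ F.map₂Iso e.unit ≪≫ F.mapComp _ _)
    ((F.mapComp _ _).symm ≪≫ F.map₂Iso e.counit ≪≫ F.mapId b)

variable (B) in
/-- Equivalence of objects. -/
def equivSetoid : Setoid B where
  r a b := Nonempty (a ≌ b)
  iseqv :=
    { refl := fun a => ⟨Bicategory.Equivalence.id a⟩
      symm := fun ⟨e⟩ => ⟨equivSymm e⟩
      trans := fun ⟨e⟩ ⟨e'⟩ => ⟨equivTrans e e'⟩ }

variable (B) in
/-- `π₀`: the equivalence classes of objects. -/
def Pi0 : Type u := Quotient (equivSetoid B)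

/-- The map induced on `π₀` by a pseudofunctor. -/
def Pi0.map {C : Type u₁} [Bicategory.{w₁, v₁} C] (F : B ⥤ᵖ C) : Pi0 B → Pi0 C :=
  Quotient.map' F.obj fun _ _ ⟨e⟩ => ⟨equivMap F e⟩

noncomputable def equivTensor [TensorBicat B] {a a' b b' : B} (e : a ≌ a') (e' : b ≌ b') :
    a ⊠ b ≌ a' ⊠ b' :=
  equivMap TensorBicat.tensor (prodEquiv e e')

/-- The addition on `π₀` is induced by the tensor product. -/
instance [TensorBicat B] : Add (Pi0 B) where
  add := Quotient.map₂ tensorObj fun _ _ ⟨e⟩ _ _ ⟨e'⟩ => ⟨equivTensor e e'⟩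

instance [TensorBicat B] : Zero (Pi0 B) where
  zero := Quotient.mk _ (one B)

instance [SymMonBicatData B] : AddCommMonoid (Pi0 B) where
  add_assoc := by
    rintro ⟨a⟩ ⟨b⟩ ⟨c⟩
    exact Quotient.sound ⟨asc a b c⟩
  zero_add := by
    rintro ⟨a⟩
    exact Quotient.sound ⟨lu a⟩
  add_zero := by
    rintro ⟨a⟩
    exact Quotient.sound ⟨ru a⟩
  add_comm := by
    rintro ⟨a⟩ ⟨b⟩
    exact Quotient.sound ⟨br a b⟩
  nsmul := nsmulRec

end Pi0

end SymBicat

/-!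
Weigh the cells of a symmetric monoidal bicategory by cochains of a complex `T` so that all
operations become addition and all structure cells have weight zero. If two bicategories are
weighted by the same `T`, and the weighting of the second is an equivalence, then choosing cells of
prescribed weight up to coboundaries transports the first to the second; the chosen cochains
determine the weight of every structure cell, and every coherence axiom becomes an identity in
`T.X₁` in which they cancel. Both `D(C)` and `Split(C)` have such a weighting in one complex:
embedding `H¹` and `H²` into divisible groups, which are injective, resolves the cohomology of `C`
by a complex that receives a quasi-isomorphism from `C` and from the cohomology.

Naturality fails for the identity of `C¹ = ℤ` as a cochain map from multiplication by two, `ℤ ⟶ ℤ`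
in degrees 1 and 2, to `ℤ` in degree 1. It is zero on cohomology, so naturality would give
2-morphisms `c ⟶ c'` the image `ν c - ν c'`, where `ν` is the weight of the naturality constraints
and is additive in `c` up to a constant. Since `1 ∈ C¹` is a 2-morphism `0 + 0 ⟶ 1 + 1`, its image
is even, but that image is a generator.
-/

namespace SymBicat

open SymMonBicatData

universe t

/-! ### Weightings -/

/-- A weighting of a symmetric monoidal bicategory in a complex `T` assigns to objects,
1-morphisms and 2-morphisms elements of `T.X₃`, `T.X₂` and `T.X₁` such that all compositions and
the tensor product become addition and all structure cells have weight zero. This is a strict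
symmetric monoidal pseudofunctor to `CochainBicat T`, spelled out in elements. -/
structure Weighting (B : Type u) [Bicategory.{w, v} B] [SymMonBicatData B]
    (T : ShortComplex Ab.{t}) where
  w₀ : B → T.X₃
  w₁ {x y : B} : (x ⟶ y) → T.X₂
  w₂ {x y : B} {f g : x ⟶ y} : (f ⟶ g) → T.X₁
  w₀_target {x y : B} (f : x ⟶ y) : w₀ y = w₀ x + T.g.hom (w₁ f)
  w₁_target {x y : B} {f g : x ⟶ y} (η : f ⟶ g) : w₁ g = w₁ f + T.f.hom (w₂ η)
  w₁_id (x : B) : w₁ (𝟙 x) = 0 := by intros; first | rfl | simp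
  w₁_comp {x y z : B} (f : x ⟶ y) (g : y ⟶ z) : w₁ (f ≫ g) = w₁ f + w₁ g := by
    intros; first | rfl | simp
  w₂_id {x y : B} (f : x ⟶ y) : w₂ (𝟙 f) = 0 := by intros; first | rfl | simp
  w₂_comp {x y : B} {f g h : x ⟶ y} (η : f ⟶ g) (θ : g ⟶ h) : w₂ (η ≫ θ) = w₂ η + w₂ θ := by
    intros; first | rfl | simp
  w₂_whiskerLeft {x y z : B} (f : x ⟶ y) {g h : y ⟶ z} (η : g ⟶ h) : w₂ (f ◁ η) = w₂ η := by
    intros; first | rfl | simp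
  w₂_whiskerRight {x y z : B} {f g : x ⟶ y} (η : f ⟶ g) (h : y ⟶ z) : w₂ (η ▷ h) = w₂ η := by
    intros; first | rfl | simp
  w₂_associator {x y z t : B} (f : x ⟶ y) (g : y ⟶ z) (h : z ⟶ t) : w₂ (α_ f g h).hom = 0 := by
    intros; first | rfl | simp
  w₂_leftUnitor {x y : B} (f : x ⟶ y) : w₂ (λ_ f).hom = 0 := by intros; first | rfl | simp
  w₂_rightUnitor {x y : B} (f : x ⟶ y) : w₂ (ρ_ f).hom = 0 := by intros; first | rfl | simp
  w₀_tensor (x y : B) : w₀ (x ⊠ y) = w₀ x + w₀ y := by intros; first | rfl | simp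
  w₀_one : w₀ (one B) = 0 := by intros; first | rfl | simp
  w₁_tensor {x x' y y' : B} (f : x ⟶ x') (g : y ⟶ y') : w₁ (f ⊠₁ g) = w₁ f + w₁ g := by
    intros; first | rfl | simp
  w₂_tensor {x x' y y' : B} {f f' : x ⟶ x'} {g g' : y ⟶ y'} (η : f ⟶ f') (θ : g ⟶ g') :
    w₂ (tensorHom₂ η θ) = w₂ η + w₂ θ := by intros; first | rfl | simp
  w₂_tensorId (x y : B) : w₂ (tensorId x y).hom = 0 := by intros; first | rfl | simp
  w₂_tensorComp {x x' x'' y y' y'' : B} (f : x ⟶ x') (f' : x' ⟶ x'') (g : y ⟶ y')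
    (g' : y' ⟶ y'') : w₂ (tensorComp f f' g g').hom = 0 := by intros; first | rfl | simp
  w₁_asc (a b c : B) : w₁ (asc a b c).hom = 0 := by intros; first | rfl | simp
  w₁_asc_inv (a b c : B) : w₁ (asc a b c).inv = 0 := by intros; first | rfl | simp
  w₂_asc_unit (a b c : B) : w₂ (asc a b c).unit.hom = 0 := by intros; first | rfl | simp
  w₂_asc_counit (a b c : B) : w₂ (asc a b c).counit.hom = 0 := by intros; first | rfl | simp
  w₁_lu (a : B) : w₁ (lu a).hom = 0 := by intros; first | rfl | simp
  w₁_ru (a : B) : w₁ (ru a).hom = 0 := by intros; first | rfl | simp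
  w₁_br (a b : B) : w₁ (br a b).hom = 0 := by intros; first | rfl | simp
  w₂_ascN {a a' b b' c c' : B} (f : a ⟶ a') (g : b ⟶ b') (h : c ⟶ c') :
    w₂ (ascN f g h).hom = 0 := by intros; first | rfl | simp
  w₂_luN {a a' : B} (f : a ⟶ a') : w₂ (luN f).hom = 0 := by intros; first | rfl | simp
  w₂_ruN {a a' : B} (f : a ⟶ a') : w₂ (ruN f).hom = 0 := by intros; first | rfl | simp
  w₂_brN {a a' b b' : B} (f : a ⟶ a') (g : b ⟶ b') : w₂ (brN f g).hom = 0 := by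
    intros; first | rfl | simp
  w₂_pent (a b c d : B) : w₂ (pent a b c d).hom = 0 := by intros; first | rfl | simp
  w₂_mid (a b : B) : w₂ (mid a b).hom = 0 := by intros; first | rfl | simp
  w₂_hexR (a b c : B) : w₂ (hexR a b c).hom = 0 := by intros; first | rfl | simp
  w₂_hexS (a b c : B) : w₂ (hexS a b c).hom = 0 := by intros; first | rfl | simp
  w₂_syl (a b : B) : w₂ (syl a b).hom = 0 := by intros; first | rfl | simp

/-- A weighting is an equivalence if it is bijective on 2-morphisms between given parallel
1-morphisms, and surjective up to coboundaries on 1-morphisms between given objects and on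
objects. -/
class Weighting.IsEquivalence {B : Type u} [Bicategory.{w, v} B] [SymMonBicatData B]
    {T : ShortComplex Ab.{t}} (R : Weighting B T) : Prop where
  faithful {x y : B} {f g : x ⟶ y} {η θ : f ⟶ g} : R.w₂ η = R.w₂ θ → η = θ
  full₂ {x y : B} (f g : x ⟶ y) (q : T.X₁) :
    R.w₁ g = R.w₁ f + T.f.hom q → ∃ η : f ⟶ g, R.w₂ η = q
  full₁ (x y : B) (q : T.X₂) :
    R.w₀ y = R.w₀ x + T.g.hom q → ∃ (f : x ⟶ y) (p : T.X₁), R.w₁ f = q + T.f.hom p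
  surj₀ (q : T.X₃) : ∃ (x : B) (p : T.X₂), R.w₀ x = q + T.g.hom p

/-- The complex `A₁ ⟶ A₂ ⟶ A₃` with zero differentials. -/
abbrev zeroDifferential (A₁ A₂ A₃ : Type u) [AddCommGroup A₁] [AddCommGroup A₂]
    [AddCommGroup A₃] : ShortComplex Ab.{u} :=
  ShortComplex.mk (X₁ := .of A₁) (X₂ := .of A₂) (X₃ := .of A₃) 0 0 (by simp)

/-- A cochain map is a quasi-isomorphism if its mapping cone is acyclic; the four fields are the
exactness of the cone at its four terms. -/
structure IsQuasiIso {S T : ShortComplex Ab.{t}} (φ : S ⟶ T) : Prop where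
  eq_zero_of_map_eq_zero {e : S.X₁} : S.f.hom e = 0 → φ.τ₁.hom e = 0 → e = 0
  exists_lift₁ {c : S.X₂} {q : T.X₁} : S.g.hom c = 0 → φ.τ₂.hom c = T.f.hom q →
    ∃ e, S.f.hom e = c ∧ φ.τ₁.hom e = q
  exists_lift₂ {x : S.X₃} {q : T.X₂} : φ.τ₃.hom x = T.g.hom q →
    ∃ c p, S.g.hom c = x ∧ φ.τ₂.hom c = q + T.f.hom p
  exists_lift₃ (q : T.X₃) : ∃ x p, φ.τ₃.hom x = q + T.g.hom p

namespace Weighting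

attribute [simp] w₁_id w₁_comp w₂_id w₂_comp w₂_whiskerLeft w₂_whiskerRight w₂_associator
  w₂_leftUnitor w₂_rightUnitor w₀_tensor w₀_one w₁_tensor w₂_tensor w₂_tensorId w₂_tensorComp
  w₁_asc w₁_asc_inv w₂_asc_unit w₂_asc_counit w₁_lu w₁_ru w₁_br w₂_ascN w₂_luN w₂_ruN w₂_brN
  w₂_pent w₂_mid w₂_hexR w₂_hexS w₂_syl

section Constructions

open CochainBicat

/-- The tautological weighting of the bicategory of a complex. -/
def self (S : ShortComplex Ab.{u}) : Weighting (CochainBicat S) S where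
  w₀ x := x.val
  w₁ := v₁
  w₂ := v₂
  w₀_target := v₁_prop
  w₁_target := v₂_prop

instance self_isEquivalence (S : ShortComplex Ab.{u}) : (self S).IsEquivalence where
  faithful := hom₂_ext
  full₂ _ _ q h := ⟨mk₂ q h, rfl⟩
  full₁ _ _ q h := ⟨mk₁ q h, 0, by rw [map_zero, add_zero]; rfl⟩
  surj₀ q := ⟨⟨q⟩, 0, by rw [map_zero, add_zero]; rfl⟩

variable (A₁ A₂ A₃ : Type u) [AddCommGroup A₁] [AddCommGroup A₂] [AddCommGroup A₃]

/-- The weighting of `A₃ × A₂[1] × A₁[2]` by the components that carry information. -/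
def split : Weighting (Disc A₃ × Shift1 A₂ × Shift2 A₁) (zeroDifferential A₁ A₂ A₃) where
  w₀ x := x.1.val
  w₁ f := v₁ (S := conc2 A₂) f.2.1
  w₂ η := v₂ (S := conc1 A₁) η.2.2
  w₀_target f := v₁_prop f.1
  w₁_target η := v₂_prop η.2.1

instance split_isEquivalence : (split A₁ A₂ A₃).IsEquivalence where
  faithful h := Prod.ext (hom₂_ext (Subsingleton.elim (α := PUnit) _ _))
    (Prod.ext (hom₂_ext (Subsingleton.elim (α := PUnit) _ _)) (hom₂_ext h))
  full₂ _ _ q h := ⟨Prod.mkHom (mk₂ 0 (Subsingleton.elim (α := PUnit) _ _))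
    (Prod.mkHom (mk₂ 0 h) (mk₂ q (Subsingleton.elim (α := PUnit) _ _))), rfl⟩
  full₁ _ _ q h := ⟨Prod.mkHom (mk₁ 0 h)
    (Prod.mkHom (mk₁ q (Subsingleton.elim (α := PUnit) _ _))
      (mk₁ 0 (Subsingleton.elim (α := PUnit) _ _))), 0, (add_zero _).symm⟩
  surj₀ q := ⟨(⟨q⟩, ⟨0⟩, ⟨0⟩), 0, (add_zero _).symm⟩

end Constructions

variable {B : Type u} [Bicategory.{w, v} B] [SymMonBicatData B] {S T : ShortComplex Ab.{t}}

/-- The image of a weighting under a cochain map. -/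
def map (R : Weighting B S) (φ : S ⟶ T) : Weighting B T where
  w₀ x := φ.τ₃.hom (R.w₀ x)
  w₁ f := φ.τ₂.hom (R.w₁ f)
  w₂ η := φ.τ₁.hom (R.w₂ η)
  w₀_target f := by rw [R.w₀_target f, map_add, map_g]
  w₁_target η := by rw [R.w₁_target η, map_add, map_f]

lemma isEquivalence_map (R : Weighting B S) [R.IsEquivalence] {φ : S ⟶ T} (hφ : IsQuasiIso φ) :
    (R.map φ).IsEquivalence where
  faithful {_ _ f g η θ} h := by
    refine IsEquivalence.faithful (R := R) (sub_eq_zero.1 (hφ.eq_zero_of_map_eq_zero ?_ ?_))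
    · rw [map_sub, sub_eq_zero]
      exact add_left_cancel ((R.w₁_target η).symm.trans (R.w₁_target θ))
    · rw [map_sub, sub_eq_zero]
      exact h
  full₂ f g q h := by
    have closed : S.g.hom (R.w₁ g - R.w₁ f) = 0 := by
      rw [map_sub, sub_eq_zero]
      exact add_left_cancel ((R.w₀_target g).symm.trans (R.w₀_target f))
    obtain ⟨e, he, rfl⟩ := hφ.exists_lift₁ closed
      (by rw [map_sub]; exact sub_eq_iff_eq_add'.2 h)
    obtain ⟨η, rfl⟩ := IsEquivalence.full₂ (R := R) f g e (by rw [he, add_sub_cancel])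
    exact ⟨η, rfl⟩
  full₁ x y q h := by
    obtain ⟨c, p, hc, hp⟩ := hφ.exists_lift₂ (x := R.w₀ y - R.w₀ x) (q := q)
      (by rw [map_sub]; exact sub_eq_iff_eq_add'.2 h)
    obtain ⟨f, p', hf⟩ := IsEquivalence.full₁ (R := R) x y c (by rw [hc, add_sub_cancel])
    refine ⟨f, p + φ.τ₁.hom p', ?_⟩
    change φ.τ₂.hom (R.w₁ f) = _
    rw [hf, map_add, hp, map_f, map_add, add_assoc]
  surj₀ q := by
    obtain ⟨a, p, hp⟩ := hφ.exists_lift₃ q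
    obtain ⟨x, p', hx⟩ := IsEquivalence.surj₀ (R := R) a
    refine ⟨x, p + φ.τ₂.hom p', ?_⟩
    change φ.τ₃.hom (R.w₀ x) = _
    rw [hx, map_add, hp, map_g, map_add, add_assoc]

section Cells

variable (R : Weighting B T)

@[simp] lemma w₂_inv {x y : B} {f g : x ⟶ y} (η : f ≅ g) : R.w₂ η.inv = -R.w₂ η.hom :=
  eq_neg_of_add_eq_zero_right (by rw [← w₂_comp, η.hom_inv_id, w₂_id])

@[simp] lemma w₂_bicategoricalIsoComp {x y : B} {f g h i : x ⟶ y} [BicategoricalCoherence g h]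
    (η : f ≅ g) (θ : h ≅ i) :
    R.w₂ (η ≪⊗≫ θ).hom = R.w₂ η.hom + (R.w₂ (⊗𝟙 : g ≅ h).hom + R.w₂ θ.hom) := by
  simp [bicategoricalIsoComp]

@[simp] lemma w₂_tensorIso {x x' y y' : B} {f f' : x ⟶ x'} {g g' : y ⟶ y'} (η : f ≅ f')
    (θ : g ≅ g') : R.w₂ (η ⊠₂ θ).hom = R.w₂ η.hom + R.w₂ θ.hom :=
  R.w₂_tensor η.hom θ.hom

@[simp] lemma w₂_sqV {a a' b b' c c' : B} {f : a ⟶ a'} {t : a ⟶ b} {t' : a' ⟶ b'} {g : b ⟶ b'}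
    {s : b ⟶ c} {s' : b' ⟶ c'} {h : c ⟶ c'} (p : f ≫ t' ≅ t ≫ g) (q : g ≫ s' ≅ s ≫ h) :
    R.w₂ (sqV p q).hom = R.w₂ p.hom + R.w₂ q.hom := by
  simp [sqV]

@[simp] lemma w₂_sqH {a a' a'' b b' b'' : B} {f : a ⟶ a'} {f₂ : a' ⟶ a''} {t : a ⟶ b}
    {t' : a' ⟶ b'} {t'' : a'' ⟶ b''} {g : b ⟶ b'} {g₂ : b' ⟶ b''} (p : f ≫ t' ≅ t ≫ g)
    (q : f₂ ≫ t'' ≅ t' ≫ g₂) : R.w₂ (sqH p q).hom = R.w₂ q.hom + R.w₂ p.hom := by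
  simp [sqH]

@[simp] lemma w₂_sqId {a a' : B} (f : a ⟶ a') : R.w₂ (sqId f).hom = 0 := by
  simp [sqId]

@[simp] lemma w₂_sqOne {a a' : B} (f : a ⟶ a') : R.w₂ (sqOne f).hom = 0 := by
  simp [sqOne]

@[simp] lemma w₂_sqT {a a' b b' : B} {f : a ⟶ a'} {t : a ⟶ b} {t' : a' ⟶ b'} {g : b ⟶ b'}
    {c c' d d' : B} {h : c ⟶ c'} {s : c ⟶ d} {s' : c' ⟶ d'} {k : d ⟶ d'}
    (p : f ≫ t' ≅ t ≫ g) (q : h ≫ s' ≅ s ≫ k) :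
    R.w₂ (sqT p q).hom = R.w₂ p.hom + R.w₂ q.hom := by
  simp [sqT]

@[simp] lemma w₂_sqR {a a' b b' : B} {f : a ⟶ a'} {t : a ⟶ b} {t' : a' ⟶ b'} {g : b ⟶ b'}
    (p : f ≫ t' ≅ t ≫ g) {x x' : B} (k : x ⟶ x') : R.w₂ (sqR p k).hom = R.w₂ p.hom := by
  simp [sqR]

@[simp] lemma w₂_sqL {x x' : B} (k : x ⟶ x') {a a' b b' : B} {f : a ⟶ a'} {t : a ⟶ b}
    {t' : a' ⟶ b'} {g : b ⟶ b'} (p : f ≫ t' ≅ t ≫ g) :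
    R.w₂ (sqL k p).hom = R.w₂ p.hom := by
  simp [sqL]

@[simp] lemma w₂_isoR {a a' : B} {f f' : a ⟶ a'} (η : f ≅ f') (c : B) :
    R.w₂ (isoR η c).hom = R.w₂ η.hom := by
  simp [isoR]

@[simp] lemma w₂_isoL (c : B) {a a' : B} {f f' : a ⟶ a'} (η : f ≅ f') :
    R.w₂ (isoL c η).hom = R.w₂ η.hom := by
  simp [isoL]

@[simp] lemma w₂_compR {a b c : B} (f : a ⟶ b) (g : b ⟶ c) (x : B) :
    R.w₂ (compR f g x).hom = 0 := by
  simp [compR]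

@[simp] lemma w₂_compL (x : B) {a b c : B} (f : a ⟶ b) (g : b ⟶ c) :
    R.w₂ (compL x f g).hom = 0 := by
  simp [compL]

@[simp] lemma w₂_compR3 {a b c d : B} (f : a ⟶ b) (g : b ⟶ c) (h : c ⟶ d) (x : B) :
    R.w₂ (compR3 f g h x).hom = 0 := by
  simp [compR3]

@[simp] lemma w₂_compL3 (x : B) {a b c d : B} (f : a ⟶ b) (g : b ⟶ c) (h : c ⟶ d) :
    R.w₂ (compL3 x f g h).hom = 0 := by
  simp [compL3]

@[simp] lemma w₂_exch {a a' b b' : B} (f : a ⟶ a') (g : b ⟶ b') : R.w₂ (exch f g).hom = 0 := by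
  simp [exch]

@[simp] lemma w₂_asA {a a' : B} (f : a ⟶ a') (b c : B) : R.w₂ (asA f b c).hom = 0 := by
  simp [asA]

@[simp] lemma w₂_asB (a : B) {b b' : B} (f : b ⟶ b') (c : B) : R.w₂ (asB a f c).hom = 0 := by
  simp [asB]

@[simp] lemma w₂_asC (a b : B) {c c' : B} (f : c ⟶ c') : R.w₂ (asC a b f).hom = 0 := by
  simp [asC]

@[simp] lemma w₂_btA {a a' : B} (f : a ⟶ a') (b : B) : R.w₂ (btA f b).hom = 0 := by
  simp [btA]

@[simp] lemma w₂_btB (a : B) {b b' : B} (f : b ⟶ b') : R.w₂ (btB a f).hom = 0 := by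
  simp [btB]

end Cells

section Equivalences

variable (R : Weighting B T) [R.IsEquivalence]

lemma hom_ext {x y : B} {f g : x ⟶ y} {η θ : f ⟶ g} (h : R.w₂ η = R.w₂ θ) : η = θ :=
  IsEquivalence.faithful h

lemma iso_ext {x y : B} {f g : x ⟶ y} {η θ : f ≅ g} (h : R.w₂ η.hom = R.w₂ θ.hom) : η = θ :=
  Iso.ext (R.hom_ext h)

lemma exists_iso {x y : B} (f g : x ⟶ y) (q : T.X₁) (h : R.w₁ g = R.w₁ f + T.f.hom q) :
    ∃ η : f ≅ g, R.w₂ η.hom = q := by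
  obtain ⟨η, hη⟩ := IsEquivalence.full₂ (R := R) f g q h
  obtain ⟨θ, hθ⟩ := IsEquivalence.full₂ (R := R) g f (-q)
    (by rw [h, map_neg, add_neg_cancel_right])
  exact ⟨⟨η, θ, R.hom_ext (by simp [hη, hθ]), R.hom_ext (by simp [hη, hθ])⟩, hη⟩

/-- The invertible 2-morphism of given weight. -/
noncomputable def iso {x y : B} {f g : x ⟶ y} (q : T.X₁) (h : R.w₁ g = R.w₁ f + T.f.hom q) :
    f ≅ g :=
  (R.exists_iso f g q h).choose

@[simp] lemma w₂_iso {x y : B} {f g : x ⟶ y} (q : T.X₁) (h : R.w₁ g = R.w₁ f + T.f.hom q) :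
    R.w₂ (R.iso q h).hom = q :=
  (R.exists_iso f g q h).choose_spec

lemma isEquiv (R : Weighting B T) [R.IsEquivalence] {x y : B} (f : x ⟶ y) : IsEquiv f := by
  obtain ⟨g, p, hg⟩ := IsEquivalence.full₁ (R := R) y x (-R.w₁ f)
    (by rw [R.w₀_target f, map_neg, add_neg_cancel_right])
  exact ⟨Bicategory.Equivalence.mkOfAdjointifyCounit (f := f) (g := g)
    (R.iso p (by simp [hg])) (R.iso (-p) (by simp [hg])), rfl⟩

/-- A 1-morphism whose weight is `q` up to the coboundary of `R.morDefect q h`. -/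
noncomputable def mor {x y : B} (q : T.X₂) (h : R.w₀ y = R.w₀ x + T.g.hom q) : x ⟶ y :=
  (IsEquivalence.full₁ x y q h).choose

/-- The cochain whose coboundary is the difference between the weight of `R.mor q h` and `q`. -/
noncomputable def morDefect {x y : B} (q : T.X₂) (h : R.w₀ y = R.w₀ x + T.g.hom q) : T.X₁ :=
  (IsEquivalence.full₁ x y q h).choose_spec.choose

lemma w₁_mor {x y : B} (q : T.X₂) (h : R.w₀ y = R.w₀ x + T.g.hom q) :
    R.w₁ (R.mor q h) = q + T.f.hom (R.morDefect q h) :=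
  (IsEquivalence.full₁ x y q h).choose_spec.choose_spec

/-- An object whose weight is `q` up to the coboundary of `R.objDefect q`. -/
noncomputable def obj (q : T.X₃) : B := (IsEquivalence.surj₀ (R := R) q).choose

/-- The cochain whose coboundary is the difference between the weight of `R.obj q` and `q`. -/
noncomputable def objDefect (q : T.X₃) : T.X₂ :=
  (IsEquivalence.surj₀ (R := R) q).choose_spec.choose

lemma w₀_obj (q : T.X₃) : R.w₀ (R.obj q) = q + T.g.hom (R.objDefect q) :=
  (IsEquivalence.surj₀ (R := R) q).choose_spec.choose_spec

end Equivalences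

end Weighting

/-! ### Comparisons of weightings and transport -/

section Comparisons

variable {M : Type u₁} [Bicategory.{w₁, v₁} M] {N : Type u₂} [Bicategory.{w₂, v₂} N]
  {P : Type u₃} [Bicategory.{w₃, v₃} P] {T : ShortComplex Ab.{t}}

/-- A comparison of weightings along the data `F` of a symmetric monoidal pseudofunctor: the weight
of the image of a cell and of every structure cell of `F` differ from the expected ones by the
coboundary of the cochain `q₀`, `q₁`, `qχ`, `qι`. -/
structure Comparison [SymMonBicatData M] [SymMonBicatData N] (R : Weighting M T)
    (R' : Weighting N T) (F : SymMonFunctorData M N) where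
  q₀ (x : M) : T.X₂
  q₁ {x y : M} (f : x ⟶ y) : T.X₁
  qχ (x y : M) : T.X₁
  qι : T.X₁
  w₀_obj (x : M) : R'.w₀ (F.obj x) = R.w₀ x + T.g.hom (q₀ x)
  w₁_map {x y : M} (f : x ⟶ y) : R'.w₁ (F.map f) = R.w₁ f + q₀ y - q₀ x + T.f.hom (q₁ f)
  w₂_map₂ {x y : M} {f g : x ⟶ y} (η : f ⟶ g) : R'.w₂ (F.map₂ η) = R.w₂ η + q₁ g - q₁ f
  w₂_mapId (x : M) : R'.w₂ (F.mapId x).hom = -q₁ (𝟙 x)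
  w₂_mapComp {x y z : M} (f : x ⟶ y) (g : y ⟶ z) :
    R'.w₂ (F.mapComp f g).hom = q₁ f + q₁ g - q₁ (f ≫ g)
  w₁_χ (x y : M) : R'.w₁ (F.χ x y) = q₀ (x ⊠ y) - q₀ x - q₀ y + T.f.hom (qχ x y)
  w₁_ι : R'.w₁ F.ι = q₀ (one M) + T.f.hom qι
  w₂_χN {x x' y y' : M} (f : x ⟶ x') (g : y ⟶ y') :
    R'.w₂ (F.χN f g).hom = qχ x y + q₁ (f ⊠₁ g) - q₁ f - q₁ g - qχ x' y'
  w₂_ω (x y z : M) : R'.w₂ (F.ω x y z).hom =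
    qχ y z + qχ x (y ⊠ z) - qχ x y - qχ (x ⊠ y) z - q₁ (as x y z)
  w₂_γ (x : M) : R'.w₂ (F.γ x).hom = -qι - qχ (one M) x - q₁ (lu x).hom
  w₂_δ (x : M) : R'.w₂ (F.δ x).hom = -qι - qχ x (one M) - q₁ (ru x).hom
  w₂_υ (x y : M) : R'.w₂ (F.υ x y).hom = qχ y x - qχ x y - q₁ (bt x y)

namespace Comparison

section Data

variable [SymMonBicatData M] [SymMonBicatData N] [SymMonBicatData P]
  {R : Weighting M T} {R' : Weighting N T} {R'' : Weighting P T}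

section StructureCells

variable {F : SymMonFunctorData M N} (c : Comparison R R' F)

lemma w₂_fun2 {x y z : M} (f : x ⟶ y) (g : y ⟶ z) :
    R'.w₂ (fun2 F.toPseudofunctor f g).hom = c.q₁ (f ≫ g) - c.q₁ f - c.q₁ g := by
  simp only [fun2, Iso.symm_hom, Weighting.w₂_inv, c.w₂_mapComp]; abel

lemma w₂_fun3 {x y z t : M} (f : x ⟶ y) (g : y ⟶ z) (h : z ⟶ t) :
    R'.w₂ (fun3 F.toPseudofunctor f g h).hom =
      c.q₁ (f ≫ g ≫ h) - c.q₁ f - c.q₁ g - c.q₁ h := by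
  simp [fun3, c.w₂_fun2]; abel

lemma w₂_map₂Iso {x y : M} {f g : x ⟶ y} (η : f ≅ g) :
    R'.w₂ (F.toPseudofunctor.map₂Iso η).hom = R.w₂ η.hom + c.q₁ g - c.q₁ f := by
  simp [c.w₂_map₂]

lemma w₂_sqMap {a a' b b' : M} {f : a ⟶ a'} {t : a ⟶ b} {t' : a' ⟶ b'} {g : b ⟶ b'}
    (p : f ≫ t' ≅ t ≫ g) :
    R'.w₂ (sqMap F.toPseudofunctor p).hom =
      R.w₂ p.hom + c.q₁ t + c.q₁ g - c.q₁ f - c.q₁ t' := by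
  simp [sqMap, c.w₂_map₂, c.w₂_mapComp]; abel

lemma w₂_χA {x x' : M} (f : x ⟶ x') (y : M) :
    R'.w₂ (F.χA f y).hom = c.qχ x y + c.q₁ (f ▹ y) - c.q₁ f - c.qχ x' y := by
  simp [SymMonFunctorData.χA, c.w₂_χN, c.w₂_mapId]; abel

lemma w₂_χB (x : M) {y y' : M} (f : y ⟶ y') :
    R'.w₂ (F.χB x f).hom = c.qχ x y + c.q₁ (x ◂ f) - c.q₁ f - c.qχ x y' := by
  simp [SymMonFunctorData.χB, c.w₂_χN, c.w₂_mapId]; abel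

lemma w₂_ιN : R'.w₂ F.ιN.hom = c.q₁ (𝟙 (one M)) := by
  simp [SymMonFunctorData.ιN, c.w₂_mapId]

lemma w₂_funUnit_asc (x y z : M) :
    R'.w₂ (funUnit F.toPseudofunctor (asc x y z)).hom = - c.q₁ (as x y z) - c.q₁ (ai x y z) := by
  simp only [funUnit, Iso.trans_hom, Iso.symm_hom, Weighting.w₂_comp, Weighting.w₂_inv,
    c.w₂_fun2, c.w₂_map₂Iso, c.w₂_mapId, Weighting.w₂_asc_unit]
  abel

lemma w₂_ωI (x y z : M) :
    R'.w₂ (F.ωI x y z).hom =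
      c.qχ x y + c.qχ (x ⊠ y) z - c.qχ y z - c.qχ x (y ⊠ z) - c.q₁ (ai x y z) := by
  simp [SymMonFunctorData.ωI, c.w₂_ω, c.w₂_funUnit_asc]; abel

end StructureCells

/-- The comparison of the identity is zero. -/
def id (R : Weighting M T) : Comparison R R (SymMonFunctorData.id M) where
  q₀ _ := 0
  q₁ _ := 0
  qχ _ _ := 0
  qι := 0
  w₀_obj x := show R.w₀ x = _ by simp
  w₁_map f := show R.w₁ f = _ by simp
  w₂_map₂ η := show R.w₂ η = _ by simp
  w₂_mapId x := show R.w₂ (𝟙 (𝟙 x)) = _ by simp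
  w₂_mapComp f g := show R.w₂ (𝟙 (f ≫ g)) = _ by simp
  w₁_χ x y := show R.w₁ (𝟙 (x ⊠ y)) = _ by simp
  w₁_ι := show R.w₁ (𝟙 (one M)) = _ by simp
  w₂_χN f g := show R.w₂ (sqId (f ⊠₁ g)).hom = _ by simp
  w₂_ω x y z := show R.w₂ (SymMonFunctorData.idω x y z).hom = _ by simp [SymMonFunctorData.idω]
  w₂_γ x := show R.w₂ (SymMonFunctorData.idγ x).hom = _ by simp [SymMonFunctorData.idγ]
  w₂_δ x := show R.w₂ (SymMonFunctorData.idδ x).hom = _ by simp [SymMonFunctorData.idδ]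
  w₂_υ x y := show R.w₂ (sqOne (bt x y)).hom = _ by simp

/-- The comparison of a composite. -/
def comp {F : SymMonFunctorData M N} {G : SymMonFunctorData N P} (c : Comparison R R' F)
    (c' : Comparison R' R'' G) : Comparison R R'' (F.comp G) where
  q₀ x := c.q₀ x + c'.q₀ (F.obj x)
  q₁ f := c.q₁ f + c'.q₁ (F.map f)
  qχ x y := c.qχ x y + c'.qχ (F.obj x) (F.obj y) + c'.q₁ (F.χ x y)
  qι := c.qι + c'.qι + c'.q₁ F.ι
  w₀_obj x := show R''.w₀ (G.obj (F.obj x)) = _ by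
    simp only [c.w₀_obj, c'.w₀_obj, map_add]; abel
  w₁_map f := show R''.w₁ (G.map (F.map f)) = _ by
    simp only [c.w₁_map, c'.w₁_map, map_add]; abel
  w₂_map₂ η := show R''.w₂ (G.map₂ (F.map₂ η)) = _ by
    simp only [c.w₂_map₂, c'.w₂_map₂]; abel
  w₂_mapId x := show R''.w₂ (G.map₂Iso (F.mapId x) ≪≫ G.mapId (F.obj x)).hom = _ by
    simp only [Iso.trans_hom, Weighting.w₂_comp, c'.w₂_map₂Iso, c.w₂_mapId, c'.w₂_mapId]; abel
  w₂_mapComp f g :=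
    show R''.w₂ (G.map₂Iso (F.mapComp f g) ≪≫ G.mapComp (F.map f) (F.map g)).hom = _ by
    simp only [Iso.trans_hom, Weighting.w₂_comp, c'.w₂_map₂Iso, c.w₂_mapComp, c'.w₂_mapComp]
    abel
  w₁_χ x y := show R''.w₁ (G.χ (F.obj x) (F.obj y) ≫ G.map (F.χ x y)) = _ by
    simp only [Weighting.w₁_comp, c.w₁_χ, c'.w₁_χ, c'.w₁_map, map_add]; abel
  w₁_ι := show R''.w₁ (G.ι ≫ G.map F.ι) = _ by
    simp only [Weighting.w₁_comp, c.w₁_ι, c'.w₁_ι, c'.w₁_map, map_add]; abel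
  w₂_χN f g :=
    show R''.w₂ (sqV (G.χN (F.map f) (F.map g)) (sqMap G.toPseudofunctor (F.χN f g))).hom = _ by
    simp only [Weighting.w₂_sqV, c.w₂_χN, c'.w₂_χN, c'.w₂_sqMap]; abel
  w₂_ω x y z := show R''.w₂ (SymMonFunctorData.compω F G x y z).hom = _ by
    simp [SymMonFunctorData.compω, c.w₂_ω, c'.w₂_ω, c'.w₂_χA, c'.w₂_χB, c'.w₂_fun3, c'.w₂_map₂]
    abel
  w₂_γ x := show R''.w₂ (SymMonFunctorData.compγ F G x).hom = _ by
    simp [SymMonFunctorData.compγ, c.w₂_γ, c'.w₂_γ, c'.w₂_χA, c'.w₂_fun3, c'.w₂_map₂]; abel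
  w₂_δ x := show R''.w₂ (SymMonFunctorData.compδ F G x).hom = _ by
    simp [SymMonFunctorData.compδ, c.w₂_δ, c'.w₂_δ, c'.w₂_χB, c'.w₂_fun3, c'.w₂_map₂]; abel
  w₂_υ x y := show R''.w₂ (SymMonFunctorData.compυ F G x y).hom = _ by
    simp [SymMonFunctorData.compυ, c.w₂_υ, c'.w₂_υ, c'.w₂_fun2, c'.w₂_map₂]; abel

end Data

/-- Structure cells that admit a comparison satisfy the axioms of a symmetric monoidal
pseudofunctor: the weights of both sides of each axiom agree. -/
def toSymMonFunctor [SymMonBicat M] [SymMonBicat N] {R : Weighting M T} {R' : Weighting N T}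
    [R'.IsEquivalence] {F : SymMonFunctorData M N} (c : Comparison R R' F) : SymMonFunctor M N where
  toSymMonFunctorData := F
  χ_equiv _ _ := R'.isEquiv _
  ι_equiv := R'.isEquiv _
  χN_naturality _ _ := R'.hom_ext (by simp [c.w₂_map₂, c.w₂_χN]; abel)
  χN_id _ _ := R'.iso_ext (by simp [c.w₂_map₂, c.w₂_χN, c.w₂_mapId]; abel)
  χN_comp _ _ _ _ := R'.iso_ext (by simp [c.w₂_map₂, c.w₂_χN, c.w₂_mapComp]; abel)
  ω_mod _ _ _ := R'.iso_ext (by simp [c.w₂_χN, c.w₂_ω, c.w₂_sqMap]; abel)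
  γ_mod _ := R'.iso_ext (by simp [c.w₂_χN, c.w₂_γ, c.w₂_sqMap, c.w₂_ιN]; abel)
  δ_mod _ := R'.iso_ext (by simp [c.w₂_χN, c.w₂_δ, c.w₂_sqMap, c.w₂_ιN]; abel)
  υ_mod _ _ := R'.iso_ext (by simp [c.w₂_χN, c.w₂_υ, c.w₂_sqMap]; abel)
  pent_coh _ _ _ _ := R'.iso_ext (by
    simp [c.w₂_ω, c.w₂_χA, c.w₂_χB, c.w₂_fun2, c.w₂_fun3, c.w₂_map₂]; abel)
  mid_coh _ _ := R'.iso_ext (by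
    simp [c.w₂_ω, c.w₂_γ, c.w₂_δ, c.w₂_χA, c.w₂_χB, c.w₂_fun2, c.w₂_map₂]; abel)
  hexR_coh _ _ _ := R'.iso_ext (by
    simp [c.w₂_ω, c.w₂_υ, c.w₂_χA, c.w₂_χB, c.w₂_fun3, c.w₂_map₂]; abel)
  hexS_coh _ _ _ := R'.iso_ext (by
    simp [c.w₂_ωI, c.w₂_υ, c.w₂_χA, c.w₂_χB, c.w₂_fun3, c.w₂_map₂]; abel)
  syl_coh _ _ := R'.iso_ext (by
    simp [c.w₂_υ, c.w₂_fun2, c.w₂_map₂, c.w₂_mapId]; abel)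

section Trans

variable [SymMonBicatData M] [SymMonBicatData N] {R : Weighting M T} {R' : Weighting N T}
  {F G : SymMonFunctorData M N}

lemma w₀_obj_eq_add (c : Comparison R R' F) (c' : Comparison R R' G) (x : M) :
    R'.w₀ (G.obj x) = R'.w₀ (F.obj x) + T.g.hom (c'.q₀ x - c.q₀ x) := by
  simp only [c.w₀_obj, c'.w₀_obj, map_sub]; abel

variable [R'.IsEquivalence] (c : Comparison R R' F) (c' : Comparison R R' G)

/-- The component at `x` of the transformation between two pseudofunctors with comparisons. -/
noncomputable def transApp (x : M) : F.obj x ⟶ G.obj x := R'.mor _ (w₀_obj_eq_add c c' x)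

/-- The defect of the weight of `transApp c c' x`. -/
noncomputable def transDefect (x : M) : T.X₁ := R'.morDefect _ (w₀_obj_eq_add c c' x)

lemma w₁_transApp (x : M) :
    R'.w₁ (transApp c c' x) = c'.q₀ x - c.q₀ x + T.f.hom (transDefect c c' x) :=
  R'.w₁_mor _ _

/-- Any two pseudofunctors with comparisons are related by a symmetric monoidal transformation. -/
noncomputable def trans : SymMonTrans F G where
  app := transApp c c'
  naturality {x y} f :=
    R'.iso (transDefect c c' x + c'.q₁ f - c.q₁ f - transDefect c c' y) (by
      simp only [Weighting.w₁_comp, c.w₁_map, c'.w₁_map, w₁_transApp, map_add, map_sub]; abel)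
  naturality_naturality _ := R'.hom_ext (by simp [c.w₂_map₂, c'.w₂_map₂]; abel)
  naturality_id _ := R'.hom_ext (by simp [c.w₂_mapId, c'.w₂_mapId]; abel)
  naturality_comp _ _ := R'.hom_ext (by simp [c.w₂_mapComp, c'.w₂_mapComp]; abel)
  m₂ x y := R'.iso (transDefect c c' x + transDefect c c' y + c'.qχ x y - c.qχ x y -
      transDefect c c' (x ⊠ y)) (by
    simp only [Weighting.w₁_comp, Weighting.w₁_tensor, c.w₁_χ, c'.w₁_χ, w₁_transApp, map_add,
      map_sub]
    abel)
  m₀ := R'.iso (c'.qι - c.qι - transDefect c c' (one M)) (by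
    simp only [Weighting.w₁_comp, c.w₁_ι, c'.w₁_ι, w₁_transApp, map_sub]; abel)
  m₂_mod _ _ := R'.iso_ext (by simp [c.w₂_χN, c'.w₂_χN]; abel)
  ω_coh _ _ _ := R'.iso_ext (by simp [c.w₂_ω, c'.w₂_ω]; abel)
  γ_coh _ := R'.iso_ext (by simp [c.w₂_γ, c'.w₂_γ]; abel)
  δ_coh _ := R'.iso_ext (by simp [c.w₂_δ, c'.w₂_δ]; abel)
  υ_coh _ _ := R'.iso_ext (by simp [c.w₂_υ, c'.w₂_υ]; abel)

end Trans

end Comparison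

namespace Weighting

section Transport

variable [SymMonBicatData M] [SymMonBicatData N] (R : Weighting M T) (R' : Weighting N T)
  [R'.IsEquivalence]

/-- The transport pseudofunctor sends an object to one with cohomologous weight. -/
noncomputable def transportObj (x : M) : N := R'.obj (R.w₀ x)

/-- The cochain by whose coboundary transport changes the weight of an object. -/
noncomputable def transportDefect₀ (x : M) : T.X₂ := R'.objDefect (R.w₀ x)

lemma w₀_transportObj (x : M) :
    R'.w₀ (transportObj R R' x) = R.w₀ x + T.g.hom (transportDefect₀ R R' x) :=
  R'.w₀_obj _

lemma w₀_transportObj_target {x y : M} (f : x ⟶ y) :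
    R'.w₀ (transportObj R R' y) = R'.w₀ (transportObj R R' x) +
      T.g.hom (R.w₁ f + transportDefect₀ R R' y - transportDefect₀ R R' x) := by
  simp only [w₀_transportObj, R.w₀_target f, map_add, map_sub]; abel

/-- The transport pseudofunctor on 1-morphisms. -/
noncomputable def transportMap {x y : M} (f : x ⟶ y) : transportObj R R' x ⟶ transportObj R R' y :=
  R'.mor _ (w₀_transportObj_target R R' f)

/-- The cochain by whose coboundary transport changes the weight of a 1-morphism, beyond the
change caused by its source and target. -/
noncomputable def transportDefect₁ {x y : M} (f : x ⟶ y) : T.X₁ :=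
  R'.morDefect _ (w₀_transportObj_target R R' f)

lemma w₁_transportMap {x y : M} (f : x ⟶ y) : R'.w₁ (transportMap R R' f) =
    R.w₁ f + transportDefect₀ R R' y - transportDefect₀ R R' x +
      T.f.hom (transportDefect₁ R R' f) :=
  R'.w₁_mor _ _

/-- The transport pseudofunctor between two weighted bicategories. -/
noncomputable def transportPseudofunctor : M ⥤ᵖ N where
  obj := transportObj R R'
  map := transportMap R R'
  map₂ {_ _ f g} η := (R'.iso (R.w₂ η + transportDefect₁ R R' g - transportDefect₁ R R' f) (by
    simp only [w₁_transportMap, R.w₁_target η, map_add, map_sub]; abel)).hom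
  map₂_id _ := R'.hom_ext (by simp)
  map₂_comp _ _ := R'.hom_ext (by simp; abel)
  mapId x := R'.iso (-transportDefect₁ R R' (𝟙 x)) (by simp [w₁_transportMap])
  mapComp f g := R'.iso
    (transportDefect₁ R R' f + transportDefect₁ R R' g - transportDefect₁ R R' (f ≫ g)) (by
      simp only [w₁_transportMap, w₁_comp, map_add, map_sub]; abel)
  map₂_whisker_left _ _ _ _ := R'.hom_ext (by simp; abel)
  map₂_whisker_right _ _ := R'.hom_ext (by simp; abel)
  map₂_associator _ _ _ := R'.hom_ext (by simp; abel)
  map₂_left_unitor _ := R'.hom_ext (by simp; abel)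
  map₂_right_unitor _ := R'.hom_ext (by simp; abel)

lemma w₀_transportObj_tensor (x y : M) : R'.w₀ (transportObj R R' (x ⊠ y)) =
    R'.w₀ (transportObj R R' x ⊠ transportObj R R' y) + T.g.hom
      (transportDefect₀ R R' (x ⊠ y) - transportDefect₀ R R' x - transportDefect₀ R R' y) := by
  simp only [w₀_transportObj, w₀_tensor, map_sub]; abel

/-- The tensor comparison of the transport pseudofunctor. -/
noncomputable def transportTensor (x y : M) :
    transportObj R R' x ⊠ transportObj R R' y ⟶ transportObj R R' (x ⊠ y) :=
  R'.mor _ (w₀_transportObj_tensor R R' x y)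

/-- The defect of the weight of `transportTensor R R' x y`. -/
noncomputable def transportTensorDefect (x y : M) : T.X₁ :=
  R'.morDefect _ (w₀_transportObj_tensor R R' x y)

lemma w₁_transportTensor (x y : M) : R'.w₁ (transportTensor R R' x y) =
    transportDefect₀ R R' (x ⊠ y) - transportDefect₀ R R' x - transportDefect₀ R R' y +
      T.f.hom (transportTensorDefect R R' x y) :=
  R'.w₁_mor _ _

lemma w₀_transportObj_one : R'.w₀ (transportObj R R' (one M)) =
    R'.w₀ (one N) + T.g.hom (transportDefect₀ R R' (one M)) := by
  simp [w₀_transportObj]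

/-- The unit comparison of the transport pseudofunctor. -/
noncomputable def transportUnit : one N ⟶ transportObj R R' (one M) :=
  R'.mor _ (w₀_transportObj_one R R')

/-- The defect of the weight of `transportUnit R R'`. -/
noncomputable def transportUnitDefect : T.X₁ := R'.morDefect _ (w₀_transportObj_one R R')

lemma w₁_transportUnit : R'.w₁ (transportUnit R R') =
    transportDefect₀ R R' (one M) + T.f.hom (transportUnitDefect R R') :=
  R'.w₁_mor _ _

/-- The structure cells of the transport pseudofunctor, with the weights that `Comparison`
prescribes. -/
noncomputable def transportData : SymMonFunctorData M N where
  toPseudofunctor := transportPseudofunctor R R'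
  χ := transportTensor R R'
  χN {x x' y y'} f g := R'.iso (transportTensorDefect R R' x y + transportDefect₁ R R' (f ⊠₁ g) -
      transportDefect₁ R R' f - transportDefect₁ R R' g - transportTensorDefect R R' x' y') (by
    simp only [transportPseudofunctor, w₁_comp, w₁_tensor, w₁_transportMap, w₁_transportTensor,
      map_add, map_sub]
    abel)
  ι := transportUnit R R'
  ω x y z := R'.iso (transportTensorDefect R R' y z + transportTensorDefect R R' x (y ⊠ z) -
      transportTensorDefect R R' x y - transportTensorDefect R R' (x ⊠ y) z -
      transportDefect₁ R R' (as x y z)) (by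
    simp only [transportPseudofunctor, w₁_comp, w₁_tensor, w₁_transportMap, w₁_transportTensor,
      w₁_id, w₁_asc, map_add, map_sub]
    abel)
  γ x := R'.iso (-transportUnitDefect R R' - transportTensorDefect R R' (one M) x -
      transportDefect₁ R R' (lu x).hom) (by
    simp only [transportPseudofunctor, w₁_comp, w₁_tensor, w₁_transportMap, w₁_transportTensor,
      w₁_transportUnit, w₁_id, w₁_lu, map_neg, map_sub]
    abel)
  δ x := R'.iso (-transportUnitDefect R R' - transportTensorDefect R R' x (one M) -
      transportDefect₁ R R' (ru x).hom) (by
    simp only [transportPseudofunctor, w₁_comp, w₁_tensor, w₁_transportMap, w₁_transportTensor,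
      w₁_transportUnit, w₁_id, w₁_ru, map_neg, map_sub]
    abel)
  υ x y := R'.iso (transportTensorDefect R R' y x - transportTensorDefect R R' x y -
      transportDefect₁ R R' (bt x y)) (by
    simp only [transportPseudofunctor, w₁_comp, w₁_transportMap, w₁_transportTensor, w₁_br, map_sub]
    abel)

/-- The comparison along the transport pseudofunctor. -/
noncomputable def transportComparison : Comparison R R' (transportData R R') where
  q₀ := transportDefect₀ R R'
  q₁ := transportDefect₁ R R'
  qχ := transportTensorDefect R R'
  qι := transportUnitDefect R R'
  w₀_obj := w₀_transportObj R R'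
  w₁_map := w₁_transportMap R R'
  w₂_map₂ _ := by simp only [transportData, transportPseudofunctor, w₂_iso]
  w₂_mapId _ := by simp only [transportData, transportPseudofunctor, w₂_iso]
  w₂_mapComp _ _ := by simp only [transportData, transportPseudofunctor, w₂_iso]
  w₁_χ := w₁_transportTensor R R'
  w₁_ι := w₁_transportUnit R R'
  w₂_χN _ _ := by simp only [transportData]; exact R'.w₂_iso _ _
  w₂_ω _ _ _ := by simp only [transportData]; exact R'.w₂_iso _ _
  w₂_γ _ := by simp only [transportData]; exact R'.w₂_iso _ _
  w₂_δ _ := by simp only [transportData]; exact R'.w₂_iso _ _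
  w₂_υ _ _ := by simp only [transportData]; exact R'.w₂_iso _ _

end Transport

/-- Symmetric monoidal bicategories with equivalences to the same complex are equivalent: transport
there and back is compared with the identity. -/
noncomputable def equivalence [SymMonBicat M] [SymMonBicat N] (R : Weighting M T)
    (R' : Weighting N T) [R.IsEquivalence] [R'.IsEquivalence] : SymMonEquivalence M N where
  F := (transportComparison R R').toSymMonFunctor
  G := (transportComparison R' R).toSymMonFunctor
  unit := (Comparison.id R).trans ((transportComparison R R').comp (transportComparison R' R))
  unit_equiv _ := R.isEquiv _
  counit := ((transportComparison R' R).comp (transportComparison R R')).trans (Comparison.id R')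
  counit_equiv _ := R'.isEquiv _

end Weighting

end Comparisons

/-! ### Resolution of the cohomology by divisible groups -/

section Divisible

variable {A X Y E : Type u} [AddCommGroup A] [AddCommGroup X] [AddCommGroup Y] [AddCommGroup E]

lemma exists_injective_to_divisible (A : Type u) [AddCommGroup A] :
    ∃ (E : Type u) (_ : AddCommGroup E) (_ : DivisibleBy E ℤ) (i : A →+ E),
      Function.Injective i :=
  ⟨CharacterModule A → AddCircle (1 : ℚ), inferInstance, inferInstance,
    AddMonoidHom.mk' (fun a c => c a) fun a b => funext fun c => map_add c a b,
    (injective_iff_map_eq_zero _).2 fun _ h =>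
      CharacterModule.eq_zero_of_character_apply fun c => congrFun h c⟩

lemma exists_extension_of_ker_le [DivisibleBy E ℤ] (d : X →+ Y) (f : X →+ E)
    (h : d.ker ≤ f.ker) : ∃ g : Y →+ E, ∀ x, g (d x) = f x := by
  obtain ⟨g, hg⟩ := (Module.Baer.of_divisible E).extension_property_addMonoidHom
    (QuotientAddGroup.kerLift d) (QuotientAddGroup.kerLift_injective d)
    (QuotientAddGroup.lift d.ker f h)
  exact ⟨g, fun x => DFunLike.congr_fun hg (x : X ⧸ d.ker)⟩

/-- The quotients of a divisible group are divisible. -/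
noncomputable abbrev divisibleQuotient [DivisibleBy E ℤ] (H : AddSubgroup E) :
    DivisibleBy (E ⧸ H) ℤ :=
  (QuotientAddGroup.mk_surjective (s := H)).divisibleBy (QuotientAddGroup.mk' H) fun _ _ => rfl

lemma exists_extension_to_resolution [DivisibleBy E ℤ] (i : A →+ E) (d : X →+ Y)
    (q : d.ker →+ A) : ∃ (f : X →+ E) (f' : Y →+ E ⧸ i.range),
      (∀ x : d.ker, f x = i (q x)) ∧ ∀ x, f' (d x) = (f x : E ⧸ i.range) := by
  let _ := divisibleQuotient i.range
  obtain ⟨f, hf⟩ := exists_extension_of_ker_le d.ker.subtype (i.comp q) (fun x hx => by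
    rw [show x = 0 from Subtype.ext hx]; exact map_zero _)
  obtain ⟨f', hf'⟩ := exists_extension_of_ker_le d ((QuotientAddGroup.mk' i.range).comp f)
    fun x hx => (QuotientAddGroup.eq_zero_iff _).2 ⟨q ⟨x, hx⟩, (hf ⟨x, hx⟩).symm⟩
  exact ⟨f, f', hf, hf'⟩

end Divisible

section Roof

variable {A₁ A₂ A₃ E₁ E₂ : Type u} [AddCommGroup A₁] [AddCommGroup A₂] [AddCommGroup A₃]
  [AddCommGroup E₁] [AddCommGroup E₂]

lemma coe_range_eq_zero (i : A₁ →+ E₁) (a : A₁) : (i a : E₁ ⧸ i.range) = 0 :=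
  (QuotientAddGroup.eq_zero_iff (i a)).2 ⟨a, rfl⟩

/-- The sum of the resolutions `E₁ ⟶ E₁ ⧸ A₁` and `E₂ ⟶ E₂ ⧸ A₂`, starting in degrees 1 and 2, and
of `A₃` in degree 3. For injective `i₁` and `i₂` its cohomology is `A₁`, `A₂`, `A₃`. -/
abbrev roof (i₁ : A₁ →+ E₁) (i₂ : A₂ →+ E₂) (A₃ : Type u) [AddCommGroup A₃] :
    ShortComplex Ab.{u} :=
  ShortComplex.mk (X₁ := .of E₁) (X₂ := .of ((E₁ ⧸ i₁.range) × E₂))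
    (X₃ := .of (A₃ × (E₂ ⧸ i₂.range)))
    (AddCommGrpCat.ofHom ((QuotientAddGroup.mk' i₁.range).prod 0))
    (AddCommGrpCat.ofHom (AddMonoidHom.prodMap 0 (QuotientAddGroup.mk' i₂.range)))
    (by ext e <;> rfl)

/-- The inclusion of the cohomology of a roof. -/
def toRoof (i₁ : A₁ →+ E₁) (i₂ : A₂ →+ E₂) (A₃ : Type u) [AddCommGroup A₃] :
    zeroDifferential A₁ A₂ A₃ ⟶ roof i₁ i₂ A₃ where
  τ₁ := AddCommGrpCat.ofHom i₁
  τ₂ := AddCommGrpCat.ofHom ((AddMonoidHom.inr _ _).comp i₂)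
  τ₃ := AddCommGrpCat.ofHom (AddMonoidHom.inl _ _)
  comm₁₂ := by ext a; exacts [coe_range_eq_zero i₁ a, (map_zero i₂).symm]
  comm₂₃ := by ext a; exacts [rfl, coe_range_eq_zero i₂ a]

open QuotientAddGroup in
lemma isQuasiIso_toRoof {i₁ : A₁ →+ E₁} {i₂ : A₂ →+ E₂} (hi₁ : Function.Injective i₁)
    (hi₂ : Function.Injective i₂) : IsQuasiIso (toRoof i₁ i₂ A₃) where
  eq_zero_of_map_eq_zero _ h := (map_eq_zero_iff i₁ hi₁).1 h
  exists_lift₁ {c q} _ h := by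
    obtain ⟨e, he⟩ := (eq_zero_iff q).1 (congrArg Prod.fst h).symm
    exact ⟨e, ((map_eq_zero_iff i₂ hi₂).1 (congrArg Prod.snd h)).symm, he⟩
  exists_lift₂ {x q} h := by
    obtain ⟨c, hc⟩ := (eq_zero_iff q.2).1 (congrArg Prod.snd h).symm
    obtain ⟨p, hp⟩ := mk_surjective (-q.1)
    refine ⟨c, p, (congrArg Prod.fst h).symm, Prod.ext ?_ ?_⟩
    · exact (add_neg_cancel q.1).symm.trans (congrArg (q.1 + ·) hp.symm)
    · exact hc.trans (add_zero q.2).symm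
  exists_lift₃ q := by
    obtain ⟨p, hp⟩ := mk_surjective (-q.2)
    refine ⟨q.1, (0, p), Prod.ext (add_zero q.1).symm ?_⟩
    exact (add_neg_cancel q.2).symm.trans (congrArg (q.2 + ·) hp.symm)

variable {S : ShortComplex Ab.{u}} {i₁ : H1 S →+ E₁} {i₂ : H2 S →+ E₂}

/-- A cochain map from `S` to the roof over its cohomology that induces the identity on
cohomology. -/
structure ExtendsCohomology (φ : S ⟶ roof i₁ i₂ (H3 S)) : Prop where
  τ₁_apply (e : H1 S) : φ.τ₁.hom e = i₁ e
  τ₂_apply (c : S.g.hom.ker) : (φ.τ₂.hom c).2 = i₂ (c : H2 S)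
  τ₃_apply (x : S.X₃) : (φ.τ₃.hom x).1 = (x : H3 S)

open QuotientAddGroup in
lemma exists_extendsCohomology (i₁ : H1 S →+ E₁) (i₂ : H2 S →+ E₂) [DivisibleBy E₁ ℤ]
    [DivisibleBy E₂ ℤ] : ∃ φ : S ⟶ roof i₁ i₂ (H3 S), ExtendsCohomology φ := by
  obtain ⟨f₁, f₂, hf₁, hf₂⟩ := exists_extension_to_resolution i₁ S.f.hom (.id _)
  obtain ⟨k₂, k₃, hk₂, hk₃⟩ := exists_extension_to_resolution i₂ S.g.hom (mk' S.abToCycles.range)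
  have k₂_boundary (e : S.X₁) : k₂ (S.f.hom e) = 0 := (hk₂ (S.abToCycles e)).trans <| by
    rw [mk'_apply, coe_range_eq_zero, map_zero]
  exact ⟨{
    τ₁ := AddCommGrpCat.ofHom f₁
    τ₂ := AddCommGrpCat.ofHom (f₂.prod k₂)
    τ₃ := AddCommGrpCat.ofHom ((mk' S.g.hom.range).prod k₃)
    comm₁₂ := by ext e; exacts [(hf₂ e).symm, (k₂_boundary e).symm]
    comm₂₃ := by ext c; exacts [(coe_range_eq_zero S.g.hom c).symm, (hk₃ c).symm] },
    hf₁, hk₂, fun _ => rfl⟩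

namespace ExtendsCohomology

variable {φ : S ⟶ roof i₁ i₂ (H3 S)}

open QuotientAddGroup

lemma exists_lift₁ (hφ : ExtendsCohomology φ) (hi₂ : Function.Injective i₂) {c : S.X₂} {q : E₁}
    (hc : S.g.hom c = 0) (h : φ.τ₂.hom c = (roof i₁ i₂ (H3 S)).f.hom q) :
    ∃ e, S.f.hom e = c ∧ φ.τ₁.hom e = q := by
  have class_eq_zero : ((⟨c, hc⟩ : S.g.hom.ker) : H2 S) = 0 :=
    (map_eq_zero_iff i₂ hi₂).1 ((hφ.τ₂_apply ⟨c, hc⟩).symm.trans (congrArg Prod.snd h))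
  obtain ⟨e, he⟩ := (eq_zero_iff _).1 class_eq_zero
  obtain rfl : S.f.hom e = c := congrArg Subtype.val he
  have class_eq : mk' i₁.range (φ.τ₁.hom e) = mk' i₁.range q :=
    congrArg Prod.fst ((map_f φ e).symm.trans h)
  obtain ⟨_, ⟨a, rfl⟩, ha⟩ := (mk'_eq_mk' _).1 class_eq
  refine ⟨e + a, ?_, ?_⟩
  · rw [map_add, show S.f.hom a = 0 from a.2, add_zero]
  · rw [map_add, hφ.τ₁_apply, ha]

lemma exists_lift₂ (hφ : ExtendsCohomology φ) {x : S.X₃} {q : (roof i₁ i₂ (H3 S)).X₂}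
    (h : φ.τ₃.hom x = (roof i₁ i₂ (H3 S)).g.hom q) :
    ∃ c p, S.g.hom c = x ∧ φ.τ₂.hom c = q + (roof i₁ i₂ (H3 S)).f.hom p := by
  obtain ⟨c, rfl⟩ := (eq_zero_iff x).1 ((hφ.τ₃_apply x).symm.trans (congrArg Prod.fst h))
  have class_eq : mk' i₂.range (φ.τ₂.hom c).2 = mk' i₂.range q.2 :=
    congrArg Prod.snd ((map_g φ c).symm.trans h)
  obtain ⟨_, ⟨a, rfl⟩, ha⟩ := (mk'_eq_mk' _).1 class_eq
  obtain ⟨z, rfl⟩ := mk_surjective a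
  obtain ⟨p, hp⟩ := mk_surjective ((φ.τ₂.hom (c + z)).1 - q.1)
  refine ⟨c + z, p, ?_, Prod.ext ?_ ?_⟩
  · rw [map_add, show S.g.hom z = 0 from z.2, add_zero]
  · exact (add_sub_cancel q.1 _).symm.trans (congrArg (q.1 + ·) hp.symm)
  · calc (φ.τ₂.hom (c + z)).2 = (φ.τ₂.hom c).2 + (φ.τ₂.hom z).2 :=
          congrArg Prod.snd (map_add φ.τ₂.hom c z)
      _ = q.2 := by rw [hφ.τ₂_apply, ha]
      _ = q.2 + 0 := (add_zero _).symm

lemma isQuasiIso (hφ : ExtendsCohomology φ) (hi₁ : Function.Injective i₁)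
    (hi₂ : Function.Injective i₂) : IsQuasiIso φ where
  eq_zero_of_map_eq_zero {e} he h := congrArg Subtype.val
    ((map_eq_zero_iff i₁ hi₁).1 ((hφ.τ₁_apply ⟨e, he⟩).symm.trans h))
  exists_lift₁ := hφ.exists_lift₁ hi₂
  exists_lift₂ := hφ.exists_lift₂
  exists_lift₃ q := by
    obtain ⟨x, hx⟩ := mk_surjective q.1
    obtain ⟨p, hp⟩ := mk_surjective ((φ.τ₃.hom x).2 - q.2)
    refine ⟨x, (0, p), Prod.ext ?_ ?_⟩
    · exact (hφ.τ₃_apply x).trans (hx.trans (add_zero q.1).symm)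
    · exact (add_sub_cancel q.2 _).symm.trans (congrArg (q.2 + ·) hp.symm)

end ExtendsCohomology

end Roof

/-- The complex and its cohomology, with zero differentials, map quasi-isomorphically to a roof. -/
theorem nonempty_equivalence_split (S : ShortComplex Ab.{u}) :
    Nonempty (SymMonEquivalence (CochainBicat S) (Split S)) := by
  obtain ⟨E₁, _, _, i₁, hi₁⟩ := exists_injective_to_divisible (H1 S)
  obtain ⟨E₂, _, _, i₂, hi₂⟩ := exists_injective_to_divisible (H2 S)
  obtain ⟨φ, hφ⟩ := exists_extendsCohomology i₁ i₂
  let R := (Weighting.self S).map φ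
  let R' := (Weighting.split (H1 S) (H2 S) (H3 S)).map (toRoof i₁ i₂ (H3 S))
  have : R.IsEquivalence := Weighting.isEquivalence_map _ (hφ.isQuasiIso hi₁ hi₂)
  have : R'.IsEquivalence := Weighting.isEquivalence_map _ (isQuasiIso_toRoof hi₁ hi₂)
  exact ⟨R.equivalence R'⟩

/-! ### Failure of naturality -/

section NonNaturality

namespace Weighting

variable {B : Type u} [Bicategory.{w, v} B] {C : Type u₁} [Bicategory.{w₁, v₁} C]
  [SymMonBicatData C] {T T' : ShortComplex Ab.{t}} (R : Weighting C T)

lemma w₂_naturality_naturality {F G : B ⥤ᵖ C} (θ : F.StrongTrans G) {x y : B} {a b : x ⟶ y}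
    (η : a ⟶ b) : R.w₂ (F.map₂ η) + R.w₂ (θ.naturality b).hom =
      R.w₂ (θ.naturality a).hom + R.w₂ (G.map₂ η) := by
  simpa only [w₂_comp, w₂_whiskerRight, w₂_whiskerLeft] using
    congrArg R.w₂ (θ.naturality_naturality η)

lemma w₂_naturality_comp {F G : B ⥤ᵖ C} (θ : F.StrongTrans G) {x y z : B} (a : x ⟶ y)
    (b : y ⟶ z) : R.w₂ (θ.naturality (a ≫ b)).hom + R.w₂ (G.mapComp a b).hom =
      R.w₂ (F.mapComp a b).hom + (R.w₂ (θ.naturality b).hom + R.w₂ (θ.naturality a).hom) := by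
  simpa only [w₂_comp, w₂_whiskerRight, w₂_whiskerLeft, w₂_associator, w₂_inv, neg_zero,
    add_zero, zero_add] using congrArg R.w₂ (θ.naturality_comp a b)

/-- The coherence constraints of `θ` express the weight of `F.map₂ η` through those of `θ` at `a`
and `b`, each of which enters twice. -/
lemma even_w₂_map₂ {F G : B ⥤ᵖ C} (θ : F.StrongTrans G)
    (w₂_map₂_eq_zero : ∀ {x y : B} {a b : x ⟶ y} (η : a ⟶ b), R.w₂ (G.map₂ η) = 0)
    (w₂_mapComp_eq_zero : ∀ {x y z : B} (a : x ⟶ y) (b : y ⟶ z), R.w₂ (G.mapComp a b).hom = 0)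
    {x : B} {a b : x ⟶ x} (η : a ≫ a ⟶ b ≫ b)
    (hF : R.w₂ (F.mapComp a a).hom = R.w₂ (F.mapComp b b).hom) : Even (R.w₂ (F.map₂ η)) := by
  have naturality_sq (c : x ⟶ x) : R.w₂ (θ.naturality (c ≫ c)).hom =
      R.w₂ (F.mapComp c c).hom + (R.w₂ (θ.naturality c).hom + R.w₂ (θ.naturality c).hom) := by
    rw [← w₂_naturality_comp, w₂_mapComp_eq_zero, add_zero]
  have naturality_η := R.w₂_naturality_naturality θ η
  rw [w₂_map₂_eq_zero, add_zero, ← eq_sub_iff_add_eq, naturality_sq, naturality_sq, hF]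
    at naturality_η
  exact ⟨R.w₂ (θ.naturality a).hom - R.w₂ (θ.naturality b).hom, by rw [naturality_η]; abel⟩

lemma even_w₂_of_even_w₂_map₂ [SymMonBicatData B] {R' : Weighting B T'} [R.IsEquivalence]
    (hT : T.f = 0) {F : B ⥤ᵖ C} {G : C ⥤ᵖ B} (θ : (Pseudofunctor.id B).StrongTrans (F.comp G))
    {x y : B} {a : x ⟶ y} {η : a ⟶ a} (h : Even (R.w₂ (F.map₂ η))) : Even (R'.w₂ η) := by
  obtain ⟨q, hq⟩ := h
  obtain ⟨ζ, rfl⟩ := IsEquivalence.full₂ (R := R) (F.map a) (F.map a) q (by simp [hT])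
  have map₂_eq : F.map₂ η = ζ ≫ ζ := R.hom_ext (by rw [hq, w₂_comp])
  refine ⟨R'.w₂ (G.map₂ ζ), ?_⟩
  calc R'.w₂ η = R'.w₂ (G.map₂ (F.map₂ η)) :=
        add_right_cancel ((R'.w₂_naturality_naturality θ η).trans (add_comm _ _))
    _ = R'.w₂ (G.map₂ ζ) + R'.w₂ (G.map₂ ζ) := by rw [map₂_eq, G.map₂_comp, w₂_comp]

end Weighting

open CochainBicat

lemma shift2_hom_eq {A : Type u} [AddCommGroup A] {x y : Shift2 A} (a b : x ⟶ y) : a = b :=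
  Hom₁.ext (Subsingleton.elim (α := PUnit) _ _)

lemma even_v₂_of_even_w₂_map₂ {A : Type u} [AddCommGroup A] {C : Type u₁}
    [Bicategory.{w₁, v₁} C] [SymMonBicat C] (Φ : SymMonEquivalence (Shift2 A) C)
    {T : ShortComplex Ab.{u}} {R : Weighting C T} [R.IsEquivalence] (hT : T.f = 0)
    {x y : Shift2 A} {a b : x ⟶ y} {η : a ⟶ b} (h : Even (R.w₂ (Φ.F.map₂ η))) :
    Even (v₂ η) := by
  obtain rfl := shift2_hom_eq a b
  exact R.even_w₂_of_even_w₂_map₂ (R' := .self (conc1 A)) hT Φ.unit.toStrongTrans h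

lemma w₂_map₂_comp_mapComp_congr {A : Type u} [AddCommGroup A] {C : Type u₁}
    [Bicategory.{w₁, v₁} C] [SymMonBicatData C] {T : ShortComplex Ab.{t}} (R : Weighting C T)
    (F : Shift2 A ⥤ᵖ C) {x y z : Shift2 A} {a a' : x ⟶ y} {b b' : y ⟶ z} {c c' : x ⟶ z}
    {η : c ⟶ a ≫ b} {η' : c' ⟶ a' ≫ b'} (h : v₂ η = v₂ η') :
    R.w₂ (F.map₂ η ≫ (F.mapComp a b).hom) = R.w₂ (F.map₂ η' ≫ (F.mapComp a' b').hom) := by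
  obtain rfl := shift2_hom_eq a a'
  obtain rfl := shift2_hom_eq b b'
  obtain rfl := shift2_hom_eq c c'
  rw [hom₂_ext h]

/-- The complex `ℤ ⟶ ℤ ⟶ 0` with first differential multiplication by two. -/
abbrev multTwo : ShortComplex Ab.{u} :=
  ShortComplex.mk (X₁ := .of (ULift.{u} ℤ)) (X₂ := .of (ULift.{u} ℤ)) (X₃ := .of PUnit)
    (AddCommGrpCat.ofHom (nsmulAddMonoidHom 2)) 0 (by simp)

/-- The cochain map to `ℤ`, placed in degree 1, that is the identity in degree 1. -/
def multTwoMap : multTwo.{u} ⟶ conc1 (ULift.{u} ℤ) where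
  τ₁ := 𝟙 _
  τ₂ := 0
  τ₃ := 0

lemma H1map_multTwoMap (x : H1 multTwo.{u}) : H1map multTwoMap x = 0 := by
  have two_mul_eq_zero : 2 * x.val.down = 0 :=
    (nsmul_eq_mul 2 _).symm.trans (congrArg ULift.down x.2)
  have x_eq_zero : x = 0 := Subtype.ext (ULift.ext _ _ (by simpa using two_mul_eq_zero))
  rw [x_eq_zero, map_zero]

/-- In degree 1 the generator of `ℤ` is a 2-morphism `𝟙 ≫ 𝟙 ⟶ one ≫ one` between squares, so
naturality makes its image, the generator of `ℤ[2]`, even. -/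
lemma multTwoMap_not_natural
    (Φ : SymMonEquivalence (CochainBicat multTwo.{u}) (Split multTwo.{u}))
    (Φ' : SymMonEquivalence (Shift2 (ULift.{u} ℤ)) (Split (conc1 (ULift.{u} ℤ))))
    (θ : Pseudofunctor.StrongTrans
      ((CochainBicat.map multTwoMap).comp Φ'.F.toPseudofunctor)
      (Φ.F.toPseudofunctor.comp (Split.map multTwoMap))) : False := by
  let R := Weighting.split (H1 (conc1 (ULift.{u} ℤ))) (H2 (conc1 (ULift.{u} ℤ)))
    (H3 (conc1 (ULift.{u} ℤ)))
  let one : (⟨0⟩ : CochainBicat multTwo.{u}) ⟶ ⟨0⟩ := mk₁ ⟨1⟩ rfl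
  let η : 𝟙 _ ≫ 𝟙 _ ⟶ one ≫ one := mk₂ ⟨1⟩
    (show (⟨1⟩ + ⟨1⟩ : ULift.{u} ℤ) = 0 + 0 + 2 • ⟨1⟩ by rw [two_nsmul, add_zero, zero_add])
  have even_w₂ : Even (R.w₂ (Φ'.F.map₂ ((CochainBicat.map multTwoMap).map₂ η))) :=
    R.even_w₂_map₂ θ (fun η => H1map_multTwoMap (v₂ (Φ.F.map₂ η).2.2))
      (fun a b => (add_zero _).trans (H1map_multTwoMap (v₂ (Φ.F.mapComp a b).hom.2.2))) η
      (w₂_map₂_comp_mapComp_congr R Φ'.F.toPseudofunctor rfl)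
  obtain ⟨z, hz⟩ : Even (⟨1⟩ : ULift.{u} ℤ) := even_v₂_of_even_w₂_map₂ Φ' rfl even_w₂
  have one_eq : (1 : ℤ) = z.down + z.down := congrArg ULift.down hz
  omega

end NonNaturality

/-! ### Equivalence classes of objects -/

section Components

open CochainBicat

variable {S : ShortComplex Ab.{u}}

lemma nonempty_equivalence_iff_coe_eq (x y : CochainBicat S) :
    Nonempty (x ≌ y) ↔ (x.val : H3 S) = y.val := by
  rw [QuotientAddGroup.eq]
  constructor
  · rintro ⟨e⟩
    exact ⟨v₁ e.hom, by rw [v₁_prop e.hom, neg_add_cancel_left]⟩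
  · rintro ⟨c, hc⟩
    exact ⟨Bicategory.Equivalence.mkOfAdjointifyCounit
      (f := mk₁ c (by rw [hc, add_neg_cancel_left]))
      (g := mk₁ (-c) (by rw [map_neg, hc, neg_add_rev, neg_neg, add_neg_cancel_left]))
      (eqIso (by simp)) (eqIso (by simp))⟩

/-- `π₀` of the bicategory of a complex is `H³`. -/
noncomputable def pi0Equiv (S : ShortComplex Ab.{u}) : Pi0 (CochainBicat S) ≃+ H3 S :=
  AddEquiv.ofBijective
    ({ toFun := Quotient.lift (fun x => (x.val : H3 S))
        fun x y => (nonempty_equivalence_iff_coe_eq x y).1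
       map_add' := by rintro ⟨x⟩ ⟨y⟩; rfl } : Pi0 (CochainBicat S) →ₙ+ H3 S)
    ⟨by rintro ⟨x⟩ ⟨y⟩ h; exact Quotient.sound ((nonempty_equivalence_iff_coe_eq x y).2 h),
      fun q => by
        obtain ⟨x, rfl⟩ := QuotientAddGroup.mk_surjective q
        exact ⟨Quotient.mk _ ⟨x⟩, rfl⟩⟩

end Components

end SymBicat

open CategoryTheory SymBicat in
theorem mainTheorem7 :
    (∀ S : ShortComplex Ab.{u}, Nonempty (SymMonEquivalence (CochainBicat S) (Split S))) ∧
    (¬ ∃ Φ : ∀ S : ShortComplex Ab.{u}, SymMonEquivalence (CochainBicat S) (Split S),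
      ∀ (S S' : ShortComplex Ab.{u}) (f : S ⟶ S'),
        ∃ θ : Pseudofunctor.StrongTrans
            ((CochainBicat.map f).comp (Φ S').F.toPseudofunctor)
            ((Φ S).F.toPseudofunctor.comp (Split.map f)),
          ∀ x, IsEquiv (θ.app x)) ∧
    (∃ φ : ∀ S : ShortComplex Ab.{u}, Pi0 (CochainBicat S) ≃+ H3 S,
      ∀ (S S' : ShortComplex Ab.{u}) (f : S ⟶ S') (x : Pi0 (CochainBicat S)),
        φ S' (Pi0.map (CochainBicat.map f) x) = H3map f (φ S x)) := by
  refine ⟨nonempty_equivalence_split, ?_, pi0Equiv, ?_⟩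
  · rintro ⟨Φ, h⟩
    obtain ⟨θ, -⟩ := h _ _ multTwoMap
    exact multTwoMap_not_natural _ _ θ
  · rintro S S' f ⟨x⟩
    rfl
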